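/- For $m\ge 2$ let $\Lambda_{K3^{[m]}} = U^{\oplus 3}\oplus E_8(-1)^{\oplus 2}\oplus \mathbf{Z}(-(2m-2))$. For $h\in\Lambda_{K3^{[m]}}$ with $h^2>0$ let $\mathscr{D}_{h^\perp}$ be the set of $x\in\mathbf{P}(h^\perp\otimes\mathbf{C})$ with $x^2=0$ and $x\cdot\bar x>0$, and let $\widehat O(\Lambda_{K3^{[m]}},h)$ be the group of isometries of $\Lambda_{K3^{[m]}}$ that fix $h$ and act as $\pm\mathrm{id}$ on the discriminant group of $\Lambda_{K3^{[m]}}$. The period domain of $h$ is the quotient $\mathscr{P}_h=\mathscr{D}_{h^\perp}/\widehat O(\Lambda_{K3^{[m]}},h)$. For an integer $d>0$, the Heegner divisor of discriminant $d$ in $\mathscr{P}_h$ is the union of the images of $\mathbf{P}(K^\perp\otimes\mathbf{C})\cap\mathscr{D}_{h^\perp}$, where $K$ runs over the rank-$2$ sublattices of $\Lambda_{K3^{[m]}}$ of real signature $(1,1)$ that contain $h$ and satisfy $\operatorname{disc}(K^\perp)=-d$; here $\operatorname{disc}$ is the determinant of a Gram matrix. Let $h_2\in\Lambda_{K3^{[2]}}$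 have square $2$ and divisibility $1$, and let $h_3\in\Lambda_{K3^{[3]}}$ have square $4$ and divisibility $2$. Let ${}^{[2]}\mathscr{P}_2^{(1)}$ and ${}^{[3]}\mathscr{P}_4^{(2)}$ be their period domains, with Heegner divisors ${}^{[2]}\mathscr{D}_{2,d}^{(1)}$ and ${}^{[3]}\mathscr{D}_{4,d}^{(2)}$. The lattices $h_2^\perp$ and $h_3^\perp$ are isometric, and every isometry $h_2^\perp\to h_3^\perp$ induces the same map $\rho\colon{}^{[2]}\mathscr{P}_2^{(1)}\to{}^{[3]}\mathscr{P}_4^{(2)}$. Let $d$ be a positive integer. The Heegner divisor ${}^{[3]}\mathscr{D}_{4,d}^{(2)}$ is nonempty if and only if $d=2e$ for an integer $e\not\equiv 3\pmod 4$. When this is the case, ${}^{[3]}\mathscr{D}_{4,2e}^{(2)}$ is irreducible (it is a closed analytic subset of ${}^{[3]}\mathscr{P}_4^{(2)}$ that is not the union of two proper closed analytic subsets), and it is the image by $\rho$ of the Heegner divisor ${}^{[2]}\mathscr{D}_{2,2e}^{(1)}$. -/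

import Mathlib

open scoped TensorProduct LinearAlgebra.Projectivization

noncomputable section

namespace K3Heegner

/-! ### The lattices -/

abbrev K3Index := (Fin 2 × Fin 3) ⊕ (Fin 8 × Fin 2)

abbrev K3mIndex := K3Index ⊕ Unit

/-- The Gram matrix of the K3 lattice `U^3 ⊕ E₈(-1)^2`. -/
def k3Gram : Matrix K3Index K3Index ℤ :=
  Matrix.fromBlocks (Matrix.blockDiagonal fun _ : Fin 3 => !![0, 1; 1, 0]) 0
    0 (Matrix.blockDiagonal fun _ : Fin 2 => -CartanMatrix.E₈)

/-- The Gram matrix of `Λ_{K3^[m]} = Λ_{K3} ⊕ ℤ(-(2m-2))`. -/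
def k3mGram (m : ℕ) : Matrix K3mIndex K3mIndex ℤ :=
  Matrix.fromBlocks k3Gram 0 0 (Matrix.of fun _ _ => -(2 * (m : ℤ) - 2))

/-- The free abelian group underlying `Λ_{K3^[m]}`; its form is `k3mForm m`. -/
abbrev K3mLattice := K3mIndex → ℤ

def k3mForm (m : ℕ) : LinearMap.BilinForm ℤ K3mLattice := Matrix.toBilin' (k3mGram m)

section Lattice

variable {Λ : Type*} [AddCommGroup Λ] (B : LinearMap.BilinForm ℤ Λ) (h : Λ)

/-- `n` is the divisibility of `h`: the ideal `B(h, Λ)` of `ℤ` is generated by `n`. -/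
def HasDivisibility (n : ℕ) : Prop :=
  LinearMap.range (B h) = Ideal.span {(n : ℤ)}

/-- The sublattice `h^⊥`. -/
abbrev perp : Submodule ℤ Λ := LinearMap.ker (B h)

/-- The form of `h^⊥`. -/
abbrev perpForm : LinearMap.BilinForm ℤ (perp B h) := B.restrict (perp B h)

/-- The discriminant group `Λ^∨ / Λ`. -/
abbrev DiscriminantGroup := Module.Dual ℤ Λ ⧸ LinearMap.range B

variable {B} in
/-- The isometry `g` (acting on `Λ^∨` by `f ↦ f ∘ g⁻¹`) acts on the discriminant group as `id` or
as `-id`. -/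
def ActsBySign (g : B.IsometryEquiv B) : Prop :=
  ∃ ε : ℤˣ, ∀ f : Module.Dual ℤ Λ,
    (Submodule.Quotient.mk (f ∘ₗ (g.symm : Λ ≃ₗ[ℤ] Λ).toLinearMap) : DiscriminantGroup B) =
      (ε : ℤ) • Submodule.Quotient.mk f

/-- The isometries of `h^⊥` that are restrictions of elements of `Ô(Λ, h)`, the group of isometries
of `Λ` that fix `h` and act as `± id` on the discriminant group of `Λ`. -/
def InPeriodGroup (γ : (perpForm B h).IsometryEquiv (perpForm B h)) : Prop :=
  ∃ g : B.IsometryEquiv B, g h = h ∧ ActsBySign g ∧ ∀ y : perp B h, (γ y : Λ) = g y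

variable {B h}

theorem InPeriodGroup.refl :
    InPeriodGroup B h (LinearMap.BilinForm.IsometryEquiv.refl (perpForm B h)) := by
  refine ⟨LinearMap.BilinForm.IsometryEquiv.refl B, rfl, ⟨1, fun f => ?_⟩, fun y => rfl⟩
  simp only [Units.val_one, one_smul]
  rfl

theorem InPeriodGroup.symm {γ : (perpForm B h).IsometryEquiv (perpForm B h)}
    (hγ : InPeriodGroup B h γ) : InPeriodGroup B h γ.symm := by
  obtain ⟨g, gh, ⟨ε, hε⟩, hg⟩ := hγ
  refine ⟨g.symm, ?_, ⟨ε, fun f => ?_⟩, fun y => ?_⟩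
  · have : g.toLinearEquiv.symm (g.toLinearEquiv h) = h := g.toLinearEquiv.symm_apply_apply h
    have e : g.toLinearEquiv h = h := gh
    rw [e] at this
    exact this
  · have := hε (f ∘ₗ (g : Λ ≃ₗ[ℤ] Λ).toLinearMap)
    have e : (f ∘ₗ (g : Λ ≃ₗ[ℤ] Λ).toLinearMap) ∘ₗ (g.symm : Λ ≃ₗ[ℤ] Λ).toLinearMap = f := by
      ext x
      exact congrArg f (g.toLinearEquiv.apply_symm_apply x)
    rw [e] at this
    change (Submodule.Quotient.mk (f ∘ₗ (g : Λ ≃ₗ[ℤ] Λ).toLinearMap) : DiscriminantGroup B) = _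
    rw [this, smul_smul]
    rcases Int.units_eq_one_or ε with rfl | rfl <;> simp
  · have := hg (γ.symm y)
    have e : γ (γ.symm y) = y := γ.toLinearEquiv.apply_symm_apply y
    rw [e] at this
    rw [this]
    exact (g.toLinearEquiv.symm_apply_apply _).symm

theorem InPeriodGroup.trans {γ δ : (perpForm B h).IsometryEquiv (perpForm B h)}
    (hγ : InPeriodGroup B h γ) (hδ : InPeriodGroup B h δ) :
    InPeriodGroup B h (γ.trans δ) := by
  obtain ⟨g, gh, ⟨ε, hε⟩, hg⟩ := hγ
  obtain ⟨k, kh, ⟨η, hη⟩, hk⟩ := hδ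
  refine ⟨g.trans k, ?_, ⟨ε * η, fun f => ?_⟩, fun y => ?_⟩
  · change k (g h) = h
    rw [gh, kh]
  · have := hη (f ∘ₗ (g.symm : Λ ≃ₗ[ℤ] Λ).toLinearMap)
    rw [hε f, smul_smul, mul_comm, ← Units.val_mul] at this
    exact this
  · change (δ (γ y) : Λ) = k (g y)
    rw [hk, hg]

end Lattice

/-! ### Period domains -/

section Domain

variable {L L' L'' : Type*} [AddCommGroup L] [AddCommGroup L'] [AddCommGroup L'']
  (b : LinearMap.BilinForm ℤ L)

/-- Complex conjugation on `ℂ ⊗ L`. -/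
def conj : ℂ ⊗[ℤ] L →ₗ[ℤ] ℂ ⊗[ℤ] L :=
  LinearMap.rTensor L (starRingEnd ℂ).toAddMonoidHom.toIntLinearMap

/-- The vectors `v` of `ℂ ⊗ L` with `v² = 0` and `v · v̄ > 0`. -/
def periodCone : Set (ℂ ⊗[ℤ] L) :=
  {v | b.baseChange ℂ v v = 0 ∧ 0 < (b.baseChange ℂ v (conj v)).re}

/-- The period domain `{[v] ∈ ℙ(ℂ ⊗ L) | v² = 0, v · v̄ > 0}`. -/
def PeriodDomain : Type _ := {x : ℙ ℂ (ℂ ⊗[ℤ] L) // x.rep ∈ periodCone b}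

variable {b}

theorem ne_zero_of_mem_periodCone {v : ℂ ⊗[ℤ] L} (hv : v ∈ periodCone b) : v ≠ 0 := by
  rintro rfl
  simpa using hv.2

theorem conj_tmul (z : ℂ) (x : L) : conj (z ⊗ₜ[ℤ] x) = (starRingEnd ℂ z) ⊗ₜ[ℤ] x := rfl

theorem conj_smul (a : ℂ) (v : ℂ ⊗[ℤ] L) : conj (a • v) = (starRingEnd ℂ a) • conj v := by
  induction v with
  | zero => simp
  | tmul z x => simp [conj_tmul, TensorProduct.smul_tmul']
  | add x y hx hy => rw [smul_add, map_add, hx, hy, map_add, smul_add]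

theorem smul_mem_periodCone {a : ℂ} (ha : a ≠ 0) {v : ℂ ⊗[ℤ] L} (hv : v ∈ periodCone b) :
    a • v ∈ periodCone b := by
  refine ⟨by simp [hv.1], ?_⟩
  have e : b.baseChange ℂ (a • v) (conj (a • v)) =
      ((Complex.normSq a : ℝ) : ℂ) * b.baseChange ℂ v (conj v) := by
    rw [conj_smul, map_smul, map_smul, LinearMap.smul_apply, smul_eq_mul, smul_eq_mul, ← mul_assoc,
      ← Complex.mul_conj]
    ring
  rw [e, Complex.re_ofReal_mul]
  exact mul_pos (Complex.normSq_pos.2 ha) hv.2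

theorem mk_rep_mem_periodCone {v : ℂ ⊗[ℤ] L} (hv : v ∈ periodCone b) :
    (Projectivization.mk ℂ v (ne_zero_of_mem_periodCone hv)).rep ∈ periodCone b := by
  obtain ⟨a, ha⟩ := Projectivization.exists_smul_eq_mk_rep ℂ v (ne_zero_of_mem_periodCone hv)
  rw [← ha]
  exact smul_mem_periodCone a.ne_zero hv

variable (b) in
/-- The point `[v]` of the period domain. -/
def PeriodDomain.mk (v : ℂ ⊗[ℤ] L) (hv : v ∈ periodCone b) : PeriodDomain b :=
  ⟨Projectivization.mk ℂ v (ne_zero_of_mem_periodCone hv), mk_rep_mem_periodCone hv⟩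

variable {b' : LinearMap.BilinForm ℤ L'} {b'' : LinearMap.BilinForm ℤ L''}

theorem map_mem_periodCone (φ : b.IsometryEquiv b') {v : ℂ ⊗[ℤ] L} (hv : v ∈ periodCone b) :
    (φ : L ≃ₗ[ℤ] L').baseChange ℤ ℂ L L' v ∈ periodCone b' := by
  have key : ∀ x y : ℂ ⊗[ℤ] L, b'.baseChange ℂ ((φ : L ≃ₗ[ℤ] L').baseChange ℤ ℂ L L' x)
      ((φ : L ≃ₗ[ℤ] L').baseChange ℤ ℂ L L' y) = b.baseChange ℂ x y := by
    intro x y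
    induction x with
    | zero => simp
    | add x x' hx hx' => simp [hx, hx']
    | tmul z x =>
      induction y with
      | zero => simp
      | add y y' hy hy' => simp only [map_add, hy, hy']
      | tmul w y => simp
  have hc : conj ((φ : L ≃ₗ[ℤ] L').baseChange ℤ ℂ L L' v) =
      (φ : L ≃ₗ[ℤ] L').baseChange ℤ ℂ L L' (conj v) := by
    clear hv
    induction v with
    | zero => simp
    | add x y hx hy => simp only [map_add, hx, hy]
    | tmul z x => simp [conj_tmul]
  refine ⟨?_, ?_⟩
  · rw [key]; exact hv.1
  · rw [hc, key]; exact hv.2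

/-- The map between period domains induced by an isometry. -/
def PeriodDomain.map (φ : b.IsometryEquiv b') (x : PeriodDomain b) : PeriodDomain b' :=
  ⟨Projectivization.map ((φ : L ≃ₗ[ℤ] L').baseChange ℤ ℂ L L').toLinearMap
      ((φ : L ≃ₗ[ℤ] L').baseChange ℤ ℂ L L').injective x.1, by
    have h := mk_rep_mem_periodCone (map_mem_periodCone φ x.2)
    have e := Projectivization.map_mk ((φ : L ≃ₗ[ℤ] L').baseChange ℤ ℂ L L').toLinearMap
      ((φ : L ≃ₗ[ℤ] L').baseChange ℤ ℂ L L').injective x.1.rep x.1.rep_nonzero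
    rw [Projectivization.mk_rep] at e
    rw [e]
    exact h⟩

theorem PeriodDomain.map_mk (φ : b.IsometryEquiv b') {v : ℂ ⊗[ℤ] L} (hv : v ∈ periodCone b) :
    PeriodDomain.map φ (PeriodDomain.mk b v hv) =
      PeriodDomain.mk b' _ (map_mem_periodCone φ hv) :=
  rfl

theorem PeriodDomain.exists_mk (x : PeriodDomain b) :
    ∃ v, ∃ hv : v ∈ periodCone b, PeriodDomain.mk b v hv = x :=
  ⟨x.1.rep, x.2, Subtype.ext x.1.mk_rep⟩

theorem PeriodDomain.mk_congr {v w : ℂ ⊗[ℤ] L} (e : v = w) (hv : v ∈ periodCone b) :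
    PeriodDomain.mk b v hv = PeriodDomain.mk b w (e ▸ hv) := by
  subst e; rfl

theorem PeriodDomain.map_refl (x : PeriodDomain b) :
    PeriodDomain.map (LinearMap.BilinForm.IsometryEquiv.refl b) x = x := by
  obtain ⟨v, hv, rfl⟩ := x.exists_mk
  rw [PeriodDomain.map_mk]
  refine PeriodDomain.mk_congr ?_ _
  change (LinearMap.id : L →ₗ[ℤ] L).baseChange ℂ v = v
  rw [LinearMap.baseChange_id]
  rfl

theorem PeriodDomain.map_trans (φ : b.IsometryEquiv b') (ψ : b'.IsometryEquiv b'')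
    (x : PeriodDomain b) :
    PeriodDomain.map (φ.trans ψ) x = PeriodDomain.map ψ (PeriodDomain.map φ x) := by
  obtain ⟨v, hv, rfl⟩ := x.exists_mk
  simp only [PeriodDomain.map_mk]
  refine PeriodDomain.mk_congr ?_ _
  exact LinearEquiv.congr_fun (LinearEquiv.baseChange_trans ℤ ℂ L L' (φ : L ≃ₗ[ℤ] L')
    (ψ : L' ≃ₗ[ℤ] L'')) v

end Domain

/-! ### Period spaces and Heegner divisors -/

section PeriodSpace

variable {Λ : Type*} [AddCommGroup Λ] (B : LinearMap.BilinForm ℤ Λ) (h : Λ)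

/-- Two points of the period domain of `h^⊥` are equivalent if they are in the same orbit of
`Ô(Λ, h)`. -/
def periodSetoid : Setoid (PeriodDomain (perpForm B h)) where
  r x y := ∃ γ : (perpForm B h).IsometryEquiv (perpForm B h),
    InPeriodGroup B h γ ∧ PeriodDomain.map γ x = y
  iseqv :=
    { refl := fun x => ⟨_, InPeriodGroup.refl, PeriodDomain.map_refl x⟩
      symm := by
        rintro x y ⟨γ, hγ, rfl⟩
        refine ⟨γ.symm, hγ.symm, ?_⟩
        rw [← PeriodDomain.map_trans]
        have e : γ.trans γ.symm = LinearMap.BilinForm.IsometryEquiv.refl _ :=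
          DFunLike.ext _ _ fun y => γ.toLinearEquiv.symm_apply_apply y
        rw [e, PeriodDomain.map_refl]
      trans := by
        rintro x y z ⟨γ, hγ, rfl⟩ ⟨δ, hδ, rfl⟩
        exact ⟨γ.trans δ, hγ.trans hδ, PeriodDomain.map_trans γ δ x⟩ }

/-- The quotient of the period domain of `h^⊥` by `Ô(Λ, h)`. -/
def PeriodSpace : Type _ := Quotient (periodSetoid B h)

/-- The quotient map from the period domain to the period space. -/
def PeriodSpace.mk (x : PeriodDomain (perpForm B h)) : PeriodSpace B h :=
  Quotient.mk (periodSetoid B h) x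

variable [Module.Free ℤ Λ] [Module.Finite ℤ Λ]

/-- The discriminant of a sublattice: the determinant of its Gram matrix in a basis. -/
def disc (N : Submodule ℤ Λ) : ℤ :=
  (LinearMap.BilinForm.toMatrix (Module.finBasis ℤ N) (B.restrict N)).det

theorem disc_eq {ι : Type*} [Fintype ι] [DecidableEq ι] (N : Submodule ℤ Λ)
    (e : Module.Basis ι ℤ N) :
    disc B N = (LinearMap.BilinForm.toMatrix e (B.restrict N)).det := by
  unfold disc
  set c := Module.finBasis ℤ N
  set e' := e.reindex (e.indexEquiv c) with he'
  have h1 : LinearMap.BilinForm.toMatrix e' (B.restrict N) =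
      (LinearMap.BilinForm.toMatrix e (B.restrict N)).submatrix (e.indexEquiv c).symm
        (e.indexEquiv c).symm := by
    ext i j
    simp [he', LinearMap.BilinForm.toMatrix_apply]
  have h2 := congrArg Matrix.det (LinearMap.BilinForm.toMatrix_mul_basis_toMatrix c e' (B.restrict N))
  rw [h1, Matrix.det_submatrix_equiv_self, Matrix.det_mul, Matrix.det_mul,
    Matrix.det_transpose] at h2
  have h3 : (c.toMatrix e').det * (e'.toMatrix c).det = 1 := by
    rw [← Matrix.det_mul, Module.Basis.toMatrix_mul_toMatrix_flip, Matrix.det_one]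
  rcases Int.isUnit_iff.1 (IsUnit.of_mul_eq_one _ h3) with h4 | h4 <;> rw [h4] at h2 <;> linarith

/-- `K` has real signature `(1, 1)`. -/
def HasSignatureOneOne (K : Submodule ℤ Λ) : Prop :=
  sigPos ((B.restrict K).baseChange ℝ).toQuadraticMap = 1 ∧
    sigNeg ((B.restrict K).baseChange ℝ).toQuadraticMap = 1

/-- The image in the period space of `ℙ(K^⊥ ⊗ ℂ) ∩ D`, where `D` is the period domain of `h^⊥`
and `h ∈ K`. -/
def heegnerOf (K : Submodule ℤ Λ) : Set (PeriodSpace B h) :=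
  PeriodSpace.mk B h ''
    {x | x.1.submodule ≤ ((B.orthogonal K).submoduleOf (perp B h)).baseChange ℂ}

/-- The union of the `heegnerOf B h K` over the sublattices `K` of rank 2 and signature `(1, 1)`
that contain `h` and satisfy `disc(K^⊥) = -d`. -/
def heegnerDivisor (d : ℕ) : Set (PeriodSpace B h) :=
  {p | ∃ K : Submodule ℤ Λ, h ∈ K ∧ Module.finrank ℤ K = 2 ∧ HasSignatureOneOne B K ∧
    disc B (B.orthogonal K) = -(d : ℤ) ∧ p ∈ heegnerOf B h K}

end PeriodSpace

/-! ### Analytic subsets -/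

section Analytic

/-- `A ∩ D` is a closed analytic subset of `D`: near each point of `D`, it is the set of common
zeros in `D` of finitely many holomorphic functions. Here `V` is identified with some `ℂ^n` by the
choice of a basis. -/
def IsAnalyticIn {V : Type*} [AddCommGroup V] [Module ℂ V] [Module.Finite ℂ V] (D A : Set V) :
    Prop :=
  ∀ p ∈ D, ∃ U : Set (Fin (Module.finrank ℂ V) → ℂ),
    IsOpen U ∧ (Module.finBasis ℂ V).equivFun p ∈ U ∧
    ∃ (r : ℕ) (f : Fin r → (Fin (Module.finrank ℂ V) → ℂ) → ℂ),
      (∀ i, DifferentiableOn ℂ (f i) U) ∧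
      ∀ v ∈ D, (Module.finBasis ℂ V).equivFun v ∈ U →
        (v ∈ A ↔ ∀ i, f i ((Module.finBasis ℂ V).equivFun v) = 0)

variable {Λ : Type*} [AddCommGroup Λ] [Module.Free ℤ Λ] [Module.Finite ℤ Λ]
  {B : LinearMap.BilinForm ℤ Λ} {h : Λ}

/-- `Z` is a closed analytic subset of the period space: its inverse image in the cone over the
period domain is a closed analytic subset. -/
def IsClosedAnalytic (Z : Set (PeriodSpace B h)) : Prop :=
  IsAnalyticIn (periodCone (perpForm B h))
    {v | ∃ hv : v ∈ periodCone (perpForm B h),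
      PeriodSpace.mk B h (PeriodDomain.mk (perpForm B h) v hv) ∈ Z}

/-- `Z` is an irreducible closed analytic subset of the period space. -/
def IsIrreducibleAnalytic (Z : Set (PeriodSpace B h)) : Prop :=
  IsClosedAnalytic Z ∧ Z.Nonempty ∧
    ∀ Z₁ Z₂ : Set (PeriodSpace B h), IsClosedAnalytic Z₁ → IsClosedAnalytic Z₂ →
      Z ⊆ Z₁ ∪ Z₂ → Z ⊆ Z₁ ∨ Z ⊆ Z₂

end Analytic

/-! ### Every isometry of `h^⊥` is induced by `Ô(Λ_{K3^[3]}, h)` if `h² = 4` and `div(h) = 2`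

This is only needed to show that the map `rho` below is well defined. -/

/-- The inverse of the Cartan matrix of type `E₈`. -/
def e8Inv : Matrix (Fin 8) (Fin 8) ℤ :=
  !![4, 5, 7, 10, 8, 6, 4, 2;
     5, 8, 10, 15, 12, 9, 6, 3;
     7, 10, 14, 20, 16, 12, 8, 4;
     10, 15, 20, 30, 24, 18, 12, 6;
     8, 12, 16, 24, 20, 15, 10, 5;
     6, 9, 12, 18, 15, 12, 8, 4;
     4, 6, 8, 12, 10, 8, 6, 3;
     2, 3, 4, 6, 5, 4, 3, 2]

theorem k3Gram_mul_inv : k3Gram * Matrix.fromBlocks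
    (Matrix.blockDiagonal fun _ : Fin 3 => !![0, 1; 1, 0]) 0
    0 (Matrix.blockDiagonal fun _ : Fin 2 => -e8Inv) = 1 := by
  have h1 : (!![0, 1; 1, 0] : Matrix (Fin 2) (Fin 2) ℤ) * !![0, 1; 1, 0] = 1 := by decide
  have h2 : CartanMatrix.E₈ * e8Inv = 1 := by decide +kernel
  rw [k3Gram, Matrix.fromBlocks_multiply]
  simp only [Matrix.mul_zero, Matrix.zero_mul, add_zero, zero_add, ← Matrix.blockDiagonal_mul, h1,
    neg_mul_neg, h2]
  have e1 : (fun _ : Fin 3 => (1 : Matrix (Fin 2) (Fin 2) ℤ)) = 1 := rfl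
  have e2 : (fun _ : Fin 2 => (1 : Matrix (Fin 8) (Fin 8) ℤ)) = 1 := rfl
  rw [e1, e2, Matrix.blockDiagonal_one, Matrix.blockDiagonal_one, Matrix.fromBlocks_one]

theorem k3Gram_symm : k3Gram.transpose = k3Gram := by
  have h1 : (!![0, 1; 1, 0] : Matrix (Fin 2) (Fin 2) ℤ).transpose = !![0, 1; 1, 0] := by decide
  have h2 : (-CartanMatrix.E₈).transpose = -CartanMatrix.E₈ := by decide +kernel
  rw [k3Gram, Matrix.fromBlocks_transpose, Matrix.blockDiagonal_transpose,
    Matrix.blockDiagonal_transpose, h1, h2]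
  simp

theorem k3Gram_diag (i : K3Index) : Even (k3Gram i i) := by
  rcases i with ⟨i, j⟩ | ⟨i, j⟩
  · simp only [k3Gram, Matrix.fromBlocks_apply₁₁, Matrix.blockDiagonal_apply_eq]
    fin_cases i <;> simp
  · simp [k3Gram, Matrix.blockDiagonal_apply_eq]

/-- The form of the K3 lattice. -/
def k3Form : LinearMap.BilinForm ℤ (K3Index → ℤ) := Matrix.toBilin' k3Gram

theorem k3Form_symm (x y : K3Index → ℤ) : k3Form x y = k3Form y x := by
  rw [k3Form, Matrix.toBilin'_apply', Matrix.toBilin'_apply', Matrix.dotProduct_mulVec,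
    ← Matrix.mulVec_transpose, k3Gram_symm, dotProduct_comm]

theorem k3Form_even (x : K3Index → ℤ) : Even (k3Form x x) := by
  let S : Submodule ℤ (K3Index → ℤ) :=
    { carrier := {x | Even (k3Form x x)}
      zero_mem' := by simp
      add_mem' := by
        intro a b ha hb
        simp only [Set.mem_ofPred_eq, map_add, LinearMap.add_apply] at *
        rw [k3Form_symm b a]
        have e : k3Form a a + k3Form a b + (k3Form a b + k3Form b b) =
          k3Form a a + k3Form b b + 2 * k3Form a b := by ring
        rw [e]
        exact (ha.add hb).add (even_two_mul _)
      smul_mem' := by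
        intro c a ha
        simp only [Set.mem_ofPred_eq, map_smul, LinearMap.smul_apply, smul_eq_mul] at *
        exact (ha.mul_left _).mul_left _ }
  have : S = ⊤ := by
    rw [eq_top_iff, ← (Pi.basisFun ℤ K3Index).span_eq, Submodule.span_le]
    rintro _ ⟨i, rfl⟩
    change Even _
    rw [Pi.basisFun_apply, k3Form, Matrix.toBilin'_single]
    exact k3Gram_diag i
  have hx : x ∈ S := this ▸ Submodule.mem_top
  exact hx

theorem k3Form_surj (f : (K3Index → ℤ) →ₗ[ℤ] ℤ) : ∃ z, ∀ x, f x = k3Form z x := by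
  refine ⟨Matrix.vecMul (fun i => f (fun j => if i = j then 1 else 0)) (Matrix.fromBlocks
    (Matrix.blockDiagonal fun _ : Fin 3 => !![0, 1; 1, 0]) 0
    0 (Matrix.blockDiagonal fun _ : Fin 2 => -e8Inv)), fun x => ?_⟩
  rw [k3Form, Matrix.toBilin'_apply', Matrix.dotProduct_mulVec, Matrix.vecMul_vecMul,
    mul_eq_one_comm.1 k3Gram_mul_inv, Matrix.vecMul_one, LinearMap.pi_apply_eq_sum_univ f x]
  simp [dotProduct, mul_comm]

theorem dvd_of_dvd_k3Form {k : ℤ} {q : K3Index → ℤ} (hq : ∀ x, k ∣ k3Form q x) :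
    ∃ z, q = k • z := by
  have : ∀ i, k ∣ q i := by
    intro i
    obtain ⟨z, hz⟩ := k3Form_surj (LinearMap.proj i)
    have := hz q
    rw [k3Form_symm] at this
    rw [LinearMap.proj_apply] at this
    rw [this]
    exact hq z
  choose z hz using this
  exact ⟨z, funext fun i => by simp [hz i]⟩

theorem k3mForm_three (x y : K3mLattice) : k3mForm 3 x y =
    k3Form (x ∘ Sum.inl) (y ∘ Sum.inl) - 4 * x (Sum.inr ()) * y (Sum.inr ()) := by
  rw [k3mForm, k3mGram, Matrix.toBilin'_apply', k3Form, Matrix.toBilin'_apply',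
    Matrix.fromBlocks_mulVec]
  simp [dotProduct, Matrix.mulVec, Fintype.sum_sum_type]
  ring

theorem k3mForm_three_symm (x y : K3mLattice) : k3mForm 3 x y = k3mForm 3 y x := by
  rw [k3mForm_three, k3mForm_three, k3Form_symm]; ring

theorem k3mForm_three_elim (x : K3mLattice) (z : K3Index → ℤ) :
    k3mForm 3 x (Sum.elim z 0) = k3Form (x ∘ Sum.inl) z := by
  rw [k3mForm_three]; simp

theorem two_dvd_of_div {h : K3mLattice}
    (hdiv : HasDivisibility (k3mForm 3) h 2) (x : K3mLattice) : 2 ∣ k3mForm 3 h x := by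
  have : k3mForm 3 h x ∈ LinearMap.range (k3mForm 3 h) := ⟨x, rfl⟩
  rw [hdiv] at this
  exact Ideal.mem_span_singleton.1 this

theorem exists_eq_two_of_div {h : K3mLattice}
    (hdiv : HasDivisibility (k3mForm 3) h 2) : ∃ x, k3mForm 3 h x = 2 := by
  have : (2 : ℤ) ∈ LinearMap.range (k3mForm 3 h) := by
    rw [hdiv]; exact Ideal.mem_span_singleton.2 (by simp)
  exact this

theorem polarization_coords {h : K3mLattice} (hsq : k3mForm 3 h h = 4)
    (hdiv : HasDivisibility (k3mForm 3) h 2) : ∃ n : K3Index → ℤ, h ∘ Sum.inl = (2 : ℤ) • n ∧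
    k3Form n n = 1 + h (Sum.inr ()) ^ 2 ∧ Odd (h (Sum.inr ())) := by
  obtain ⟨n, hn⟩ := dvd_of_dvd_k3Form (k := 2) (q := h ∘ Sum.inl) fun z => by
    rw [← k3mForm_three_elim]; exact two_dvd_of_div hdiv _
  have e : k3Form n n = 1 + h (Sum.inr ()) ^ 2 := by
    rw [k3mForm_three, hn] at hsq
    simp only [map_smul, LinearMap.smul_apply, smul_eq_mul] at hsq
    linarith
  refine ⟨n, hn, e, ?_⟩
  have := k3Form_even n
  rw [e] at this
  by_contra hs
  rw [Int.not_odd_iff_even] at hs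
  obtain ⟨r, hr⟩ := hs
  obtain ⟨q, hq⟩ := this
  rw [hr] at hq
  have : 1 = 2 * (q - 2 * r * r) := by linarith [hq]
  omega

theorem exists_eq_add_two_smul {h : K3mLattice} (hsq : k3mForm 3 h h = 4)
    (hdiv : HasDivisibility (k3mForm 3) h 2) {y : K3mLattice} (hy : k3mForm 3 h y = 0)
    (hy2 : ∀ w, k3mForm 3 h w = 0 → 2 ∣ k3mForm 3 y w) (hy4 : 8 ∣ k3mForm 3 y y - 4) :
    ∃ t : K3mLattice, y = h + (2 : ℤ) • t := by
  obtain ⟨n, hn, hnn, s, hs⟩ := polarization_coords hsq hdiv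
  obtain ⟨x₀, hx₀⟩ := exists_eq_two_of_div hdiv
  set p := k3mForm 3 y x₀ with hp
  have h1 : ∀ x, 4 ∣ k3mForm 3 ((2 : ℤ) • y - p • h) x := by
    intro x
    obtain ⟨a, ha⟩ := two_dvd_of_div hdiv x
    obtain ⟨c, hc⟩ := hy2 (x - a • x₀) (by
      rw [map_sub, map_smul, hx₀, ha, smul_eq_mul]; ring)
    refine ⟨c, ?_⟩
    rw [map_sub, map_smul, smul_eq_mul, ← hp] at hc
    simp only [map_sub, map_smul, LinearMap.sub_apply, LinearMap.smul_apply, smul_eq_mul, ha]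
    linear_combination 2 * hc
  obtain ⟨z, hz⟩ := dvd_of_dvd_k3Form (k := 4) (q := ((2 : ℤ) • y - p • h) ∘ Sum.inl) fun z => by
    rw [← k3mForm_three_elim]; exact h1 _
  have hyz : y ∘ Sum.inl = p • n + (2 : ℤ) • z := by
    funext i
    have e1 := congrFun hz i
    have e2 := congrFun hn i
    simp only [Function.comp_apply, Pi.sub_apply, Pi.smul_apply, Pi.add_apply, smul_eq_mul] at *
    rw [e2] at e1
    linarith
  set c := y (Sum.inr ()) with hc
  rw [k3mForm_three, hn, hyz, hs, ← hc] at hy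
  rw [k3mForm_three, hyz, ← hc] at hy4
  rw [hs] at hnn
  obtain ⟨m, hm⟩ := k3Form_even z
  simp only [map_smul, map_add, LinearMap.smul_apply, LinearMap.add_apply, smul_eq_mul, hnn, hm,
    k3Form_symm z n] at hy hy4
  set u := k3Form n z with hu
  have hpe : Even p := by
    by_contra hpo
    rw [Int.not_even_iff_odd] at hpo
    obtain ⟨q, hq⟩ := hpo
    obtain ⟨k, hk⟩ := hy4
    rw [hq] at hy hk
    have h2 : 4 * u = 4 * (2 * s + 1) * c - 2 * (2 * q + 1) * (1 + (2 * s + 1) ^ 2) := by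
      linarith
    have h3 : -((2 * q + 1) ^ 2) * (1 + (2 * s + 1) ^ 2) + 4 * (2 * q + 1) * (2 * s + 1) * c
        - 4 * c ^ 2 + 8 * m - 4 = 8 * k := by
      linear_combination hk - (2 * q + 1) * h2
    have h4 : (2 : ℤ) = 4 * (-(q * q + q) * (1 + (2 * s + 1) ^ 2) - (s * s + s) +
        (2 * q + 1) * (2 * s + 1) * c - c ^ 2 + 2 * m - 1 - 2 * k) := by
      linear_combination -h3
    omega
  obtain ⟨q, hq⟩ := hpe
  have hpq : p = 2 * q := by omega
  have hco : Odd c := by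
    by_contra hce
    rw [Int.not_odd_iff_even] at hce
    obtain ⟨r, hr⟩ := hce
    obtain ⟨k, hk⟩ := hy4
    rw [hpq] at hk hy
    rw [hr] at hk hy
    have h2 : 4 * u = 8 * (2 * s + 1) * r - 4 * q * (1 + (2 * s + 1) ^ 2) := by
      linarith
    have h3 : (4 : ℤ) = 8 * (-q ^ 2 * (2 * s * s + 2 * s + 1) + 2 * q * (2 * s + 1) * r
        - 2 * r ^ 2 + m - k) := by
      linear_combination 2 * q * h2 - hk
    omega
  obtain ⟨r, hr⟩ := hco
  refine ⟨Sum.elim (q • n + z - n) (fun _ => r - s), ?_⟩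
  funext i
  rcases i with i | ⟨⟩
  · have e1 := congrFun hyz i
    have e2 := congrFun hn i
    simp only [Function.comp_apply, Pi.sub_apply, Pi.smul_apply, Pi.add_apply, smul_eq_mul,
      Sum.elim_inl] at *
    rw [e1, e2, hpq]
    ring
  · simp only [Pi.smul_apply, Pi.add_apply, smul_eq_mul, Sum.elim_inr, hs, ← hc, hr]
    ring

theorem two_smul_cancel {x y : K3mLattice} (e : (2 : ℤ) • x = (2 : ℤ) • y) : x = y := by
  funext i
  have := congrFun e i
  simp only [Pi.smul_apply, smul_eq_mul] at this
  omega

theorem exists_extension {h : K3mLattice} (hsq : k3mForm 3 h h = 4)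
    (hdiv : HasDivisibility (k3mForm 3) h 2) : ∃ A : K3mLattice →ₗ[ℤ] ℤ, (∀ x, k3mForm 3 h x = 2 * A x) ∧
    ∃ w : K3mLattice →ₗ[ℤ] perp (k3mForm 3) h, (∀ x, (w x : K3mLattice) = (2 : ℤ) • x - A x • h) ∧
    ∀ γ : (perpForm (k3mForm 3) h).IsometryEquiv (perpForm (k3mForm 3) h),
      ∃ G : K3mLattice →ₗ[ℤ] K3mLattice,
        ∀ x, (2 : ℤ) • G x = A x • h + (γ (w x) : K3mLattice) := by
  choose a ha using two_dvd_of_div hdiv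
  let A : K3mLattice →ₗ[ℤ] ℤ :=
    { toFun := a
      map_add' := fun x y => by
        have := ha (x + y)
        rw [map_add, ha, ha] at this
        omega
      map_smul' := fun c x => by
        have := ha (c • x)
        rw [map_smul, ha, smul_eq_mul] at this
        simp only [RingHom.id_apply, smul_eq_mul]
        linarith }
  have hA : ∀ x, k3mForm 3 h x = 2 * A x := ha
  let w₀ : K3mLattice →ₗ[ℤ] K3mLattice := (2 : ℤ) • LinearMap.id - A.smulRight h
  have hw₀ : ∀ x, w₀ x = (2 : ℤ) • x - A x • h := fun x => rfl
  let w : K3mLattice →ₗ[ℤ] perp (k3mForm 3) h := w₀.codRestrict _ fun x => by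
    rw [LinearMap.mem_ker, hw₀, map_sub, map_smul, map_smul, hsq, hA, smul_eq_mul, smul_eq_mul]
    ring
  have hw : ∀ x, (w x : K3mLattice) = (2 : ℤ) • x - A x • h := fun x => rfl
  refine ⟨A, hA, w, hw, fun γ => ?_⟩
  have hγ : ∀ y z : perp (k3mForm 3) h, k3mForm 3 (γ y) (γ z) = k3mForm 3 y z := fun y z =>
    γ.map_app z y
  have key : ∀ x, ∃ z : K3mLattice, (2 : ℤ) • z = A x • h + (γ (w x) : K3mLattice) := by
    intro x
    rcases Int.even_or_odd' (A x) with ⟨c, hc | hc⟩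
    · let v : perp (k3mForm 3) h := ⟨x - c • h, by
        rw [LinearMap.mem_ker, map_sub, map_smul, hsq, hA, hc, smul_eq_mul]; ring⟩
      have hv : w x = (2 : ℤ) • v := by
        apply Subtype.ext
        rw [hw, hc]
        change _ = (2 : ℤ) • (x - c • h)
        rw [smul_sub, smul_smul]
      refine ⟨c • h + γ v, ?_⟩
      rw [hv, map_smul, hc, smul_add, smul_smul]
      rfl
    · obtain ⟨t, ht⟩ := exists_eq_add_two_smul hsq hdiv (y := γ (w x)) (γ (w x)).2 (by
        intro v hv
        have e := hγ (w x) (γ.symm ⟨v, hv⟩)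
        have e' : γ (γ.symm ⟨v, hv⟩) = ⟨v, hv⟩ := γ.toLinearEquiv.apply_symm_apply _
        rw [e'] at e
        change k3mForm 3 (γ (w x)) v = _ at e
        rw [e, hw]
        have e2 : k3mForm 3 h (γ.symm ⟨v, hv⟩) = 0 := (γ.symm ⟨v, hv⟩).2
        rw [map_sub, LinearMap.sub_apply, map_smul, map_smul, LinearMap.smul_apply,
          LinearMap.smul_apply, e2, smul_zero, sub_zero]
        exact ⟨_, rfl⟩) (by
        obtain ⟨r, hr⟩ : Even (k3mForm 3 x x) := by
          rw [k3mForm_three]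
          refine (k3Form_even _).sub ?_
          exact ⟨2 * x (Sum.inr ()) * x (Sum.inr ()), by ring⟩
        have e := k3mForm_three_symm x h
        rw [hγ, hw]
        simp only [map_sub, map_smul, LinearMap.sub_apply, LinearMap.smul_apply, smul_eq_mul, hsq,
          e, hA, hc, hr]
        refine ⟨r - 2 * c * c - 2 * c - 1, ?_⟩
        ring)
      refine ⟨(c + 1) • h + t, ?_⟩
      rw [ht, hc]
      module
  choose G hG using key
  refine ⟨{ toFun := G, map_add' := fun x y => ?_, map_smul' := fun c x => ?_ }, hG⟩
  · apply two_smul_cancel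
    rw [smul_add, hG, hG, hG, map_add, map_add, map_add, Submodule.coe_add]
    module
  · apply two_smul_cancel
    rw [RingHom.id_apply, smul_comm, hG, hG, map_smul, map_smul, map_smul, Submodule.coe_smul]
    module

theorem actsBySign_three (g : (k3mForm 3).IsometryEquiv (k3mForm 3)) : ActsBySign g := by
  set δ : K3mLattice := Sum.elim 0 1 with hδ
  have hδx : ∀ x, k3mForm 3 δ x = -4 * x (Sum.inr ()) := by
    intro x
    rw [k3mForm_three]
    have : δ ∘ Sum.inl = 0 := rfl
    rw [this]
    simp [hδ]
  set t : K3mLattice := g δ with ht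
  have hgs : ∀ x, g (g.symm x) = x := fun x => g.toLinearEquiv.apply_symm_apply x
  have htx : ∀ x, k3mForm 3 t x = -4 * (g.symm x) (Sum.inr ()) := by
    intro x
    rw [← hδx, ← g.map_app (g.symm x) δ, hgs]
  obtain ⟨q, hq⟩ := dvd_of_dvd_k3Form (k := 4) (q := t ∘ Sum.inl) fun z => by
    rw [← k3mForm_three_elim, htx]
    exact ⟨_, by rw [neg_mul]; exact (mul_neg _ _).symm⟩
  set c := t (Sum.inr ()) with hc
  have hco : Odd c := by
    by_contra hce
    rw [Int.not_odd_iff_even] at hce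
    obtain ⟨r, hr⟩ := hce
    have e := g.map_app δ δ
    rw [← ht, hδx, k3mForm_three, hq, ← hc, hr] at e
    simp only [map_smul, LinearMap.smul_apply, smul_eq_mul, hδ, Sum.elim_inr, Pi.one_apply] at e
    have : (1 : ℤ) = 4 * (r * r - k3Form q q) := by linarith
    omega
  obtain ⟨ε, k, hk⟩ : ∃ ε : ℤˣ, ∃ k : ℤ, c = ε + 4 * k := by
    obtain ⟨r, hr⟩ := hco
    rcases Int.even_or_odd' r with ⟨k, hk | hk⟩
    · exact ⟨1, k, by simp; omega⟩
    · exact ⟨-1, k + 1, by simp; omega⟩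
  refine ⟨ε, fun f => ?_⟩
  rw [← Submodule.Quotient.mk_smul, Submodule.Quotient.eq]
  let i₁ : (K3Index → ℤ) →ₗ[ℤ] K3mLattice :=
    { toFun := fun z => Sum.elim z 0
      map_add' := fun x y => by funext i; rcases i with i | i <;> simp
      map_smul' := fun a x => by funext i; rcases i with i | i <;> simp }
  obtain ⟨z, hz⟩ := k3Form_surj (f ∘ₗ i₁)
  have hf : ∀ x, f x = k3mForm 3 (Sum.elim z 0) x + f δ * x (Sum.inr ()) := by
    intro x
    have e : x = i₁ (x ∘ Sum.inl) + x (Sum.inr ()) • δ := by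
      funext i
      rcases i with i | ⟨⟩ <;> simp [i₁, hδ]
    have e2 := hz (x ∘ Sum.inl)
    rw [LinearMap.comp_apply] at e2
    conv_lhs => rw [e, map_add, e2, map_smul, smul_eq_mul]
    rw [k3mForm_three_symm, k3mForm_three_elim, k3Form_symm]
    ring
  refine ⟨g (Sum.elim z 0) - f δ • (Sum.elim q 0 : K3mLattice) - (f δ * k) • δ -
    (ε : ℤ) • (Sum.elim z 0 : K3mLattice), LinearMap.ext fun x => ?_⟩
  have e1 := g.map_app (g.symm x) (Sum.elim z 0)
  rw [hgs] at e1
  have e3 := htx x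
  rw [k3mForm_three, hq, ← hc, map_smul, LinearMap.smul_apply, smul_eq_mul, hk] at e3
  have e4 : k3mForm 3 (Sum.elim q 0) x = k3Form q (x ∘ Sum.inl) := by
    rw [k3mForm_three_symm, k3mForm_three_elim, k3Form_symm]
  change _ = f (g.symm x) - (ε : ℤ) * f x
  rw [hf (g.symm x), hf x]
  simp only [map_sub, map_smul, LinearMap.sub_apply, LinearMap.smul_apply, smul_eq_mul, e1, e4, hδx]
  linarith [congrArg (fun y => f δ * y) e3]

theorem inPeriodGroup_of_sq_of_div {h : K3mLattice} (hsq : k3mForm 3 h h = 4)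
    (hdiv : HasDivisibility (k3mForm 3) h 2)
    (γ : (perpForm (k3mForm 3) h).IsometryEquiv (perpForm (k3mForm 3) h)) :
    InPeriodGroup (k3mForm 3) h γ := by
  obtain ⟨A, hA, w, hw, H⟩ := exists_extension hsq hdiv
  have hperp : ∀ y : perp (k3mForm 3) h, k3mForm 3 h y = 0 := fun y => y.2
  have hAG : ∀ (δ : (perpForm (k3mForm 3) h).IsometryEquiv (perpForm (k3mForm 3) h))
      (G : K3mLattice →ₗ[ℤ] K3mLattice)
      (_ : ∀ x, (2 : ℤ) • G x = A x • h + (δ (w x) : K3mLattice)) (x : K3mLattice),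
      A (G x) = A x ∧ w (G x) = δ (w x) := by
    intro δ G hG x
    have e := congrArg (k3mForm 3 h) (hG x)
    rw [map_smul, map_add, map_smul, hsq, hperp, hA, smul_eq_mul, smul_eq_mul] at e
    have e1 : A (G x) = A x := by linarith
    refine ⟨e1, Subtype.ext ?_⟩
    rw [hw, hG, e1, add_sub_cancel_left]
  have hinv : ∀ (δ η : (perpForm (k3mForm 3) h).IsometryEquiv (perpForm (k3mForm 3) h))
      (_ : ∀ y, η (δ y) = y) (G G' : K3mLattice →ₗ[ℤ] K3mLattice)
      (_ : ∀ x, (2 : ℤ) • G x = A x • h + (δ (w x) : K3mLattice))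
      (_ : ∀ x, (2 : ℤ) • G' x = A x • h + (η (w x) : K3mLattice)) (x : K3mLattice),
      G' (G x) = x := by
    intro δ η hδη G G' hG hG' x
    apply two_smul_cancel
    rw [hG', (hAG δ G hG x).1, (hAG δ G hG x).2, hδη, hw]
    abel
  obtain ⟨G, hG⟩ := H γ
  obtain ⟨G', hG'⟩ := H γ.symm
  let g : (k3mForm 3).IsometryEquiv (k3mForm 3) :=
    { G with
      invFun := G'
      left_inv := hinv γ γ.symm (fun y => γ.toLinearEquiv.symm_apply_apply y) G G' hG hG'
      right_inv := hinv γ.symm γ (fun y => γ.toLinearEquiv.apply_symm_apply y) G' G hG' hG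
      map_app' := by
        intro x y
        change k3mForm 3 (G x) (G y) = k3mForm 3 x y
        have e1 : k3mForm 3 ((2 : ℤ) • G x) ((2 : ℤ) • G y) = 4 * k3mForm 3 (G x) (G y) := by
          simp only [map_smul, LinearMap.smul_apply, smul_eq_mul]
          ring
        have e2 : k3mForm 3 (γ (w x)) (γ (w y)) = k3mForm 3 (w x) (w y) :=
          γ.map_app (w y) (w x)
        have e3 : k3mForm 3 (γ (w x)) h = 0 := by rw [k3mForm_three_symm, hperp]
        have e4 := k3mForm_three_symm x h
        rw [hG, hG] at e1
        simp only [map_add, map_sub, map_smul, LinearMap.add_apply, LinearMap.smul_apply,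
          LinearMap.sub_apply, smul_eq_mul, hsq, hperp, e2, e3, hw, hA, e4] at e1
        linarith }
  have hg : ∀ x, g x = G x := fun _ => rfl
  have hAh : A h = 2 := by
    have := hA h
    rw [hsq] at this
    omega
  refine ⟨g, ?_, actsBySign_three g, fun y => ?_⟩
  · apply two_smul_cancel
    have e : w h = 0 := Subtype.ext (by rw [hw, hAh, sub_self]; rfl)
    rw [hg, hG, hAh, e, map_zero]
    simp
  · apply two_smul_cancel
    have e0 : A y = 0 := by
      have := hA y
      rw [hperp] at this
      omega
    have e : w y = (2 : ℤ) • y := Subtype.ext (by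
      rw [hw, e0, zero_smul, sub_zero]; rfl)
    rw [hg, hG, e0, e, map_smul, zero_smul, zero_add]
    rfl

/-! ### The map `ρ` -/

section Rho

variable {h₂ h₃ : K3mLattice} (hsq : k3mForm 3 h₃ h₃ = 4)
  (hdiv : HasDivisibility (k3mForm 3) h₃ 2)
  (φ : (perpForm (k3mForm 2) h₂).IsometryEquiv (perpForm (k3mForm 3) h₃))

/-- The map between period spaces induced by an isometry `φ : h₂^⊥ ≃ h₃^⊥`. -/
def rho : PeriodSpace (k3mForm 2) h₂ → PeriodSpace (k3mForm 3) h₃ :=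
  Quotient.map (sa := periodSetoid (k3mForm 2) h₂) (sb := periodSetoid (k3mForm 3) h₃)
    (PeriodDomain.map φ) (by
      rintro x y ⟨γ, -, rfl⟩
      refine ⟨(φ.symm.trans γ).trans φ, inPeriodGroup_of_sq_of_div hsq hdiv _, ?_⟩
      rw [← PeriodDomain.map_trans, ← PeriodDomain.map_trans]
      congr 1
      refine DFunLike.ext _ _ fun z => ?_
      change φ (γ (φ.symm (φ z))) = φ (γ z)
      congr 2
      exact φ.toLinearEquiv.symm_apply_apply z)

theorem rho_mk (x : PeriodDomain (perpForm (k3mForm 2) h₂)) :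
    rho hsq hdiv φ (PeriodSpace.mk _ _ x) = PeriodSpace.mk _ _ (PeriodDomain.map φ x) :=
  rfl

/-- `rho` does not depend on the choice of the isometry. -/
theorem rho_eq (ψ : (perpForm (k3mForm 2) h₂).IsometryEquiv (perpForm (k3mForm 3) h₃)) :
    rho hsq hdiv φ = rho hsq hdiv ψ := by
  funext p
  obtain ⟨x, rfl⟩ := Quotient.exists_rep p
  refine Quotient.sound (s := periodSetoid (k3mForm 3) h₃) ?_
  refine ⟨φ.symm.trans ψ, inPeriodGroup_of_sq_of_div hsq hdiv _, ?_⟩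
  rw [← PeriodDomain.map_trans]
  congr 1
  refine DFunLike.ext _ _ fun z => ?_
  change ψ (φ.symm (φ z)) = ψ z
  congr 1
  exact φ.toLinearEquiv.symm_apply_apply z

end Rho

end K3Heegner

end

/-!
Both `h₂^⊥` and `h₃^⊥` are isometric to `2U ⊕ ⟨-2⟩² ⊕ E₈(-1)²`. A Heegner divisor of discriminant
`d` is the image of the periods orthogonal to a vector of negative square whose orthogonal
complement in `h^⊥` has discriminant `-d`; this description only involves the lattice `h^⊥`, so that
`ρ` matches the two divisors. By Eichler's criterion, every vector of the lattice spans the same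
line as a multiple of a translate of `2 (e + q f) + δ`, where `e, f` is a basis of a hyperbolic
plane and `δ` is `0`, `δ₁` or `δ₁ + δ₂` for the generators `δ₁`, `δ₂` of `⟨-2⟩²`. The complement of
this vector has discriminant `8 q - 2 r` with `r = 0, 1, 2` the number of generators in `δ`. Hence
`d = 2 e` with `e ≡ r` modulo `4`, and `d` determines `q` and `r`, so that the vectors of
discriminant `-d` lie on one orbit of lines.

Every isometry of `h₃^⊥` belongs to the period group, so the divisor is the image of the periods
orthogonal to that single orbit. This locus is closed analytic because a compact set of periods
meets only finitely many of the hyperplanes. For irreducibility, every point of the divisor is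
represented in the tube domain of the lattice and orthogonal to one fixed vector; two such points
are joined by a holomorphic curve inside the locus, and by the identity theorem a curve covered by
two closed analytic subsets is contained in one of them.
-/

noncomputable section

namespace K3Heegner

open scoped Matrix

/-! ### Eichler's criterion -/

section Orbits

variable {L L' : Type*} [AddCommGroup L] [AddCommGroup L'] {b : LinearMap.BilinForm ℤ L}
  {b' : LinearMap.BilinForm ℤ L'}

theorem isometryEquiv_apply_symm_apply (g : b.IsometryEquiv b') (x : L') : g (g.symm x) = x :=
  g.toLinearEquiv.apply_symm_apply x

theorem isometryEquiv_symm_apply_apply (g : b.IsometryEquiv b') (x : L) : g.symm (g x) = x :=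
  g.toLinearEquiv.symm_apply_apply x

theorem isometryEquiv_symm_trans_apply {L'' : Type*} [AddCommGroup L'']
    {b'' : LinearMap.BilinForm ℤ L''} (g : b.IsometryEquiv b') (g' : b.IsometryEquiv b'') (x : L) :
    (g.symm.trans g') (g x) = g' x :=
  congrArg g' (isometryEquiv_symm_apply_apply g x)

theorem range_apply_isometryEquiv (g : b.IsometryEquiv b') (v : L) :
    LinearMap.range (b' (g v)) = LinearMap.range (b v) := by
  ext n
  constructor
  · rintro ⟨x, rfl⟩
    exact ⟨g.symm x, by rw [← g.map_app, isometryEquiv_apply_symm_apply]⟩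
  · rintro ⟨x, rfl⟩
    exact ⟨g x, g.map_app x v⟩

theorem map_ker_apply_isometryEquiv (φ : b.IsometryEquiv b') (v : L) :
    (LinearMap.ker (b v)).map φ.toLinearEquiv.toLinearMap = LinearMap.ker (b' (φ v)) := by
  ext y
  rw [Submodule.mem_map_equiv, LinearMap.mem_ker, LinearMap.mem_ker, ← φ.map_app]
  exact iff_of_eq (congrArg (b' (φ v) · = 0) (isometryEquiv_apply_symm_apply φ y))

/-- The vectors `v` and `w` are in the same orbit of the isometry group of `b`. -/
def SameOrbit (b : LinearMap.BilinForm ℤ L) (v w : L) : Prop :=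
  ∃ g : b.IsometryEquiv b, g v = w

namespace SameOrbit

theorem refl (v : L) : SameOrbit b v v :=
  ⟨LinearMap.BilinForm.IsometryEquiv.refl b, rfl⟩

theorem symm {v w : L} : SameOrbit b v w → SameOrbit b w v := by
  rintro ⟨g, rfl⟩
  exact ⟨g.symm, isometryEquiv_symm_apply_apply g v⟩

theorem trans {u v w : L} : SameOrbit b u v → SameOrbit b v w → SameOrbit b u w := by
  rintro ⟨g, rfl⟩ ⟨g', rfl⟩
  exact ⟨g.trans g', rfl⟩

theorem apply_self {v w : L} : SameOrbit b v w → b w w = b v v := by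
  rintro ⟨g, rfl⟩
  exact g.map_app v v

theorem smul (n : ℤ) {v w : L} : SameOrbit b v w → SameOrbit b (n • v) (n • w) := by
  rintro ⟨g, rfl⟩
  exact ⟨g, map_smul g.toLinearEquiv n v⟩

theorem map {v w : L} (g : b.IsometryEquiv b') :
    SameOrbit b v w → SameOrbit b' (g v) (g w) := by
  rintro ⟨k, rfl⟩
  exact ⟨(g.symm.trans k).trans g, congrArg g (isometryEquiv_symm_trans_apply g k v)⟩

theorem image_setOf (ψ : b.IsometryEquiv b') (v : L) :
    ψ '' {w | SameOrbit b v w} = {w | SameOrbit b' (ψ v) w} := by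
  ext w
  constructor
  · rintro ⟨w, hw, rfl⟩
    exact hw.map ψ
  · rintro ⟨g, rfl⟩
    refine ⟨ψ.symm (g (ψ v)), ⟨(ψ.trans g).trans ψ.symm, rfl⟩, ?_⟩
    exact isometryEquiv_apply_symm_apply ψ _

end SameOrbit

namespace HasDivisibility

variable {v w : L} {t : ℕ}

theorem map (h : HasDivisibility b v t) (g : b.IsometryEquiv b') : HasDivisibility b' (g v) t :=
  (range_apply_isometryEquiv g v).trans h

theorem of_sameOrbit (h : HasDivisibility b v t) : SameOrbit b v w → HasDivisibility b w t := by
  rintro ⟨g, rfl⟩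
  exact h.map g

theorem dvd (h : HasDivisibility b v t) (x : L) : (t : ℤ) ∣ b v x :=
  Ideal.mem_span_singleton.1 <| h ▸ LinearMap.mem_range_self (b v) x

theorem exists_eq (h : HasDivisibility b v t) : ∃ x, b v x = t :=
  LinearMap.mem_range.1 <| h ▸ Ideal.mem_span_singleton_self (t : ℤ)

theorem natAbs_eq_of_dvd (h : HasDivisibility b v t) {p : ℤ} (hp : ∀ x, p ∣ b v x)
    (hv : ∃ x, b v x = p) : p.natAbs = t := by
  obtain ⟨x, hx⟩ := hv
  obtain ⟨y, hy⟩ := h.exists_eq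
  exact Int.natAbs_eq_of_dvd_dvd (hy ▸ hp y) (hx ▸ h.dvd x)

end HasDivisibility

theorem exists_hasDivisibility (b : LinearMap.BilinForm ℤ L) (v : L) :
    ∃ t : ℕ, HasDivisibility b v t := by
  obtain ⟨a, ha⟩ := (IsPrincipalIdealRing.principal (LinearMap.range (b v) : Ideal ℤ)).1
  exact ⟨a.natAbs, ha.trans (Int.span_natAbs a).symm⟩

end Orbits

section HyperbolicSum

variable {M : Type*} [AddCommGroup M]

/-- The orthogonal sum `U ⊕ M` of a hyperbolic plane and the lattice `M` with form `B`. -/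
def hyperbolicSum (B : LinearMap.BilinForm ℤ M) : LinearMap.BilinForm ℤ (ℤ × ℤ × M) :=
  LinearMap.mk₂ ℤ (fun v w => v.1 * w.2.1 + v.2.1 * w.1 + B v.2.2 w.2.2)
    (fun x y z => by simp only [Prod.fst_add, Prod.snd_add, map_add, LinearMap.add_apply]; ring)
    (fun c x y => by
      simp only [Prod.smul_fst, Prod.smul_snd, smul_eq_mul, map_smul, LinearMap.smul_apply]; ring)
    (fun x y z => by simp only [Prod.fst_add, Prod.snd_add, map_add]; ring)
    (fun c x y => by simp only [Prod.smul_fst, Prod.smul_snd, smul_eq_mul, map_smul]; ring)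

theorem hyperbolicSum_apply (B : LinearMap.BilinForm ℤ M) (p q p' q' : ℤ) (x x' : M) :
    hyperbolicSum B (p, q, x) (p', q', x') = p * q' + q * p' + B x x' :=
  rfl

variable {B : LinearMap.BilinForm ℤ M}

theorem hyperbolicSum_symm (hB : ∀ x y, B x y = B y x) (v w : ℤ × ℤ × M) :
    hyperbolicSum B v w = hyperbolicSum B w v := by
  obtain ⟨p, q, x⟩ := v
  obtain ⟨p', q', x'⟩ := w
  rw [hyperbolicSum_apply, hyperbolicSum_apply, hB x]
  ring

theorem even_hyperbolicSum (hev : ∀ x, Even (B x x)) (v : ℤ × ℤ × M) :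
    Even (hyperbolicSum B v v) := by
  obtain ⟨p, q, x⟩ := v
  rw [hyperbolicSum_apply, mul_comm q p]
  exact (Even.add_self _).add (hev x)

/-- The isometry `id ⊕ g` of `U ⊕ B` onto `U ⊕ B'`. -/
def hyperbolicSumCongr {M' : Type*} [AddCommGroup M'] {B' : LinearMap.BilinForm ℤ M'}
    (g : B.IsometryEquiv B') : (hyperbolicSum B).IsometryEquiv (hyperbolicSum B') where
  toFun v := (v.1, v.2.1, g v.2.2)
  invFun v := (v.1, v.2.1, g.symm v.2.2)
  left_inv v := by simp only [isometryEquiv_symm_apply_apply]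
  right_inv v := by simp only [isometryEquiv_apply_symm_apply]
  map_add' _ _ := by simp
  map_smul' _ _ := by simp
  map_app' v w := by
    simp only [hyperbolicSum_apply, g.map_app]
    rfl

namespace SameOrbit

theorem hyperbolicSum_swap (p q : ℤ) (x : M) :
    SameOrbit (hyperbolicSum B) (p, q, x) (q, p, x) :=
  ⟨{  toFun := fun v => (v.2.1, v.1, v.2.2)
      invFun := fun v => (v.2.1, v.1, v.2.2)
      map_add' := fun _ _ => rfl
      map_smul' := fun _ _ => rfl
      map_app' := by
        rintro ⟨p, q, x⟩ ⟨p', q', x'⟩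
        simp only [hyperbolicSum_apply]
        ring }, rfl⟩

theorem hyperbolicSum_neg (p q : ℤ) (x : M) :
    SameOrbit (hyperbolicSum B) (p, q, x) (-p, -q, x) :=
  ⟨{  toFun := fun v => (-v.1, -v.2.1, v.2.2)
      invFun := fun v => (-v.1, -v.2.1, v.2.2)
      left_inv := fun _ => by simp
      right_inv := fun _ => by simp
      map_add' := fun _ _ => by simp [add_comm]
      map_smul' := fun _ _ => by simp
      map_app' := by
        rintro ⟨p, q, x⟩ ⟨p', q', x'⟩
        simp only [hyperbolicSum_apply]
        ring }, rfl⟩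

theorem hyperbolicSum_right {x y : M} (p q : ℤ) :
    SameOrbit B x y → SameOrbit (hyperbolicSum B) (p, q, x) (p, q, y) := by
  rintro ⟨g, rfl⟩
  exact ⟨hyperbolicSumCongr g, rfl⟩

theorem hyperbolicSum_transvection (hB : ∀ x y, B x y = B y x) {a : M} {c : ℤ}
    (hc : B a a = 2 * c) (p q : ℤ) (x : M) :
    SameOrbit (hyperbolicSum B) (p, q, x) (p, q - B a x - c * p, x + p • a) :=
  ⟨{  toFun := fun v => (v.1, v.2.1 - B a v.2.2 - c * v.1, v.2.2 + v.1 • a)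
      invFun := fun v => (v.1, v.2.1 + B a v.2.2 - c * v.1, v.2.2 - v.1 • a)
      left_inv := fun v => by
        ext
        · rfl
        · simp only [map_add, map_smul, hc, smul_eq_mul]
          ring
        · exact add_sub_cancel_right _ _
      right_inv := fun v => by
        ext
        · rfl
        · simp only [map_sub, map_smul, hc, smul_eq_mul]
          ring
        · exact sub_add_cancel _ _
      map_add' := fun v w => by
        ext
        · rfl
        · simp only [Prod.fst_add, Prod.snd_add, map_add]
          ring
        · simp only [Prod.fst_add, Prod.snd_add, add_smul]
          abel
      map_smul' := fun k v => by
        ext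
        · rfl
        · simp only [Prod.smul_fst, Prod.smul_snd, map_smul, smul_eq_mul, RingHom.id_apply]
          ring
        · simp only [Prod.smul_fst, Prod.smul_snd, smul_add, mul_smul, smul_eq_mul,
            RingHom.id_apply]
      map_app' := by
        rintro ⟨p, q, x⟩ ⟨p', q', x'⟩
        simp only [hyperbolicSum_apply, map_add, map_smul, LinearMap.add_apply,
          LinearMap.smul_apply, smul_eq_mul, hc, hB _ a]
        ring }, rfl⟩

theorem hyperbolicSum_exchange (p q r s : ℤ) (x : M) :
    SameOrbit (hyperbolicSum (hyperbolicSum B)) (p, q, r, s, x) (r, s, p, q, x) :=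
  ⟨{  toFun := fun v => (v.2.2.1, v.2.2.2.1, v.1, v.2.1, v.2.2.2.2)
      invFun := fun v => (v.2.2.1, v.2.2.2.1, v.1, v.2.1, v.2.2.2.2)
      map_add' := fun _ _ => rfl
      map_smul' := fun _ _ => rfl
      map_app' := by
        rintro ⟨p, q, r, s, x⟩ ⟨p', q', r', s', x'⟩
        simp only [hyperbolicSum_apply]
        ring }, rfl⟩

end SameOrbit

end HyperbolicSum

section Eichler

open SameOrbit

variable {M N : Type*} [AddCommGroup M] [AddCommGroup N]

theorem exists_sameOrbit_fst_ne_zero {B : LinearMap.BilinForm ℤ M} (hB : ∀ x y, B x y = B y x)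
    (hev : ∀ x, Even (B x x)) {v : ℤ × ℤ × M} (hv : hyperbolicSum B v ≠ 0) :
    ∃ w, SameOrbit (hyperbolicSum B) v w ∧ w.1 ≠ 0 := by
  obtain ⟨p, q, x⟩ := v
  by_contra! hzero
  have hp : p = 0 := hzero _ (SameOrbit.refl _)
  have hq : q = 0 := hzero _ (hyperbolicSum_swap p q x)
  have hx (a : M) : B x a = 0 := by
    obtain ⟨c, hc⟩ := hev a
    have hfst := hzero _ ((hyperbolicSum_transvection hB (hc.trans (two_mul c).symm) p q x).trans
      (hyperbolicSum_swap _ _ _))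
    simpa [hp, hq, hB a] using hfst
  refine hv (LinearMap.ext fun ⟨p', q', x'⟩ => ?_)
  simp [hyperbolicSum_apply, hp, hq, hx]

theorem exists_sameOrbit_fst_minimal {B : LinearMap.BilinForm ℤ M} (hB : ∀ x y, B x y = B y x)
    (hev : ∀ x, Even (B x x)) {v : ℤ × ℤ × M} (hv : hyperbolicSum B v ≠ 0) :
    ∃ w, SameOrbit (hyperbolicSum B) v w ∧ w.1 ≠ 0 ∧
      ∀ w', SameOrbit (hyperbolicSum B) v w' → w'.1 ≠ 0 → w.1.natAbs ≤ w'.1.natAbs := by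
  obtain ⟨w, ⟨hw, hw₀⟩, hmin⟩ := exists_minimalFor_of_wellFoundedLT
    (fun w => SameOrbit (hyperbolicSum B) v w ∧ w.1 ≠ 0) (fun w => w.1.natAbs)
    (exists_sameOrbit_fst_ne_zero hB hev hv)
  exact ⟨w, hw, hw₀, fun w' hw' h₀ => (le_total _ _).elim id fun h => hmin ⟨hw', h₀⟩ h⟩

variable {B : LinearMap.BilinForm ℤ N} {v : ℤ × ℤ × ℤ × ℤ × N} {p : ℤ}

theorem dvd_of_fst_minimal (hB : ∀ x y, B x y = B y x) (hp : p ≠ 0)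
    (hmin : ∀ w, SameOrbit (hyperbolicSum (hyperbolicSum B)) v w → w.1 ≠ 0 →
      p.natAbs ≤ w.1.natAbs) {q r s : ℤ} {x : N}
    (hw : SameOrbit (hyperbolicSum (hyperbolicSum B)) v (p, q, r, s, x)) : p ∣ r := by
  by_contra hndvd
  have hshift := (hw.trans (hyperbolicSum_transvection (hyperbolicSum_symm hB)
    (a := (-(r / p), 0, 0)) (c := 0) (by simp [hyperbolicSum_apply]) _ _ _)).trans
    (hyperbolicSum_exchange _ _ _ _ _)
  have hmod : r + p * -(r / p) = r % p := by rw [Int.emod_def]; ring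
  have hle := hmin _ hshift
  simp only [Prod.smul_fst, smul_eq_mul, hmod] at hle
  have hpos := Int.emod_nonneg r hp
  have hlt := Int.emod_lt_abs r hp
  have := hle fun h => hndvd (Int.dvd_of_emod_eq_zero h)
  rw [Int.abs_eq_natAbs] at hlt
  omega

theorem exists_sameOrbit_normal_form (hB : ∀ x y, B x y = B y x) (hev : ∀ x, Even (B x x))
    (hv : hyperbolicSum (hyperbolicSum B) v ≠ 0) :
    ∃ (p q : ℤ) (x : N), SameOrbit (hyperbolicSum (hyperbolicSum B)) v (p, p * q, 0, 0, x) ∧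
      ∀ y, p ∣ B x y := by
  obtain ⟨⟨p, q, r, s, x⟩, hw, hp, hmin⟩ := exists_sameOrbit_fst_minimal
    (hyperbolicSum_symm hB) (even_hyperbolicSum hev) hv
  have hdvd {q r s : ℤ} {x : N}
      (h : SameOrbit (hyperbolicSum (hyperbolicSum B)) v (p, q, r, s, x)) : p ∣ r :=
    dvd_of_fst_minimal hB hp hmin h
  obtain ⟨k, rfl⟩ := hdvd hw
  obtain ⟨l, rfl⟩ := hdvd (((hw.trans (hyperbolicSum_exchange _ _ _ _ _)).trans
    (hyperbolicSum_swap _ _ _)).trans (hyperbolicSum_exchange _ _ _ _ _))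
  have hclear := hw.trans (hyperbolicSum_transvection (hyperbolicSum_symm hB)
    (a := (-k, -l, 0)) (c := k * l) (by simp only [hyperbolicSum_apply, map_zero]; ring) _ _ _)
  simp only [Prod.smul_mk, Prod.mk_add_mk, smul_eq_mul, mul_neg, add_neg_cancel, smul_zero,
    add_zero] at hclear
  set q' := q - hyperbolicSum B (-k, -l, 0) (p * k, p * l, x) - k * l * p
  have hflip := hclear.trans (hyperbolicSum_exchange _ _ _ _ _)
  have hshift (a : ℤ × ℤ × N) {c : ℤ} (hc : hyperbolicSum B a a = 2 * c) :
      p ∣ hyperbolicSum B a (p, q', x) := by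
    have := hdvd (((hflip.trans (hyperbolicSum_transvection (hyperbolicSum_symm hB) hc _ _ _)).trans
      (hyperbolicSum_swap _ _ _)).trans (by
        rw [zero_smul, add_zero]; exact hyperbolicSum_exchange _ _ _ _ _))
    simpa using this
  obtain ⟨k', hk'⟩ : p ∣ q' := by
    simpa [hyperbolicSum_apply] using hshift (1, 0, 0) (c := 0) (by simp [hyperbolicSum_apply])
  refine ⟨p, k', x, hk' ▸ hclear, fun y => ?_⟩
  obtain ⟨c, hc⟩ := hev y
  simpa [hyperbolicSum_apply, hB y] using
    hshift (0, 0, y) (c := c) (by simpa [hyperbolicSum_apply, two_mul] using hc)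

theorem exists_sameOrbit_of_hasDivisibility (hB : ∀ x y, B x y = B y x)
    (hev : ∀ x, Even (B x x)) {t : ℕ} (ht : t ≠ 0)
    (hv : HasDivisibility (hyperbolicSum (hyperbolicSum B)) v t) :
    ∃ (q : ℤ) (x : N), SameOrbit (hyperbolicSum (hyperbolicSum B)) v (t, t * q, 0, 0, x) ∧
      ∀ y, (t : ℤ) ∣ B x y := by
  obtain ⟨y, hy⟩ := hv.exists_eq
  obtain ⟨p, q, x, hw, hdvd⟩ := exists_sameOrbit_normal_form hB hev (v := v)
    fun h => ht (by simpa [h] using hy.symm)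
  have hpt : p.natAbs = t := by
    refine (hv.of_sameOrbit hw).natAbs_eq_of_dvd ?_ ⟨(0, 1, 0, 0, 0), ?_⟩
    · rintro ⟨p', q', r', s', x'⟩
      simp only [hyperbolicSum_apply, zero_mul, zero_add, mul_assoc]
      exact dvd_add (dvd_add (dvd_mul_right _ _) (dvd_mul_right _ _)) (hdvd x')
    · simp [hyperbolicSum_apply]
  rcases Int.natAbs_eq p with h | h <;> rw [hpt] at h <;> subst h
  · exact ⟨q, x, hw, hdvd⟩
  · refine ⟨q, x, ?_, fun z => neg_dvd.1 (hdvd z)⟩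
    simpa only [neg_mul, neg_neg] using hw.trans (hyperbolicSum_neg _ _ _)

theorem exists_sameOrbit_add_smul (hB : ∀ x y, B x y = B y x) (hev : ∀ x, Even (B x x))
    {t : ℤ} {x : N} (hx : ∀ y, t ∣ B x y) (q : ℤ) (a : N) :
    ∃ q', SameOrbit (hyperbolicSum (hyperbolicSum B)) (t, t * q, 0, 0, x)
      (t, t * q', 0, 0, x + t • a) := by
  obtain ⟨c, hc⟩ := hev a
  obtain ⟨k, hk⟩ := hx a
  refine ⟨q - k - c, ?_⟩
  convert hyperbolicSum_transvection (hyperbolicSum_symm hB) (a := (0, 0, a)) (c := c)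
    (by simpa [hyperbolicSum_apply, two_mul] using hc) t (t * q) (0, 0, x) using 2
  simp only [hyperbolicSum_apply, hB a x, hk, Prod.smul_mk, Prod.mk_add_mk, smul_zero, add_zero,
    Prod.mk.injEq, and_true]
  ring

end Eichler

/-! ### Gram matrices over arbitrary rings -/

section GramForm

variable {ι κ R S : Type*} [Fintype ι] [DecidableEq ι] [Fintype κ] [DecidableEq κ] [CommRing R]
  [CommRing S]

variable (R) in
/-- The bilinear form on `ι → R` with the integral Gram matrix `G`. -/
def gramForm (G : Matrix ι ι ℤ) : LinearMap.BilinForm R (ι → R) :=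
  Matrix.toBilin' (G.map Int.cast)

theorem gramForm_apply (G : Matrix ι ι ℤ) (x y : ι → R) :
    gramForm R G x y = ∑ i, ∑ j, x i * G i j * y j :=
  Matrix.toBilin'_apply _ x y

theorem gramForm_int (G : Matrix ι ι ℤ) : gramForm ℤ G = Matrix.toBilin' G := by
  rw [gramForm]
  congr 1

theorem gramForm_symm {G : Matrix ι ι ℤ} (hG : G.IsSymm) (x y : ι → R) :
    gramForm R G x y = gramForm R G y x := by
  rw [gramForm_apply, gramForm_apply, Finset.sum_comm]
  refine Finset.sum_congr rfl fun i _ => Finset.sum_congr rfl fun j _ => ?_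
  rw [hG.apply i j]
  ring

theorem gramForm_map (f : R →+* S) (G : Matrix ι ι ℤ) (x y : ι → R) :
    gramForm S G (f ∘ x) (f ∘ y) = f (gramForm R G x y) := by
  simp [gramForm_apply]

theorem gramForm_intCast (G : Matrix ι ι ℤ) (x y : ι → ℤ) :
    gramForm R G (Int.cast ∘ x) (Int.cast ∘ y) = gramForm ℤ G x y :=
  gramForm_map (Int.castRingHom R) G x y

theorem gramForm_neg (G : Matrix ι ι ℤ) (x y : ι → R) :
    gramForm R (-G) x y = -gramForm R G x y := by
  simp [gramForm_apply]

theorem gramForm_fromBlocks (A : Matrix ι ι ℤ) (D : Matrix κ κ ℤ) (x y : ι ⊕ κ → R) :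
    gramForm R (Matrix.fromBlocks A 0 0 D) x y =
      gramForm R A (x ∘ Sum.inl) (y ∘ Sum.inl) + gramForm R D (x ∘ Sum.inr) (y ∘ Sum.inr) := by
  simp [gramForm_apply, Fintype.sum_sum_type]

theorem gramForm_smul_add_smul {G : Matrix ι ι ℤ} (hG : G.IsSymm) (s t : R) (x y : ι → R) :
    gramForm R G (s • x + t • y) (s • x + t • y) =
      s ^ 2 * gramForm R G x x + 2 * s * t * gramForm R G x y + t ^ 2 * gramForm R G y y := by
  simp only [map_add, map_smul, LinearMap.add_apply, LinearMap.smul_apply, smul_eq_mul,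
    gramForm_symm hG y x]
  ring

end GramForm

section ComplexGramForm

variable {ι : Type*} (v : ι → ℂ)

theorem ofReal_re_add_I_smul_ofReal_im :
    Complex.ofRealHom ∘ Complex.re ∘ v + Complex.I • (Complex.ofRealHom ∘ Complex.im ∘ v) = v := by
  funext i
  simp [mul_comm Complex.I]

theorem ofReal_re_sub_I_smul_ofReal_im :
    Complex.ofRealHom ∘ Complex.re ∘ v - Complex.I • (Complex.ofRealHom ∘ Complex.im ∘ v) =
      starRingEnd ℂ ∘ v := by
  funext i
  simp [Complex.ext_iff]

variable [Fintype ι] [DecidableEq ι] {G : Matrix ι ι ℤ}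

theorem gramForm_complex_self (hG : G.IsSymm) : gramForm ℂ G v v =
    (gramForm ℝ G (Complex.re ∘ v) (Complex.re ∘ v) -
        gramForm ℝ G (Complex.im ∘ v) (Complex.im ∘ v) : ℝ) +
      (2 * gramForm ℝ G (Complex.re ∘ v) (Complex.im ∘ v) : ℝ) * Complex.I := by
  conv_lhs => rw [← ofReal_re_add_I_smul_ofReal_im v]
  simp only [map_add, map_smul, LinearMap.add_apply, LinearMap.smul_apply, gramForm_map,
    smul_eq_mul, Complex.ofRealHom_eq_coe, gramForm_symm hG (Complex.im ∘ v) (Complex.re ∘ v)]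
  push_cast
  linear_combination (gramForm ℝ G (Complex.im ∘ v) (Complex.im ∘ v) : ℂ) * Complex.I_sq

theorem gramForm_conj_right (hG : G.IsSymm) : gramForm ℂ G v (starRingEnd ℂ ∘ v) =
    (gramForm ℝ G (Complex.re ∘ v) (Complex.re ∘ v) +
      gramForm ℝ G (Complex.im ∘ v) (Complex.im ∘ v) : ℝ) := by
  rw [← ofReal_re_sub_I_smul_ofReal_im]
  conv_lhs => enter [1]; rw [← ofReal_re_add_I_smul_ofReal_im v]
  simp only [map_add, map_sub, map_smul, LinearMap.add_apply, LinearMap.smul_apply, gramForm_map,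
    smul_eq_mul, Complex.ofRealHom_eq_coe, gramForm_symm hG (Complex.im ∘ v) (Complex.re ∘ v)]
  push_cast
  linear_combination -(gramForm ℝ G (Complex.im ∘ v) (Complex.im ∘ v) : ℂ) * Complex.I_sq

theorem gramForm_ofReal_left (G : Matrix ι ι ℤ) (w : ι → ℝ) : gramForm ℂ G (Complex.ofReal ∘ w) v =
    gramForm ℝ G w (Complex.re ∘ v) + gramForm ℝ G w (Complex.im ∘ v) * Complex.I := by
  conv_lhs => rw [← ofReal_re_add_I_smul_ofReal_im v]
  rw [map_add, map_smul, smul_eq_mul, mul_comm Complex.I]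
  exact congrArg₂ (· + · * _) (gramForm_map Complex.ofRealHom G w _)
    (gramForm_map Complex.ofRealHom G w _)

theorem gramForm_ofReal_left_eq_zero_iff (G : Matrix ι ι ℤ) {w : ι → ℝ} :
    gramForm ℂ G (Complex.ofReal ∘ w) v = 0 ↔
      gramForm ℝ G w (Complex.re ∘ v) = 0 ∧ gramForm ℝ G w (Complex.im ∘ v) = 0 := by
  simp [gramForm_ofReal_left, Complex.ext_iff]

variable (G) in
/-- The cone over the period domain of the lattice with Gram matrix `G`, in coordinates. -/
def gramCone : Set (ι → ℂ) :=
  {v | gramForm ℂ G v v = 0 ∧ 0 < (gramForm ℂ G v (starRingEnd ℂ ∘ v)).re}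

variable {v}

theorem gramForm_complex_self_eq_zero_iff (hG : G.IsSymm) : gramForm ℂ G v v = 0 ↔
    gramForm ℝ G (Complex.re ∘ v) (Complex.re ∘ v) =
        gramForm ℝ G (Complex.im ∘ v) (Complex.im ∘ v) ∧
      gramForm ℝ G (Complex.re ∘ v) (Complex.im ∘ v) = 0 := by
  simp [gramForm_complex_self v hG, Complex.ext_iff, sub_eq_zero]

theorem mem_gramCone_iff (hG : G.IsSymm) : v ∈ gramCone G ↔
    gramForm ℂ G v v = 0 ∧ 0 < gramForm ℝ G (Complex.im ∘ v) (Complex.im ∘ v) := by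
  refine and_congr_right fun hnull => ?_
  rw [gramForm_conj_right v hG, Complex.ofReal_re,
    ((gramForm_complex_self_eq_zero_iff hG).1 hnull).1, ← two_mul, mul_pos_iff_of_pos_left two_pos]

end ComplexGramForm

section ComplexCoordinates

variable {ι L L' : Type*} [Fintype ι] [DecidableEq ι] {G : Matrix ι ι ℤ}
  [AddCommGroup L] [AddCommGroup L'] {b : LinearMap.BilinForm ℤ L} {b' : LinearMap.BilinForm ℤ L'}

theorem baseChange_isometryEquiv (φ : b.IsometryEquiv b') (v w : ℂ ⊗[ℤ] L) :
    b'.baseChange ℂ ((φ : L ≃ₗ[ℤ] L').baseChange ℤ ℂ L L' v)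
      ((φ : L ≃ₗ[ℤ] L').baseChange ℤ ℂ L L' w) = b.baseChange ℂ v w := by
  induction v with
  | zero => simp
  | add x x' hx hx' => simp [hx, hx']
  | tmul z x =>
    induction w with
    | zero => simp
    | add y y' hy hy' => simp only [map_add, hy, hy']
    | tmul w y => simp

variable (ψ : (gramForm ℤ G).IsometryEquiv b)

/-- The coordinates on `ℂ ⊗ L` given by an isometry from the lattice with Gram matrix `G`
to `L`. -/
def complexCoords : ℂ ⊗[ℤ] L ≃ₗ[ℂ] (ι → ℂ) :=
  ((ψ.symm : L ≃ₗ[ℤ] (ι → ℤ)).baseChange ℤ ℂ L (ι → ℤ)).trans (TensorProduct.piScalarRight ℤ ℂ ℂ ι)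

theorem complexCoords_tmul (z : ℂ) (x : L) :
    complexCoords ψ (z ⊗ₜ x) = z • (Int.cast ∘ ψ.symm x) := by
  funext i
  simp [complexCoords, mul_comm]

theorem complexCoords_conj (v : ℂ ⊗[ℤ] L) :
    complexCoords ψ (conj v) = starRingEnd ℂ ∘ complexCoords ψ v := by
  induction v with
  | zero => funext i; simp
  | add x y hx hy => rw [map_add, map_add, hx, hy, map_add]; funext i; simp
  | tmul z x => rw [conj_tmul, complexCoords_tmul, complexCoords_tmul]; funext i; simp

theorem gramForm_complexCoords (v w : ℂ ⊗[ℤ] L) :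
    gramForm ℂ G (complexCoords ψ v) (complexCoords ψ w) = b.baseChange ℂ v w := by
  induction v with
  | zero => simp
  | add x y hx hy => simp only [map_add, LinearMap.add_apply, hx, hy]
  | tmul z x =>
    induction w with
    | zero => simp
    | add x y hx hy => simp only [map_add, hx, hy]
    | tmul w y =>
      rw [complexCoords_tmul, complexCoords_tmul, map_smul, map_smul, LinearMap.smul_apply,
        gramForm_intCast, LinearMap.BilinForm.baseChange_tmul, ← ψ.map_app,
        isometryEquiv_apply_symm_apply, isometryEquiv_apply_symm_apply]
      simp only [smul_eq_mul, zsmul_eq_mul]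
      ring

theorem complexCoords_mem_gramCone {v : ℂ ⊗[ℤ] L} :
    complexCoords ψ v ∈ gramCone G ↔ v ∈ periodCone b := by
  rw [gramCone, periodCone, Set.mem_ofPred_eq, Set.mem_ofPred_eq, ← complexCoords_conj,
    gramForm_complexCoords, gramForm_complexCoords]

theorem baseChange_one_tmul_apply (β : ι → ℤ) (v : ℂ ⊗[ℤ] L) :
    b.baseChange ℂ (1 ⊗ₜ ψ β) v = gramForm ℂ G (Int.cast ∘ β) (complexCoords ψ v) := by
  rw [← gramForm_complexCoords ψ, complexCoords_tmul, isometryEquiv_symm_apply_apply, one_smul]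

end ComplexCoordinates

/-! ### Analytic subsets and local finiteness -/

section LocalFiniteness

open Filter Topology

theorem finite_setOf_norm_intCast_le {ι : Type*} [Fintype ι] (C : ℝ) :
    {β : ι → ℤ | ‖(Int.cast ∘ β : ι → ℝ)‖ ≤ C}.Finite := by
  classical
  refine (Set.finite_Icc (fun _ => -⌈C⌉) fun _ => ⌈C⌉).subset fun β hβ => ?_
  have hcoord (i : ι) : |β i| ≤ ⌈C⌉ := by
    have hle := ((norm_le_pi_norm (Int.cast ∘ β : ι → ℝ) i).trans hβ).trans (Int.le_ceil C)
    rw [Function.comp_apply, Real.norm_eq_abs] at hle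
    exact_mod_cast hle
  exact ⟨fun i => (abs_le.1 (hcoord i)).1, fun i => (abs_le.1 (hcoord i)).2⟩

variable {ι : Type*} [Fintype ι] [DecidableEq ι] {G : Matrix ι ι ℤ} {p : ι → ℂ}

theorem eventually_forall_sphere_gramForm_add_lt
    (hp : ∀ w : ι → ℝ, w ≠ 0 → gramForm ℂ G (Complex.ofReal ∘ w) p = 0 → gramForm ℝ G w w < 0) :
    ∀ᶠ z : ℝ × (ι → ℂ) in 𝓝 (0, p), ∀ w ∈ Metric.sphere (0 : ι → ℝ) 1,
      gramForm ℂ G (Complex.ofReal ∘ w) z.2 ≠ 0 ∨ gramForm ℝ G w w + z.1 < 0 := by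
  refine (isCompact_sphere _ _).eventually_forall_of_forall_eventually fun w hw => ?_
  have hpair : Continuous fun y : (ℝ × (ι → ℂ)) × (ι → ℝ) =>
      gramForm ℂ G (Complex.ofReal ∘ y.2) y.1.2 := by
    simp only [gramForm_apply, Function.comp_apply]
    fun_prop
  have hself : Continuous fun y : (ℝ × (ι → ℂ)) × (ι → ℝ) => gramForm ℝ G y.2 y.2 + y.1.1 := by
    simp only [gramForm_apply]
    fun_prop
  by_cases horth : gramForm ℂ G (Complex.ofReal ∘ w) p = 0
  · have hneg : gramForm ℝ G w w + 0 < 0 := by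
      simpa using hp w (ne_zero_of_mem_unit_sphere ⟨w, hw⟩) horth
    filter_upwards [(isOpen_lt hself continuous_const).mem_nhds hneg] with y hy
    exact Or.inr hy
  · filter_upwards [hpair.continuousAt.eventually_ne horth] with y hy
    exact Or.inl hy

theorem exists_eventually_gramForm_le_neg_mul_sq_norm
    (hp : ∀ w : ι → ℝ, w ≠ 0 → gramForm ℂ G (Complex.ofReal ∘ w) p = 0 → gramForm ℝ G w w < 0) :
    ∃ ε > 0, ∀ᶠ v in 𝓝 p, ∀ w : ι → ℝ, gramForm ℂ G (Complex.ofReal ∘ w) v = 0 →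
      gramForm ℝ G w w ≤ -ε * ‖w‖ ^ 2 := by
  have hcurry : ∀ᶠ ε in 𝓝 (0 : ℝ), ∀ᶠ v in 𝓝 p, ∀ w ∈ Metric.sphere (0 : ι → ℝ) 1,
      gramForm ℂ G (Complex.ofReal ∘ w) v ≠ 0 ∨ gramForm ℝ G w w + ε < 0 :=
    (eventually_forall_sphere_gramForm_add_lt hp).curry_nhds
  obtain ⟨ε, hev, hε⟩ := ((hcurry.filter_mono (nhdsWithin_le_nhds (s := Set.Ioi 0))).and
    self_mem_nhdsWithin).exists
  refine ⟨ε, hε, hev.mono fun v hv w hw => ?_⟩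
  rcases eq_or_ne w 0 with rfl | hw₀
  · simp
  have hnorm : 0 < ‖w‖ := norm_pos_iff.2 hw₀
  have hunit : ‖w‖⁻¹ • w ∈ Metric.sphere (0 : ι → ℝ) 1 := by
    simp [norm_smul, hnorm.ne']
  have hscale : Complex.ofReal ∘ (‖w‖⁻¹ • w) = (‖w‖⁻¹ : ℂ) • (Complex.ofReal ∘ w) := by
    funext i
    simp
  have hlt := (hv _ hunit).resolve_left
    (not_not.2 (by rw [hscale, map_smul, LinearMap.smul_apply, hw, smul_zero]))
  have hexpand : gramForm ℝ G w w = ‖w‖ ^ 2 * gramForm ℝ G (‖w‖⁻¹ • w) (‖w‖⁻¹ • w) := by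
    simp only [map_smul, LinearMap.smul_apply, smul_eq_mul]
    field_simp
  rw [hexpand]
  nlinarith [sq_pos_of_pos hnorm]

theorem exists_nhds_finite_orthogonal
    (hp : ∀ w : ι → ℝ, w ≠ 0 → gramForm ℂ G (Complex.ofReal ∘ w) p = 0 → gramForm ℝ G w w < 0)
    (n : ℤ) : ∃ U ∈ 𝓝 p,
      {β : ι → ℤ | gramForm ℤ G β β = n ∧ ∃ v ∈ U, gramForm ℂ G (Int.cast ∘ β) v = 0}.Finite := by
  obtain ⟨ε, hε, hev⟩ := exists_eventually_gramForm_le_neg_mul_sq_norm hp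
  refine ⟨_, hev, (finite_setOf_norm_intCast_le (1 + -n / ε)).subset ?_⟩
  rintro β ⟨hβ, v, hv, horth⟩
  have hcast : (Int.cast ∘ β : ι → ℂ) = Complex.ofReal ∘ Int.cast ∘ β := by
    funext i
    simp
  have hle := hv (Int.cast ∘ β) (hcast ▸ horth)
  rw [gramForm_intCast, hβ] at hle
  have hsq : ‖(Int.cast ∘ β : ι → ℝ)‖ ^ 2 ≤ -n / ε := by
    rw [le_div_iff₀ hε]
    linarith
  change ‖(Int.cast ∘ β : ι → ℝ)‖ ≤ _
  nlinarith [sq_nonneg (‖(Int.cast ∘ β : ι → ℝ)‖ - 1)]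

end LocalFiniteness

section Analytic

open Topology

variable {V : Type*} [AddCommGroup V] [Module ℂ V] [Module.Finite ℂ V] {D A A' : Set V}

theorem IsAnalyticIn.congr (h : IsAnalyticIn D A) (hAA' : ∀ v ∈ D, v ∈ A ↔ v ∈ A') :
    IsAnalyticIn D A' := by
  intro p hp
  obtain ⟨U, hU, hpU, r, f, hf, hzero⟩ := h p hp
  exact ⟨U, hU, hpU, r, f, hf, fun v hv hvU => (hAA' v hv).symm.trans (hzero v hv hvU)⟩

theorem isAnalyticIn_iUnion_ker {I ι : Type*} [Finite ι] (c : V ≃ₗ[ℂ] (ι → ℂ))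
    (ℓ : I → (ι → ℂ) →ₗ[ℂ] ℂ) (S : Set I)
    (hfin : ∀ p ∈ D, ∃ U ∈ 𝓝 (c p), {i ∈ S | ∃ u ∈ U, ℓ i u = 0}.Finite) :
    IsAnalyticIn D {v | ∃ i ∈ S, ℓ i (c v) = 0} := by
  intro p hp
  obtain ⟨U, hU, hUfin⟩ := hfin p hp
  let κ : (Fin (Module.finrank ℂ V) → ℂ) →L[ℂ] (ι → ℂ) :=
    (c.toLinearMap ∘ₗ (Module.finBasis ℂ V).equivFun.symm.toLinearMap).toContinuousLinearMap
  have hκ (v : V) : κ ((Module.finBasis ℂ V).equivFun v) = c v := by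
    simp only [κ, LinearMap.coe_toContinuousLinearMap', LinearMap.comp_apply, LinearEquiv.coe_coe,
      LinearEquiv.symm_apply_apply]
  have hlin (i : I) : Differentiable ℂ fun u => ℓ i (κ u) :=
    ((ℓ i).toContinuousLinearMap.comp κ).differentiable
  refine ⟨κ ⁻¹' interior U, isOpen_interior.preimage κ.continuous, ?_, 1,
    fun _ u => ∏ i ∈ hUfin.toFinset, ℓ i (κ u), fun _ u _ => ?_, fun v _ hv => ?_⟩
  · rw [Set.mem_preimage, hκ]
    exact mem_interior_iff_mem_nhds.2 hU
  · classical
    exact (HasFDerivAt.finsetProd fun i _ =>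
      (hlin i u).hasFDerivAt).differentiableAt.differentiableWithinAt
  · rw [Set.mem_preimage, hκ] at hv
    simp only [hκ, Finset.prod_eq_zero_iff, forall_const, Set.Finite.mem_toFinset]
    exact ⟨fun ⟨i, hi, hiv⟩ => ⟨i, ⟨hi, c v, interior_subset hv, hiv⟩, hiv⟩,
      fun ⟨i, hi, hiv⟩ => ⟨i, hi.1, hiv⟩⟩

/-! ### Analytic subsets along curves -/

variable {F : ℂ → V} {Ω : Set ℂ}

theorem IsAnalyticIn.exists_ball (hA : IsAnalyticIn D A) (hΩ : IsOpen Ω)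
    (hF : Differentiable ℂ fun s => (Module.finBasis ℂ V).equivFun (F s))
    (hD : ∀ s ∈ Ω, F s ∈ D) {s : ℂ} (hs : s ∈ Ω) :
    ∃ ε > 0, Metric.ball s ε ⊆ Ω ∧ ∃ (r : ℕ) (f : Fin r → ℂ → ℂ),
      (∀ i, AnalyticOnNhd ℂ (f i) (Metric.ball s ε)) ∧
      ∀ t ∈ Metric.ball s ε, F t ∈ A ↔ ∀ i, f i t = 0 := by
  obtain ⟨U, hU, hsU, r, f, hf, hzero⟩ := hA _ (hD s hs)
  obtain ⟨ε, hε, hball⟩ := Metric.isOpen_iff.1 (hΩ.inter (hU.preimage hF.continuous)) s ⟨hs, hsU⟩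
  exact ⟨ε, hε, fun t ht => (hball ht).1, r, fun i t => f i _,
    fun i => ((hf i).comp hF.differentiableOn fun t ht => (hball ht).2).analyticOnNhd
      Metric.isOpen_ball, fun t ht => hzero _ (hD t (hball ht).1) (hball ht).2⟩

theorem IsAnalyticIn.eventually_notMem (hA : IsAnalyticIn D A) (hΩ : IsOpen Ω)
    (hF : Differentiable ℂ fun s => (Module.finBasis ℂ V).equivFun (F s))
    (hD : ∀ s ∈ Ω, F s ∈ D) {s : ℂ} (hs : s ∈ Ω) (hsA : F s ∉ A) : ∀ᶠ t in 𝓝 s, F t ∉ A := by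
  obtain ⟨ε, hε, -, r, f, hf, hzero⟩ := hA.exists_ball hΩ hF hD hs
  obtain ⟨i, hi⟩ := not_forall.1 (mt (hzero s (Metric.mem_ball_self hε)).2 hsA)
  filter_upwards [(hf i s (Metric.mem_ball_self hε)).continuousAt.eventually_ne hi,
    Metric.ball_mem_nhds s hε] with t ht htball hmem
  exact ht ((hzero t htball).1 hmem i)

theorem IsAnalyticIn.forall_mem_of_eventually_mem (hA : IsAnalyticIn D A) (hΩ : IsOpen Ω)
    (hΩ' : IsPreconnected Ω)
    (hF : Differentiable ℂ fun s => (Module.finBasis ℂ V).equivFun (F s))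
    (hD : ∀ s ∈ Ω, F s ∈ D) {s₀ : ℂ} (hs₀ : s₀ ∈ Ω) (hev : ∀ᶠ t in 𝓝 s₀, F t ∈ A) :
    ∀ s ∈ Ω, F s ∈ A := by
  have hsub : Ω ⊆ interior {s | F s ∈ A} := by
    refine hΩ'.subset_of_closure_inter_subset isOpen_interior
      ⟨s₀, hs₀, mem_interior_iff_mem_nhds.2 hev⟩ ?_
    rintro s ⟨hs, hsΩ⟩
    obtain ⟨ε, hε, -, r, f, hf, hzero⟩ := hA.exists_ball hΩ hF hD hsΩ
    obtain ⟨t, ht, hst⟩ := Metric.mem_closure_iff.1 hs ε hε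
    have htball : t ∈ Metric.ball s ε := Metric.mem_ball'.2 hst
    refine mem_interior_iff_mem_nhds.2 (Filter.mem_of_superset (Metric.ball_mem_nhds s hε) ?_)
    refine fun u hu => (hzero u hu).2 fun i => (hf i).eqOn_zero_of_preconnected_of_eventuallyEq_zero
      (convex_ball s ε).isPreconnected htball ?_ hu
    filter_upwards [mem_interior_iff_mem_nhds.1 ht, Metric.isOpen_ball.mem_nhds htball]
      with z hz hzball
    exact (hzero z hzball).1 hz i
  exact fun s hs => interior_subset (s := {s | F s ∈ A}) (hsub hs)

theorem IsAnalyticIn.forall_mem_or_forall_mem (hA : IsAnalyticIn D A) (hA' : IsAnalyticIn D A')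
    (hΩ : IsOpen Ω) (hΩ' : IsPreconnected Ω)
    (hF : Differentiable ℂ fun s => (Module.finBasis ℂ V).equivFun (F s))
    (hD : ∀ s ∈ Ω, F s ∈ D) (hAA' : ∀ s ∈ Ω, F s ∈ A ∪ A') :
    (∀ s ∈ Ω, F s ∈ A) ∨ ∀ s ∈ Ω, F s ∈ A' := by
  refine or_iff_not_imp_left.2 fun hno => ?_
  push Not at hno
  obtain ⟨s₀, hs₀, hs₀A⟩ := hno
  refine hA'.forall_mem_of_eventually_mem hΩ hΩ' hF hD hs₀ ?_
  filter_upwards [hA.eventually_notMem hΩ hF hD hs₀ hs₀A, hΩ.mem_nhds hs₀] with t ht htΩ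
  exact (hAA' t htΩ).resolve_left ht

end Analytic

/-! ### The tube domain -/

section TubeLattice

variable {ι R : Type*} [Fintype ι] [DecidableEq ι] [CommRing R] {G : Matrix ι ι ℤ}

/-- The Gram matrix of the lattice `U ⊕ U ⊕ M(-1)`, where `M` has Gram matrix `G`. -/
def tubeGram (G : Matrix ι ι ℤ) : Matrix (Fin 4 ⊕ ι) (Fin 4 ⊕ ι) ℤ :=
  Matrix.fromBlocks !![0, 1, 0, 0; 1, 0, 0, 0; 0, 0, 0, 1; 0, 0, 1, 0] 0 0 (-G)

omit [Fintype ι] [DecidableEq ι] in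
theorem tubeGram_isSymm (hG : G.IsSymm) : (tubeGram G).IsSymm :=
  Matrix.IsSymm.fromBlocks (by ext i j; fin_cases i <;> fin_cases j <;> rfl) (by simp) hG.neg

theorem gramForm_tubeGram (v w : Fin 4 ⊕ ι → R) : gramForm R (tubeGram G) v w =
    v (.inl 0) * w (.inl 1) + v (.inl 1) * w (.inl 0) + v (.inl 2) * w (.inl 3) +
      v (.inl 3) * w (.inl 2) - gramForm R G (v ∘ Sum.inr) (w ∘ Sum.inr) := by
  rw [tubeGram, gramForm_fromBlocks, gramForm_neg, ← sub_eq_add_neg]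
  simp [gramForm_apply, Fin.sum_univ_four, add_assoc]

omit [Fintype ι] [DecidableEq ι] [CommRing R] in
theorem sumElim_comp_inl_comp_inr (v : Fin 4 ⊕ ι → R) :
    Sum.elim ![v (.inl 0), v (.inl 1), v (.inl 2), v (.inl 3)] (v ∘ Sum.inr) = v := by
  funext i
  rcases i with i | i
  · fin_cases i <;> rfl
  · rfl

/-- The decomposition of the lattice with Gram matrix `tubeGram G` into two hyperbolic planes and
a negative lattice. -/
def tubeIsometry (G : Matrix ι ι ℤ) :
    (hyperbolicSum (hyperbolicSum (gramForm ℤ (-G)))).IsometryEquiv (gramForm ℤ (tubeGram G)) where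
  toFun v := Sum.elim ![v.1, v.2.1, v.2.2.1, v.2.2.2.1] v.2.2.2.2
  invFun v := (v (.inl 0), v (.inl 1), v (.inl 2), v (.inl 3), v ∘ Sum.inr)
  map_add' v w := by
    funext i
    rcases i with i | i
    · fin_cases i <;> rfl
    · rfl
  map_smul' c v := by
    funext i
    rcases i with i | i
    · fin_cases i <;> rfl
    · rfl
  left_inv _ := rfl
  right_inv := sumElim_comp_inl_comp_inr
  map_app' v w := by
    obtain ⟨p, q, r, s, x⟩ := v
    obtain ⟨p', q', r', s', x'⟩ := w
    simp only [hyperbolicSum_apply, gramForm_tubeGram, gramForm_neg, Sum.elim_inl,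
      Sum.elim_comp_inr, Matrix.cons_val]
    ring

/-- The signs `1` on the second hyperbolic plane and `-1` on its orthogonal complement. -/
def tubeSign (ι : Type*) : Fin 4 ⊕ ι → ℤˣ := Sum.elim ![-1, -1, 1, 1] fun _ => -1

variable (G) in
/-- The isometry multiplying the coordinates by the signs `tubeSign`. -/
def tubeNeg : (gramForm ℤ (tubeGram G)).IsometryEquiv (gramForm ℤ (tubeGram G)) where
  toLinearEquiv := LinearEquiv.piCongrRight fun i => LinearEquiv.smulOfUnit (tubeSign ι i)
  map_app' v w := by
    have hinr (v : Fin 4 ⊕ ι → ℤ) : (fun i => tubeSign ι i • v i) ∘ Sum.inr = -(v ∘ Sum.inr) := by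
      funext i
      simp [tubeSign]
    change gramForm ℤ (tubeGram G) (fun i => tubeSign ι i • v i) (fun i => tubeSign ι i • w i) = _
    rw [gramForm_tubeGram, gramForm_tubeGram, hinr, hinr]
    simp [tubeSign]

theorem tubeNeg_apply (v : Fin 4 ⊕ ι → ℤ) (i : Fin 4 ⊕ ι) :
    tubeNeg G v i = tubeSign ι i * v i := rfl

end TubeLattice

section TubeDomain

variable {ι : Type*} [Fintype ι] [DecidableEq ι] {G : Matrix ι ι ℤ}
  (hG : G.IsSymm) (hpos : ∀ x : ι → ℝ, x ≠ 0 → 0 < gramForm ℝ G x x)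

include hpos in
theorem gramForm_self_nonneg (x : ι → ℝ) : 0 ≤ gramForm ℝ G x x := by
  rcases eq_or_ne x 0 with rfl | hx
  · simp
  · exact (hpos x hx).le

include hpos in
theorem gramForm_tubeGram_neg {y : Fin 4 ⊕ ι → ℝ} (hy : y ≠ 0) (h₀₁ : y (.inl 0) + y (.inl 1) = 0)
    (h₂₃ : y (.inl 2) + y (.inl 3) = 0) : gramForm ℝ (tubeGram G) y y < 0 := by
  by_contra! hnonneg
  rw [gramForm_tubeGram, eq_neg_of_add_eq_zero_right h₀₁, eq_neg_of_add_eq_zero_right h₂₃]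
    at hnonneg
  have hsq₀ := sq_nonneg (y (.inl 0))
  have hsq₂ := sq_nonneg (y (.inl 2))
  have hinr : y ∘ Sum.inr = 0 := by
    by_contra hne
    linarith [hpos _ hne]
  rw [hinr, map_zero] at hnonneg
  have h₀ : y (.inl 0) = 0 := pow_eq_zero_iff two_ne_zero |>.1 (by linarith)
  have h₂ : y (.inl 2) = 0 := pow_eq_zero_iff two_ne_zero |>.1 (by linarith)
  refine hy ?_
  rw [← sumElim_comp_inl_comp_inr y, hinr, eq_neg_of_add_eq_zero_right h₀₁,
    eq_neg_of_add_eq_zero_right h₂₃, h₀, h₂]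
  funext i
  rcases i with i | i
  · fin_cases i <;> simp
  · rfl

include hpos in
theorem exists_gramForm_tubeGram_linearCombination_neg {u : Fin 3 → Fin 4 ⊕ ι → ℝ}
    (hu : LinearIndependent ℝ u) : ∃ c : Fin 3 → ℝ, gramForm ℝ (tubeGram G)
      (Fintype.linearCombination ℝ u c) (Fintype.linearCombination ℝ u c) < 0 := by
  let f : (Fin 4 ⊕ ι → ℝ) →ₗ[ℝ] ℝ × ℝ :=
    LinearMap.prod (LinearMap.proj (.inl 0) + LinearMap.proj (.inl 1))
      (LinearMap.proj (.inl 2) + LinearMap.proj (.inl 3))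
  obtain ⟨c, hc, hc₀⟩ := (Submodule.ne_bot_iff _).1
    ((f ∘ₗ Fintype.linearCombination ℝ u).ker_ne_bot_of_finrank_lt (by simp))
  obtain ⟨h₀₁, h₂₃⟩ := Prod.ext_iff.1 (LinearMap.mem_ker.1 hc)
  exact ⟨c, gramForm_tubeGram_neg hpos
    ((map_ne_zero_iff _ hu.fintypeLinearCombination_injective).2 hc₀) h₀₁ h₂₃⟩

include hG hpos in
theorem gramForm_self_neg_of_orthogonal {p : Fin 4 ⊕ ι → ℂ} (hp : p ∈ gramCone (tubeGram G))
    {w : Fin 4 ⊕ ι → ℝ} (hw : w ≠ 0)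
    (horth : gramForm ℂ (tubeGram G) (Complex.ofReal ∘ w) p = 0) :
    gramForm ℝ (tubeGram G) w w < 0 := by
  have hsymm := tubeGram_isSymm hG
  obtain ⟨hnull, him⟩ := (mem_gramCone_iff hsymm).1 hp
  obtain ⟨hre, hreim⟩ := (gramForm_complex_self_eq_zero_iff hsymm).1 hnull
  obtain ⟨hwre, hwim⟩ := (gramForm_ofReal_left_eq_zero_iff p _).1 horth
  set r := Complex.re ∘ p
  set m := Complex.im ∘ p
  set b := gramForm ℝ (tubeGram G)
  have hself (c : Fin 3 → ℝ) : b (Fintype.linearCombination ℝ ![r, m, w] c)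
      (Fintype.linearCombination ℝ ![r, m, w] c) =
        (c 0 ^ 2 + c 1 ^ 2) * b m m + c 2 ^ 2 * b w w := by
    simp only [b, Fintype.linearCombination_apply, Fin.sum_univ_three, Matrix.cons_val, map_add,
      map_smul, LinearMap.add_apply, LinearMap.smul_apply, smul_eq_mul, hre, hreim, hwre, hwim,
      gramForm_symm hsymm _ w, gramForm_symm hsymm m r]
    ring
  have hindep : LinearIndependent ℝ ![r, m, w] := by
    refine Fintype.linearIndependent_iff.2 fun c hc => ?_
    have hb (y : Fin 4 ⊕ ι → ℝ) : c 0 * b r y + c 1 * b m y + c 2 * b w y = 0 := by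
      simpa [Fin.sum_univ_three] using congrArg (fun x => b x y) hc
    have hc₀ : c 0 = 0 := by
      simpa [hre, hwre, gramForm_symm hsymm m r, hreim, him.ne', b] using hb r
    have hc₁ : c 1 = 0 := by
      simpa [hwim, hreim, him.ne', b] using hb m
    have hc₂ : c 2 = 0 := by
      simpa [Fin.sum_univ_three, hc₀, hc₁, hw] using hc
    exact Fin.forall_fin_succ.2 ⟨hc₀, Fin.forall_fin_two.2 ⟨hc₁, hc₂⟩⟩
  obtain ⟨c, hc⟩ := exists_gramForm_tubeGram_linearCombination_neg hpos hindep
  by_contra! hnonneg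
  rw [hself] at hc
  exact hc.not_ge (by positivity)

include hG hpos in
theorem apply_inl_three_ne_zero {v : Fin 4 ⊕ ι → ℂ} (hv : v ∈ gramCone (tubeGram G)) :
    v (.inl 3) ≠ 0 := by
  intro hv₃
  set e : Fin 4 ⊕ ι → ℝ := Sum.elim ![0, 0, 1, 0] 0 with he
  have horth : gramForm ℂ (tubeGram G) (Complex.ofReal ∘ e) v = 0 := by
    rw [gramForm_tubeGram, he, Sum.comp_elim, Sum.elim_comp_inr]
    simp [hv₃]
  have he₀ : e ≠ 0 := fun h => one_ne_zero (congrFun h (.inl 2))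
  refine (gramForm_self_neg_of_orthogonal hG hpos hv he₀ horth).ne ?_
  rw [gramForm_tubeGram, he, Sum.elim_comp_inr]
  simp

variable (G) in
/-- A component of the light cone of `U ⊕ M(-1)`, seen in `U ⊕ U ⊕ M(-1)`: there is no condition
on the coordinates in the second hyperbolic plane. -/
def lightCone : Set (Fin 4 ⊕ ι → ℝ) :=
  {y | 0 < y (.inl 0) ∧ gramForm ℝ G (y ∘ Sum.inr) (y ∘ Sum.inr) < 2 * y (.inl 0) * y (.inl 1)}

theorem isOpen_lightCone : IsOpen (lightCone G) := by
  have hform : Continuous fun y : Fin 4 ⊕ ι → ℝ => gramForm ℝ G (y ∘ Sum.inr) (y ∘ Sum.inr) := by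
    simp only [gramForm_apply, Function.comp_apply]
    fun_prop
  have hcoord (i : Fin 4 ⊕ ι) : Continuous fun y : Fin 4 ⊕ ι → ℝ => y i := continuous_apply i
  exact (isOpen_lt continuous_const (hcoord _)).inter
    (isOpen_lt hform ((continuous_const.mul (hcoord _)).mul (hcoord _)))

include hG hpos in
/-- The form `G` is nonnegative on `y'₀ • (y ∘ Sum.inr) - y₀ • (y' ∘ Sum.inr)`. -/
theorem gramForm_lt_of_mem_lightCone {y y' : Fin 4 ⊕ ι → ℝ} (hy : y ∈ lightCone G)
    (hy' : y' ∈ lightCone G) : gramForm ℝ G (y ∘ Sum.inr) (y' ∘ Sum.inr) <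
      y (.inl 0) * y' (.inl 1) + y (.inl 1) * y' (.inl 0) := by
  obtain ⟨h₀, hlt⟩ := hy
  obtain ⟨h₀', hlt'⟩ := hy'
  have hnonneg := gramForm_self_nonneg hpos
    (y' (.inl 0) • (y ∘ Sum.inr) + -y (.inl 0) • (y' ∘ Sum.inr))
  rw [gramForm_smul_add_smul hG] at hnonneg
  have hprod := mul_pos h₀ h₀'
  nlinarith [mul_lt_mul_of_pos_left hlt (sq_pos_of_pos h₀'),
    mul_lt_mul_of_pos_left hlt' (sq_pos_of_pos h₀)]

include hG hpos in
theorem convex_lightCone : Convex ℝ (lightCone G) := by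
  refine convex_iff_forall_pos.2 fun y hy y' hy' s t hs ht _ => ⟨?_, ?_⟩
  · exact add_pos (mul_pos hs hy.1) (mul_pos ht hy'.1)
  · have hlt := gramForm_lt_of_mem_lightCone hG hpos hy hy'
    have hcomp : (s • y + t • y') ∘ Sum.inr = s • (y ∘ Sum.inr) + t • (y' ∘ Sum.inr) := rfl
    rw [hcomp, gramForm_smul_add_smul hG]
    simp only [Pi.add_apply, Pi.smul_apply, smul_eq_mul]
    nlinarith [mul_lt_mul_of_pos_left hy.2 (sq_pos_of_pos hs),
      mul_lt_mul_of_pos_left hy'.2 (sq_pos_of_pos ht), mul_lt_mul_of_pos_left hlt (mul_pos hs ht)]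

variable (G) in
/-- The part of the cone where the last hyperbolic coordinate is `1` and the imaginary part is in a
fixed component of the light cone. -/
def tubeDomain : Set (Fin 4 ⊕ ι → ℂ) :=
  {v | v ∈ gramCone (tubeGram G) ∧ v (.inl 3) = 1 ∧ Complex.im ∘ v ∈ lightCone G}

variable (G) in
/-- The point of the tube domain obtained from `u` by solving for the third coordinate. -/
def tubePoint (u : Fin 4 ⊕ ι → ℂ) : Fin 4 ⊕ ι → ℂ :=
  Function.update u (.inl 2)
    (gramForm ℂ G (u ∘ Sum.inr) (u ∘ Sum.inr) / 2 - u (.inl 0) * u (.inl 1))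

theorem tubePoint_comp_inr (u : Fin 4 ⊕ ι → ℂ) : tubePoint G u ∘ Sum.inr = u ∘ Sum.inr := by
  funext i
  simp [tubePoint]

theorem gramForm_tubePoint {β : Fin 4 ⊕ ι → ℂ} (hβ : β (.inl 3) = 0) (u : Fin 4 ⊕ ι → ℂ) :
    gramForm ℂ (tubeGram G) β (tubePoint G u) = gramForm ℂ (tubeGram G) β u := by
  rw [gramForm_tubeGram, gramForm_tubeGram, tubePoint_comp_inr]
  simp [tubePoint, hβ]

theorem gramForm_im_of_apply_inl_three {v : Fin 4 ⊕ ι → ℂ} (hv : v (.inl 3) = 1) :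
    gramForm ℝ (tubeGram G) (Complex.im ∘ v) (Complex.im ∘ v) =
      2 * (v (.inl 0)).im * (v (.inl 1)).im -
        gramForm ℝ G (Complex.im ∘ v ∘ Sum.inr) (Complex.im ∘ v ∘ Sum.inr) := by
  simp only [gramForm_tubeGram, Function.comp_apply, hv, Complex.one_im, Function.comp_assoc]
  ring

include hG in
theorem tubePoint_mem_tubeDomain {u : Fin 4 ⊕ ι → ℂ} (hu : u (.inl 3) = 1)
    (him : Complex.im ∘ u ∈ lightCone G) : tubePoint G u ∈ tubeDomain G := by
  have h₃ : tubePoint G u (.inl 3) = 1 := by simpa [tubePoint] using hu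
  have h₀ : tubePoint G u (.inl 0) = u (.inl 0) := by simp [tubePoint]
  have h₁ : tubePoint G u (.inl 1) = u (.inl 1) := by simp [tubePoint]
  refine ⟨(mem_gramCone_iff (tubeGram_isSymm hG)).2 ⟨?_, ?_⟩, h₃, ?_⟩
  · rw [gramForm_tubeGram, tubePoint_comp_inr, h₀, h₁, h₃]
    simp only [tubePoint, Function.update_self]
    ring
  · rw [gramForm_im_of_apply_inl_three h₃, tubePoint_comp_inr, h₀, h₁]
    exact sub_pos.2 him.2
  · rw [lightCone, Set.mem_ofPred_eq, Function.comp_assoc, tubePoint_comp_inr]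
    simp only [Function.comp_apply, h₀, h₁]
    exact him

theorem tubePoint_eq_self {v : Fin 4 ⊕ ι → ℂ} (hv : v ∈ tubeDomain G) : tubePoint G v = v := by
  have hnull := hv.1.1
  rw [gramForm_tubeGram, hv.2.1] at hnull
  rw [tubePoint, Function.update_eq_self_iff]
  linear_combination (-1 / 2) * hnull

theorem differentiable_tubePoint : Differentiable ℂ (tubePoint G) := by
  refine differentiable_pi.2 fun i => ?_
  simp only [tubePoint, Function.update_apply, gramForm_apply, Function.comp_apply]
  split_ifs <;> fun_prop

include hpos in
theorem apply_inl_zero_im_ne_zero (hG : G.IsSymm) {v : Fin 4 ⊕ ι → ℂ}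
    (hv : v ∈ gramCone (tubeGram G)) (h₃ : v (.inl 3) = 1) : (v (.inl 0)).im ≠ 0 := by
  intro h₀
  have hlt := ((mem_gramCone_iff (tubeGram_isSymm hG)).1 hv).2
  rw [gramForm_im_of_apply_inl_three h₃, h₀] at hlt
  linarith [gramForm_self_nonneg hpos (Complex.im ∘ v ∘ Sum.inr)]

include hG in
theorem mem_tubeDomain {v : Fin 4 ⊕ ι → ℂ} (hv : v ∈ gramCone (tubeGram G))
    (h₃ : v (.inl 3) = 1) (h₀ : 0 < (v (.inl 0)).im) : v ∈ tubeDomain G := by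
  have hlt := ((mem_gramCone_iff (tubeGram_isSymm hG)).1 hv).2
  rw [gramForm_im_of_apply_inl_three h₃] at hlt
  exact ⟨hv, h₃, h₀, sub_pos.1 hlt⟩

include hG hpos in
theorem isPreconnected_lineMap_preimage_lightCone (v w : Fin 4 ⊕ ι → ℂ) :
    IsPreconnected {s : ℂ | Complex.im ∘ AffineMap.lineMap v w s ∈ lightCone G} := by
  refine Convex.isPreconnected (convex_iff_forall_pos.2 fun s hs t ht a b ha hb hab => ?_)
  have hcomb : Complex.im ∘ AffineMap.lineMap v w (a • s + b • t) =
      a • Complex.im ∘ AffineMap.lineMap v w s + b • Complex.im ∘ AffineMap.lineMap v w t := by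
    funext i
    simp only [AffineMap.lineMap_apply_module', Function.comp_apply, Pi.add_apply, Pi.smul_apply,
      Pi.sub_apply, Complex.add_im, Complex.smul_im, Complex.mul_im, Complex.sub_im,
      Complex.add_re, Complex.smul_re, Complex.sub_re, smul_eq_mul]
    linear_combination -(v i).im * hab
  rw [Set.mem_ofPred_eq, hcomb]
  exact convex_lightCone hG hpos hs ht ha.le hb.le hab

include hG hpos in
theorem exists_curve_orthogonal {β v w : Fin 4 ⊕ ι → ℂ} (hβ : β (.inl 3) = 0)
    (hv : v ∈ tubeDomain G) (hw : w ∈ tubeDomain G) (hβv : gramForm ℂ (tubeGram G) β v = 0)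
    (hβw : gramForm ℂ (tubeGram G) β w = 0) :
    ∃ (Ω : Set ℂ) (F : ℂ → Fin 4 ⊕ ι → ℂ), IsOpen Ω ∧ IsPreconnected Ω ∧ Differentiable ℂ F ∧
      (∀ s ∈ Ω, F s ∈ gramCone (tubeGram G) ∧ gramForm ℂ (tubeGram G) β (F s) = 0) ∧
      (0 ∈ Ω ∧ F 0 = v) ∧ 1 ∈ Ω ∧ F 1 = w := by
  have hline : Differentiable ℂ fun s : ℂ => (AffineMap.lineMap v w s : Fin 4 ⊕ ι → ℂ) := by
    simp only [AffineMap.lineMap_apply_module']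
    fun_prop
  have him : Continuous fun s : ℂ => Complex.im ∘ AffineMap.lineMap v w s :=
    continuous_pi fun i => Complex.continuous_im.comp ((continuous_apply i).comp hline.continuous)
  have hcurve : Differentiable ℂ fun s : ℂ => tubePoint G (AffineMap.lineMap v w s) :=
    Differentiable.comp (g := tubePoint G) differentiable_tubePoint hline
  refine ⟨{s | Complex.im ∘ AffineMap.lineMap v w s ∈ lightCone G},
    fun s => tubePoint G (AffineMap.lineMap v w s), isOpen_lightCone.preimage him,
    isPreconnected_lineMap_preimage_lightCone hG hpos v w, hcurve,
    fun s hs => ⟨(tubePoint_mem_tubeDomain hG ?_ hs).1, ?_⟩, ⟨?_, ?_⟩, ?_, ?_⟩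
  · simp [AffineMap.lineMap_apply_module', hv.2.1, hw.2.1]
  · rw [gramForm_tubePoint hβ]
    simp [AffineMap.lineMap_apply_module', hβv, hβw]
  · simpa using hv.2.2
  · simpa using tubePoint_eq_self hv
  · simpa using hw.2.2
  · simpa using tubePoint_eq_self hw

theorem exists_mem_lightCone_orthogonal {β : Fin 4 ⊕ ι → ℤ} (h₀ : β (.inl 0) ≠ 0)
    (h₂ : β (.inl 2) = 0) (h₃ : β (.inl 3) = 0) (hneg : gramForm ℤ (tubeGram G) β β < 0) :
    ∃ y ∈ lightCone G, y (.inl 3) = 0 ∧ gramForm ℝ (tubeGram G) (Int.cast ∘ β) y = 0 := by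
  set t := β (.inl 0) with ht
  set s := β (.inl 1) with hs
  set x := β ∘ Sum.inr with hx
  set N := gramForm ℤ G x x with hN
  have ht₀ : (t : ℝ) ≠ 0 := Int.cast_ne_zero.2 h₀
  have ht₂ : (0 : ℝ) < t ^ 2 := by positivity
  have hlt : 2 * (t * s : ℝ) < N := by
    rw [gramForm_tubeGram, h₂, h₃, ← ht, ← hs, ← hx, ← hN] at hneg
    exact_mod_cast (by linarith : 2 * (t * s) < N)
  refine ⟨Sum.elim ![1, (N / t - s) / t, 0, 0] ((t : ℝ)⁻¹ • (Int.cast ∘ x)), ⟨one_pos, ?_⟩, rfl, ?_⟩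
  · rw [Sum.elim_comp_inr, map_smul, LinearMap.map_smul₂, gramForm_intCast, ← hN]
    simp only [Sum.elim_inl, Matrix.cons_val, smul_eq_mul]
    rw [← sub_pos]
    have hexpand : 2 * 1 * ((N / t - s) / t) - (t : ℝ)⁻¹ * ((t : ℝ)⁻¹ * N) =
        (N - 2 * (t * s)) / (t : ℝ) ^ 2 := by
      field_simp
      ring
    rw [hexpand]
    exact div_pos (sub_pos.2 hlt) ht₂
  · rw [gramForm_tubeGram, Sum.elim_comp_inr, Function.comp_assoc, ← hx, map_smul,
      gramForm_intCast, ← hN]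
    simp only [Sum.elim_inl, Matrix.cons_val, Function.comp_apply, smul_eq_mul, h₂, h₃, ← ht, ← hs,
      Int.cast_zero]
    field_simp
    ring

include hG in
theorem exists_mem_tubeDomain_orthogonal {β : Fin 4 ⊕ ι → ℤ} (h₀ : β (.inl 0) ≠ 0)
    (h₂ : β (.inl 2) = 0) (h₃ : β (.inl 3) = 0) (hneg : gramForm ℤ (tubeGram G) β β < 0) :
    ∃ v ∈ tubeDomain G, gramForm ℂ (tubeGram G) (Int.cast ∘ β) v = 0 := by
  obtain ⟨y, hy, hy₃, horth⟩ := exists_mem_lightCone_orthogonal h₀ h₂ h₃ hneg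
  let e : Fin 4 ⊕ ι → ℝ := Sum.elim ![0, 0, 0, 1] 0
  let u : Fin 4 ⊕ ι → ℂ := fun i => ⟨e i, y i⟩
  have hu : u (.inl 3) = 1 := Complex.ext rfl hy₃
  have hβe : gramForm ℝ (tubeGram G) (Int.cast ∘ β) e = 0 := by
    rw [gramForm_tubeGram, Sum.elim_comp_inr, map_zero]
    simp [e, h₂]
  have hcast : (Int.cast ∘ β : Fin 4 ⊕ ι → ℂ) = Complex.ofReal ∘ Int.cast ∘ β :=
    funext fun i => (Complex.ofReal_intCast (β i)).symm
  refine ⟨tubePoint G u, tubePoint_mem_tubeDomain hG hu hy, ?_⟩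
  rw [gramForm_tubePoint (by simp [h₃]), hcast]
  exact (gramForm_ofReal_left_eq_zero_iff u _).2 ⟨hβe, horth⟩

end TubeDomain

section TubeReflection

variable {ι L : Type*} [Fintype ι] [DecidableEq ι] [AddCommGroup L] {b : LinearMap.BilinForm ℤ L}
  {G : Matrix ι ι ℤ} (ψ : (gramForm ℤ (tubeGram G)).IsometryEquiv b)

/-- The isometry `tubeNeg G`, transported along an isometry `ψ`. -/
def tubeReflection : b.IsometryEquiv b := (ψ.symm.trans (tubeNeg G)).trans ψ

theorem complexCoords_tubeReflection (v : ℂ ⊗[ℤ] L) (i : Fin 4 ⊕ ι) :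
    complexCoords ψ ((tubeReflection ψ : L ≃ₗ[ℤ] L).baseChange ℤ ℂ L L v) i =
      (tubeSign ι i : ℤ) * complexCoords ψ v i := by
  induction v with
  | zero => simp
  | add x y hx hy => simp only [map_add, Pi.add_apply, hx, hy, mul_add]
  | tmul z x =>
    rw [LinearEquiv.baseChange_tmul, complexCoords_tmul, complexCoords_tmul]
    change z * (ψ.symm (ψ (tubeNeg G (ψ.symm x))) i : ℂ) = _ * (z * (ψ.symm x i : ℂ))
    rw [isometryEquiv_symm_apply_apply, tubeNeg_apply]
    push_cast
    ring

theorem gramForm_complexCoords_tubeReflection {β : Fin 4 ⊕ ι → ℂ} (h₂ : β (.inl 2) = 0)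
    (h₃ : β (.inl 3) = 0) (v : ℂ ⊗[ℤ] L) :
    gramForm ℂ (tubeGram G) β
      (complexCoords ψ ((tubeReflection ψ : L ≃ₗ[ℤ] L).baseChange ℤ ℂ L L v)) =
        -gramForm ℂ (tubeGram G) β (complexCoords ψ v) := by
  have hinr : complexCoords ψ ((tubeReflection ψ : L ≃ₗ[ℤ] L).baseChange ℤ ℂ L L v) ∘ Sum.inr =
      -(complexCoords ψ v ∘ Sum.inr) := by
    funext i
    simp [complexCoords_tubeReflection, tubeSign]
  rw [gramForm_tubeGram, gramForm_tubeGram, hinr]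
  simp only [complexCoords_tubeReflection, h₂, h₃, tubeSign, Sum.elim_inl, Matrix.cons_val,
    map_neg, Units.val_neg, Units.val_one]
  push_cast
  ring

end TubeReflection

/-! ### Orthogonal loci in period domains and period spaces -/

section OrthogonalLocus

variable {L L' : Type*} [AddCommGroup L] [AddCommGroup L'] {b : LinearMap.BilinForm ℤ L}
  {b' : LinearMap.BilinForm ℤ L'}

theorem PeriodDomain.mk_smul {z : ℂ} (hz : z ≠ 0) {v : ℂ ⊗[ℤ] L} (hv : v ∈ periodCone b) :
    PeriodDomain.mk b (z • v) (smul_mem_periodCone hz hv) = PeriodDomain.mk b v hv :=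
  Subtype.ext ((Projectivization.mk_eq_mk_iff' _ _ _ _ _).2 ⟨z, rfl⟩)

theorem PeriodDomain.map_map_symm (φ : b.IsometryEquiv b') (x : PeriodDomain b') :
    PeriodDomain.map φ (PeriodDomain.map φ.symm x) = x := by
  have hrefl : φ.symm.trans φ = LinearMap.BilinForm.IsometryEquiv.refl b' :=
    DFunLike.ext _ _ (isometryEquiv_apply_symm_apply φ)
  rw [← PeriodDomain.map_trans, hrefl, PeriodDomain.map_refl]

variable (b) in
/-- The points of the period domain that are orthogonal to some vector of `S`. -/
def orthogonalLocus (S : Set L) : Set (PeriodDomain b) :=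
  {x | ∃ β ∈ S, x.1.submodule ≤ LinearMap.ker (b.baseChange ℂ (1 ⊗ₜ β))}

theorem mk_mem_orthogonalLocus_iff {S : Set L} {v : ℂ ⊗[ℤ] L} (hv : v ∈ periodCone b) :
    PeriodDomain.mk b v hv ∈ orthogonalLocus b S ↔
      ∃ β ∈ S, b.baseChange ℂ (1 ⊗ₜ β) v = 0 := by
  refine exists_congr fun β => and_congr_right fun _ => ?_
  rw [PeriodDomain.mk, Projectivization.submodule_mk, Submodule.span_singleton_le_iff_mem,
    LinearMap.mem_ker]

theorem map_mem_orthogonalLocus (φ : b.IsometryEquiv b') {S : Set L} {x : PeriodDomain b}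
    (hx : x ∈ orthogonalLocus b S) : PeriodDomain.map φ x ∈ orthogonalLocus b' (φ '' S) := by
  obtain ⟨v, hv, rfl⟩ := x.exists_mk
  obtain ⟨β, hβ, hβv⟩ := (mk_mem_orthogonalLocus_iff hv).1 hx
  rw [PeriodDomain.map_mk, mk_mem_orthogonalLocus_iff]
  refine ⟨φ β, Set.mem_image_of_mem φ hβ, ?_⟩
  rw [← hβv, ← baseChange_isometryEquiv φ, LinearEquiv.baseChange_tmul]
  rfl

theorem map_image_orthogonalLocus (φ : b.IsometryEquiv b') (S : Set L) :
    PeriodDomain.map φ '' orthogonalLocus b S = orthogonalLocus b' (φ '' S) := by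
  refine Set.Subset.antisymm ?_ fun y hy => ?_
  · rintro _ ⟨x, hx, rfl⟩
    exact map_mem_orthogonalLocus φ hx
  · refine ⟨_, ?_, PeriodDomain.map_map_symm φ y⟩
    have hinv : φ.symm '' (φ '' S) = S := by
      simp [Set.image_image, isometryEquiv_symm_apply_apply]
    exact hinv ▸ map_mem_orthogonalLocus φ.symm hy

theorem isAnalyticIn_orthogonal [Module.Finite ℤ L] {ι : Type*} [Fintype ι]
    [DecidableEq ι] {G : Matrix ι ι ℤ} (hG : G.IsSymm)
    (hpos : ∀ x : ι → ℝ, x ≠ 0 → 0 < gramForm ℝ G x x)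
    (ψ : (gramForm ℤ (tubeGram G)).IsometryEquiv b) {S : Set L} {n : ℤ}
    (hS : ∀ β ∈ S, b β β = n) :
    IsAnalyticIn (periodCone b) {v | ∃ β ∈ S, b.baseChange ℂ (1 ⊗ₜ β) v = 0} := by
  refine (isAnalyticIn_iUnion_ker (complexCoords ψ)
    (fun β : Fin 4 ⊕ ι → ℤ => gramForm ℂ (tubeGram G) (Int.cast ∘ β)) (ψ ⁻¹' S)
    fun p hp => ?_).congr fun v _ => ?_
  · obtain ⟨U, hU, hfin⟩ := exists_nhds_finite_orthogonal (fun w hw horth =>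
      gramForm_self_neg_of_orthogonal hG hpos ((complexCoords_mem_gramCone ψ).2 hp) hw horth) n
    exact ⟨U, hU, hfin.subset fun β hβ => ⟨ψ.map_app β β ▸ hS _ hβ.1, hβ.2⟩⟩
  · refine ⟨fun ⟨β, hβ, hβv⟩ => ⟨ψ β, hβ, (baseChange_one_tmul_apply ψ β v).trans hβv⟩,
      fun ⟨β, hβ, hβv⟩ => ⟨ψ.symm β, ?_, ?_⟩⟩
    · rwa [Set.mem_preimage, isometryEquiv_apply_symm_apply]
    · rwa [← baseChange_one_tmul_apply, isometryEquiv_apply_symm_apply]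

theorem orthogonalLocus_orbit_nonempty {ι : Type*} [Fintype ι] [DecidableEq ι] {G : Matrix ι ι ℤ}
    (hG : G.IsSymm) (ψ : (gramForm ℤ (tubeGram G)).IsometryEquiv b) {β : Fin 4 ⊕ ι → ℤ}
    (h₀ : β (.inl 0) ≠ 0) (h₂ : β (.inl 2) = 0) (h₃ : β (.inl 3) = 0)
    (hneg : gramForm ℤ (tubeGram G) β β < 0) :
    (orthogonalLocus b {w | SameOrbit b (ψ β) w}).Nonempty := by
  obtain ⟨u, hu, horth⟩ := exists_mem_tubeDomain_orthogonal hG h₀ h₂ h₃ hneg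
  have hcoords := (complexCoords ψ).apply_symm_apply u
  have hv : (complexCoords ψ).symm u ∈ periodCone b := by
    rw [← complexCoords_mem_gramCone ψ, hcoords]
    exact hu.1
  refine ⟨_, (mk_mem_orthogonalLocus_iff hv).2 ⟨ψ β, SameOrbit.refl _, ?_⟩⟩
  rw [baseChange_one_tmul_apply, hcoords, horth]

end OrthogonalLocus

section PeriodSpaceLocus

variable {Λ : Type*} [AddCommGroup Λ] {B : LinearMap.BilinForm ℤ Λ} {h : Λ}

theorem PeriodSpace.mk_map {φ : (perpForm B h).IsometryEquiv (perpForm B h)}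
    (hφ : InPeriodGroup B h φ) (x : PeriodDomain (perpForm B h)) :
    PeriodSpace.mk B h (PeriodDomain.map φ x) = PeriodSpace.mk B h x :=
  (Quotient.sound (s := periodSetoid B h) ⟨φ, hφ, rfl⟩).symm

theorem mk_mem_image_orthogonalLocus_iff {β : perp B h} {x : PeriodDomain (perpForm B h)} :
    PeriodSpace.mk B h x ∈
        PeriodSpace.mk B h '' orthogonalLocus _ {w | SameOrbit (perpForm B h) β w} ↔
      x ∈ orthogonalLocus _ {w | SameOrbit (perpForm B h) β w} := by
  refine ⟨?_, Set.mem_image_of_mem _⟩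
  rintro ⟨y, hy, hyx⟩
  obtain ⟨γ, -, rfl⟩ := Quotient.exact (s := periodSetoid B h) hyx
  obtain ⟨w, hw, horth⟩ := map_mem_orthogonalLocus γ hy
  obtain ⟨w, hβw, rfl⟩ := hw
  exact ⟨γ w, hβw.trans ⟨γ, rfl⟩, horth⟩

theorem exists_mk_eq_orthogonal (hγ : ∀ γ, InPeriodGroup B h γ) {β : perp B h} {p : PeriodSpace B h}
    (hp : p ∈ PeriodSpace.mk B h '' orthogonalLocus _ {w | SameOrbit (perpForm B h) β w}) :
    ∃ v, ∃ hv : v ∈ periodCone (perpForm B h), PeriodSpace.mk B h (PeriodDomain.mk _ v hv) = p ∧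
      (perpForm B h).baseChange ℂ (1 ⊗ₜ β) v = 0 := by
  obtain ⟨x, ⟨w, ⟨g, rfl⟩, horth⟩, rfl⟩ := hp
  obtain ⟨v, hv, hx⟩ := (PeriodDomain.map g.symm x).exists_mk
  refine ⟨v, hv, by rw [hx, PeriodSpace.mk_map (hγ g.symm)], ?_⟩
  have hmem := map_mem_orthogonalLocus (S := {g β}) g.symm ⟨g β, rfl, horth⟩
  rw [← hx, Set.image_singleton, isometryEquiv_symm_apply_apply] at hmem
  simpa using (mk_mem_orthogonalLocus_iff hv).1 hmem

variable {ι : Type*} [Fintype ι] [DecidableEq ι] {G : Matrix ι ι ℤ} (hG : G.IsSymm)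
    (hpos : ∀ x : ι → ℝ, x ≠ 0 → 0 < gramForm ℝ G x x) (hγ : ∀ γ, InPeriodGroup B h γ)
    (ψ : (gramForm ℤ (tubeGram G)).IsometryEquiv (perpForm B h)) {β : Fin 4 ⊕ ι → ℤ}

include hG hpos hγ in
theorem exists_mk_eq_mem_tubeDomain (h₂ : β (.inl 2) = 0) (h₃ : β (.inl 3) = 0)
    {v : ℂ ⊗[ℤ] perp B h} (hv : v ∈ periodCone (perpForm B h))
    (hv₃ : complexCoords ψ v (.inl 3) = 1)
    (horth : gramForm ℂ (tubeGram G) (Int.cast ∘ β) (complexCoords ψ v) = 0) :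
    ∃ w, ∃ hw : w ∈ periodCone (perpForm B h), PeriodSpace.mk B h (PeriodDomain.mk _ w hw) =
      PeriodSpace.mk B h (PeriodDomain.mk _ v hv) ∧ complexCoords ψ w ∈ tubeDomain G ∧
      gramForm ℂ (tubeGram G) (Int.cast ∘ β) (complexCoords ψ w) = 0 := by
  have hcone := (complexCoords_mem_gramCone ψ).2 hv
  rcases (apply_inl_zero_im_ne_zero hpos hG hcone hv₃).lt_or_gt with him | him
  · have hη := map_mem_periodCone (tubeReflection ψ) hv
    refine ⟨_, hη, ?_, mem_tubeDomain hG ((complexCoords_mem_gramCone ψ).2 hη) ?_ ?_, ?_⟩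
    · rw [← PeriodDomain.map_mk, PeriodSpace.mk_map (hγ _)]
    · rw [complexCoords_tubeReflection, hv₃]
      simp [tubeSign]
    · rw [complexCoords_tubeReflection]
      simpa [tubeSign] using him
    · rw [gramForm_complexCoords_tubeReflection ψ (by simp [h₂]) (by simp [h₃]), horth, neg_zero]
  · exact ⟨v, hv, rfl, mem_tubeDomain hG hcone hv₃ him, horth⟩

include hG hpos hγ in
theorem exists_mem_tubeDomain_of_mem_image (h₂ : β (.inl 2) = 0) (h₃ : β (.inl 3) = 0)
    {p : PeriodSpace B h}
    (hp : p ∈ PeriodSpace.mk B h '' orthogonalLocus _ {w | SameOrbit (perpForm B h) (ψ β) w}) :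
    ∃ v, ∃ hv : v ∈ periodCone (perpForm B h), PeriodSpace.mk B h (PeriodDomain.mk _ v hv) = p ∧
      complexCoords ψ v ∈ tubeDomain G ∧
      gramForm ℂ (tubeGram G) (Int.cast ∘ β) (complexCoords ψ v) = 0 := by
  obtain ⟨v, hv, rfl, horth⟩ := exists_mk_eq_orthogonal hγ hp
  rw [baseChange_one_tmul_apply] at horth
  have hne := apply_inl_three_ne_zero hG hpos ((complexCoords_mem_gramCone ψ).2 hv)
  have hinv := inv_ne_zero hne
  rw [← PeriodDomain.mk_smul hinv hv]
  refine exists_mk_eq_mem_tubeDomain hG hpos hγ ψ h₂ h₃ _ ?_ ?_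
  · simp [hne]
  · simp [horth]

variable [Module.Finite ℤ Λ]

theorem IsClosedAnalytic.forall_mem_or_forall_mem {Z₁ Z₂ : Set (PeriodSpace B h)}
    (hZ₁ : IsClosedAnalytic Z₁) (hZ₂ : IsClosedAnalytic Z₂) {Ω : Set ℂ} (hΩ : IsOpen Ω)
    (hΩ' : IsPreconnected Ω) {F : ℂ → ℂ ⊗[ℤ] perp B h}
    (hF : Differentiable ℂ fun s => (Module.finBasis ℂ _).equivFun (F s))
    (hD : ∀ s ∈ Ω, F s ∈ periodCone (perpForm B h))
    (hZ : ∀ s (hs : s ∈ Ω), PeriodSpace.mk B h (PeriodDomain.mk _ _ (hD s hs)) ∈ Z₁ ∪ Z₂) :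
    (∀ s (hs : s ∈ Ω), PeriodSpace.mk B h (PeriodDomain.mk _ _ (hD s hs)) ∈ Z₁) ∨
      ∀ s (hs : s ∈ Ω), PeriodSpace.mk B h (PeriodDomain.mk _ _ (hD s hs)) ∈ Z₂ :=
  (IsAnalyticIn.forall_mem_or_forall_mem hZ₁ hZ₂ hΩ hΩ' hF hD fun s hs =>
    (hZ s hs).imp (fun hmem => ⟨hD s hs, hmem⟩) fun hmem => ⟨hD s hs, hmem⟩).imp
    (fun hall s hs => (hall s hs).2) fun hall s hs => (hall s hs).2

include hG hpos in
theorem isClosedAnalytic_image_orthogonalLocus :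
    IsClosedAnalytic
      (PeriodSpace.mk B h '' orthogonalLocus _ {w | SameOrbit (perpForm B h) (ψ β) w}) := by
  have hsq : ∀ w ∈ {w | SameOrbit (perpForm B h) (ψ β) w},
      perpForm B h w w = perpForm B h (ψ β) (ψ β) := fun w hw => hw.apply_self
  refine (isAnalyticIn_orthogonal hG hpos ψ hsq).congr fun v hv => ?_
  rw [Set.mem_ofPred_eq, Set.mem_ofPred_eq, ← mk_mem_orthogonalLocus_iff hv,
    ← mk_mem_image_orthogonalLocus_iff]
  exact ⟨fun hmem => ⟨hv, hmem⟩, fun ⟨_, hmem⟩ => hmem⟩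

include hG hpos hγ in
theorem isIrreducibleAnalytic_image_orthogonalLocus (h₀ : β (.inl 0) ≠ 0) (h₂ : β (.inl 2) = 0)
    (h₃ : β (.inl 3) = 0) (hneg : gramForm ℤ (tubeGram G) β β < 0) :
    IsIrreducibleAnalytic
      (PeriodSpace.mk B h '' orthogonalLocus _ {w | SameOrbit (perpForm B h) (ψ β) w}) := by
  refine ⟨isClosedAnalytic_image_orthogonalLocus hG hpos ψ,
    (orthogonalLocus_orbit_nonempty hG ψ h₀ h₂ h₃ hneg).image _,
    fun Z₁ Z₂ hZ₁ hZ₂ hZ => ?_⟩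
  by_contra! hno
  obtain ⟨⟨p, hp, hp₁⟩, q, hq, hq₂⟩ := hno.imp Set.not_subset.1 Set.not_subset.1
  obtain ⟨v, hv, rfl, hvt, hvβ⟩ := exists_mem_tubeDomain_of_mem_image hG hpos hγ ψ h₂ h₃ hp
  obtain ⟨w, hw, rfl, hwt, hwβ⟩ := exists_mem_tubeDomain_of_mem_image hG hpos hγ ψ h₂ h₃ hq
  obtain ⟨Ω, F, hΩ, hΩ', hF, hFΩ, ⟨h0, hF0⟩, h1, hF1⟩ :=
    exists_curve_orthogonal hG hpos (by simp [h₃]) hvt hwt hvβ hwβ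
  have hD (s : ℂ) (hs : s ∈ Ω) : (complexCoords ψ).symm (F s) ∈ periodCone (perpForm B h) := by
    rw [← complexCoords_mem_gramCone ψ, LinearEquiv.apply_symm_apply]
    exact (hFΩ s hs).1
  have hdiff : Differentiable ℂ fun s => (Module.finBasis ℂ (ℂ ⊗[ℤ] perp B h)).equivFun
      ((complexCoords ψ).symm (F s)) :=
    (LinearMap.toContinuousLinearMap ((complexCoords ψ).symm.trans
      (Module.finBasis ℂ (ℂ ⊗[ℤ] perp B h)).equivFun).toLinearMap).differentiable.comp hF
  have hcover (s : ℂ) (hs : s ∈ Ω) :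
      PeriodSpace.mk B h (PeriodDomain.mk _ _ (hD s hs)) ∈ Z₁ ∪ Z₂ := by
    refine hZ (Set.mem_image_of_mem _ ((mk_mem_orthogonalLocus_iff _).2
      ⟨ψ β, SameOrbit.refl _, ?_⟩))
    rw [baseChange_one_tmul_apply, LinearEquiv.apply_symm_apply, (hFΩ s hs).2]
  refine (hZ₁.forall_mem_or_forall_mem hZ₂ hΩ hΩ' hdiff hD hcover).elim
    (fun hall => hp₁ ?_) fun hall => hq₂ ?_
  · simpa only [hF0, LinearEquiv.symm_apply_apply] using hall 0 h0
  · simpa only [hF1, LinearEquiv.symm_apply_apply] using hall 1 h1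

end PeriodSpaceLocus

/-! ### Heegner divisors as orthogonal loci -/

section Signature

variable {V : Type*} [AddCommGroup V] [Module ℝ V] [FiniteDimensional ℝ V] (Q : QuadraticForm ℝ V)
  {v w : V}

theorem one_le_sigPos_of_pos (hv : 0 < Q v) : 1 ≤ sigPos Q := by
  have hv₀ : v ≠ 0 := by
    rintro rfl
    simp at hv
  rw [← finrank_span_singleton (K := ℝ) hv₀]
  refine le_sigPos_of_posDef Q fun ⟨x, hx⟩ hx₀ => ?_
  obtain ⟨r, rfl⟩ := Submodule.mem_span_singleton.1 hx
  have hr : r ≠ 0 := fun hr => hx₀ (Subtype.ext (by simp [hr]))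
  change 0 < Q (r • v)
  rw [QuadraticMap.map_smul]
  exact mul_pos (mul_self_pos.2 hr) hv

theorem exists_neg_of_sigNeg_eq_one (hQ : sigNeg Q = 1) : ∃ v, Q v < 0 := by
  obtain ⟨W, hW, hneg⟩ := exists_finrank_eq_sigNeg_and_negDef Q
  have : Nontrivial W := Module.nontrivial_of_finrank_pos (R := ℝ) (by omega)
  obtain ⟨w, hw⟩ := exists_ne (0 : W)
  exact ⟨w, neg_pos.1 (hneg w hw)⟩

theorem sigPos_eq_one_and_sigNeg_eq_one (hV : Module.finrank ℝ V = 2) (hv : 0 < Q v)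
    (hw : Q w < 0) :
    sigPos Q = 1 ∧ sigNeg Q = 1 := by
  have hpos := one_le_sigPos_of_pos Q hv
  have hneg : 1 ≤ sigNeg Q := one_le_sigPos_of_pos (-Q) (neg_pos.2 hw)
  have hsum := QuadraticForm.sigPos_add_sigNeg_add_radical (Q := Q)
  omega

end Signature

section RankTwo

variable {M : Type*} [AddCommGroup M] {x y : M}

theorem exists_smul_eq_smul_add_smul [Module.Free ℤ M] (hM : Module.finrank ℤ M = 2)
    (hxy : LinearIndependent ℤ ![x, y]) (z : M) :
    ∃ n : ℤ, n ≠ 0 ∧ ∃ s t : ℤ, n • z = s • x + t • y := by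
  have : Module.Finite ℤ M := Module.finite_of_finrank_pos (by omega)
  have hdep : ¬LinearIndependent ℤ ![z, x, y] := fun hli => by
    have hcard := hli.fintype_card_le_finrank
    rw [hM, Fintype.card_fin] at hcard
    omega
  obtain ⟨c, hc, i, hi⟩ := Fintype.not_linearIndependent_iff.1 hdep
  simp only [Fin.sum_univ_three, Matrix.cons_val] at hc
  refine ⟨c 0, fun h₀ => hi ?_, -c 1, -c 2, ?_⟩
  · obtain ⟨h₁, h₂⟩ := LinearIndependent.pair_iff.1 hxy (c 1) (c 2) (by simpa [h₀] using hc)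
    fin_cases i <;> assumption
  · rw [neg_smul, neg_smul, ← neg_add, eq_neg_iff_add_eq_zero, ← add_assoc, hc]

theorem exists_eq_smul_tmul_add_smul_tmul
    (hxy : ∀ z : M, ∃ n : ℤ, n ≠ 0 ∧ ∃ s t : ℤ, n • z = s • x + t • y) (w : ℝ ⊗[ℤ] M) :
    ∃ s t : ℝ, w = s • (1 ⊗ₜ x) + t • (1 ⊗ₜ y) := by
  induction w with
  | zero => exact ⟨0, 0, by simp⟩
  | add w w' hw hw' =>
    obtain ⟨s, t, rfl⟩ := hw
    obtain ⟨s', t', rfl⟩ := hw'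
    exact ⟨s + s', t + t', by module⟩
  | tmul r z =>
    obtain ⟨n, hn, s, t, hz⟩ := hxy z
    have hn' : (n : ℝ) ≠ 0 := Int.cast_ne_zero.2 hn
    refine ⟨r / n * s, r / n * t, ?_⟩
    calc r ⊗ₜ[ℤ] z = (n • (r / n : ℝ)) ⊗ₜ z := by rw [zsmul_eq_mul, mul_div_cancel₀ _ hn']
      _ = (r / n : ℝ) ⊗ₜ (s • x + t • y) := by rw [TensorProduct.smul_tmul, hz]
      _ = _ := by
        rw [TensorProduct.tmul_add, ← TensorProduct.smul_tmul, ← TensorProduct.smul_tmul,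
          TensorProduct.smul_tmul', TensorProduct.smul_tmul']
        simp [zsmul_eq_mul, mul_comm]

end RankTwo

section HeegnerVectors

variable {L L' : Type*} [AddCommGroup L] [Module.Free ℤ L] [Module.Finite ℤ L] [AddCommGroup L']
  [Module.Free ℤ L'] [Module.Finite ℤ L'] {b : LinearMap.BilinForm ℤ L}
  {b' : LinearMap.BilinForm ℤ L'}

variable (b) in
/-- The vectors of negative square whose orthogonal complement has discriminant `-d`. -/
def heegnerVectors (d : ℕ) : Set L :=
  {β | b β β < 0 ∧ disc b (LinearMap.ker (b β)) = -(d : ℤ)}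

theorem disc_congr {N : Submodule ℤ L} {N' : Submodule ℤ L'} (e : N ≃ₗ[ℤ] N')
    (he : ∀ x y, b' (e x) (e y) = b x y) : disc b N = disc b' N' := by
  rw [disc_eq b' N' ((Module.finBasis ℤ N).map e), disc]
  congr 1
  ext i j
  rw [LinearMap.BilinForm.toMatrix_apply, LinearMap.BilinForm.toMatrix_apply,
    Module.Basis.map_apply, Module.Basis.map_apply]
  exact (he _ _).symm

theorem disc_ker_isometryEquiv (φ : b.IsometryEquiv b') (β : L) :
    disc b' (LinearMap.ker (b' (φ β))) = disc b (LinearMap.ker (b β)) :=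
  (disc_congr (φ.toLinearEquiv.ofSubmodules _ _ (map_ker_apply_isometryEquiv φ β))
    fun x y => φ.map_app y x).symm

theorem disc_top_isometryEquiv (φ : b.IsometryEquiv b') : disc b ⊤ = disc b' ⊤ :=
  disc_congr ((Submodule.topEquiv.trans φ.toLinearEquiv).trans Submodule.topEquiv.symm)
    fun x y => φ.map_app y x

theorem map_image_heegnerVectors (φ : b.IsometryEquiv b') (d : ℕ) :
    φ '' heegnerVectors b d = heegnerVectors b' d := by
  have hmem (β : L) : φ β ∈ heegnerVectors b' d ↔ β ∈ heegnerVectors b d := by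
    rw [heegnerVectors, heegnerVectors, Set.mem_ofPred_eq, Set.mem_ofPred_eq, φ.map_app,
      disc_ker_isometryEquiv]
  ext γ
  refine ⟨?_, fun hγ => ⟨φ.symm γ, ?_, isometryEquiv_apply_symm_apply φ γ⟩⟩
  · rintro ⟨β, hβ, rfl⟩
    exact (hmem β).2 hβ
  · rwa [← hmem, isometryEquiv_apply_symm_apply]

end HeegnerVectors

section HeegnerDivisor

variable {Λ : Type*} [AddCommGroup Λ] {B : LinearMap.BilinForm ℤ Λ} {h : Λ}

theorem mem_orthogonal_iff {K : Submodule ℤ Λ} {β : Λ} (hh : h ∈ K) (hβ : β ∈ K)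
    (hK : ∀ z : K, ∃ n : ℤ, n ≠ 0 ∧ ∃ s t : ℤ, n • z = s • ⟨h, hh⟩ + t • ⟨β, hβ⟩) (y : Λ) :
    y ∈ B.orthogonal K ↔ B h y = 0 ∧ B β y = 0 := by
  refine ⟨fun hy => ⟨hy h hh, hy β hβ⟩, fun ⟨hhy, hβy⟩ z hz => ?_⟩
  obtain ⟨n, hn, s, t, hst⟩ := hK ⟨z, hz⟩
  have hnz : n • z = s • h + t • β := congrArg Subtype.val hst
  have hnzy : n * B z y = 0 := by
    simpa [hhy, hβy] using congrArg (fun x => B x y) hnz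
  exact (mul_eq_zero.1 hnzy).resolve_left hn

theorem submoduleOf_orthogonal {K : Submodule ℤ Λ} {β : perp B h}
    (hK : ∀ y, y ∈ B.orthogonal K ↔ B h y = 0 ∧ B β y = 0) :
    (B.orthogonal K).submoduleOf (perp B h) = LinearMap.ker (perpForm B h β) := by
  ext y
  rw [Submodule.submoduleOf, Submodule.mem_comap, LinearMap.mem_ker]
  exact (hK y).trans (and_iff_right y.2)

variable [Module.Free ℤ Λ]

theorem linearIndependent_pair_of_orthogonal {β : Λ} (hh : B h h ≠ 0) (hβ : β ≠ 0)
    (hhβ : B h β = 0) : LinearIndependent ℤ ![h, β] := by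
  refine LinearIndependent.pair_iff.2 fun s t hst => ?_
  have hs : s = 0 := by simpa [hhβ, hh] using congrArg (B h) hst
  exact ⟨hs, by simpa [hs, hβ] using hst⟩

variable [Module.Finite ℤ Λ]

theorem exists_orthogonal_of_signature (hB : ∀ x y, B x y = B y x) (hh : 0 < B h h)
    {K : Submodule ℤ Λ} (hK : h ∈ K) (hrank : Module.finrank ℤ K = 2)
    (hsig : HasSignatureOneOne B K) :
    ∃ β, B h β = 0 ∧ B β β < 0 ∧ ∀ y, y ∈ B.orthogonal K ↔ B h y = 0 ∧ B β y = 0 := by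
  have hker : LinearMap.ker ((B h).domRestrict K) ≠ ⊥ := fun hbot => by
    have hle := LinearMap.finrank_le_finrank_of_injective (LinearMap.ker_eq_bot.1 hbot)
    rw [hrank, Module.finrank_self] at hle
    omega
  obtain ⟨⟨β, hβK⟩, hβ, hβ₀⟩ := (Submodule.ne_bot_iff _).1 hker
  have hhβ : B h β = 0 := hβ
  have hli : LinearIndependent ℤ ![(⟨h, hK⟩ : K), ⟨β, hβK⟩] :=
    linearIndependent_pair_of_orthogonal (B := B.restrict K) hh.ne' hβ₀ hhβ
  have hspan := exists_smul_eq_smul_add_smul hrank hli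
  refine ⟨β, hhβ, ?_, mem_orthogonal_iff hK hβK hspan⟩
  obtain ⟨w, hw⟩ := exists_neg_of_sigNeg_eq_one _ hsig.2
  obtain ⟨s, t, rfl⟩ := exists_eq_smul_tmul_add_smul_tmul hspan w
  have hw' : s ^ 2 * (B h h : ℝ) + t ^ 2 * B β β < 0 := by
    refine lt_of_eq_of_lt ?_ hw
    simp only [LinearMap.BilinMap.toQuadraticMap_apply, map_add, map_smul, LinearMap.add_apply,
      LinearMap.smul_apply, LinearMap.BilinForm.baseChange_tmul, LinearMap.BilinForm.restrict_apply,
      LinearMap.domRestrict_apply, zsmul_eq_mul, smul_eq_mul, hhβ, hB β h, Int.cast_zero]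
    ring
  by_contra! hnonneg
  exact hw'.not_ge (add_nonneg (mul_nonneg (sq_nonneg s) (Int.cast_nonneg_iff.2 hh.le))
    (mul_nonneg (sq_nonneg t) (Int.cast_nonneg_iff.2 hnonneg)))

theorem exists_sublattice_of_orthogonal (hh : 0 < B h h) {β : Λ}
    (hhβ : B h β = 0) (hβ : B β β < 0) :
    ∃ K : Submodule ℤ Λ, h ∈ K ∧ Module.finrank ℤ K = 2 ∧ HasSignatureOneOne B K ∧
      ∀ y, y ∈ B.orthogonal K ↔ B h y = 0 ∧ B β y = 0 := by
  have hβ₀ : β ≠ 0 := fun h => by simp [h] at hβ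
  have hrank := finrank_span_eq_card (linearIndependent_pair_of_orthogonal hh.ne' hβ₀ hhβ)
  rw [Matrix.range_cons_cons_empty, Fintype.card_fin] at hrank
  have hhK : h ∈ Submodule.span ℤ {h, β} := Submodule.subset_span (by simp)
  have hβK : β ∈ Submodule.span ℤ {h, β} := Submodule.subset_span (by simp)
  refine ⟨_, hhK, hrank, ?_, mem_orthogonal_iff hhK hβK fun ⟨z, hz⟩ => ?_⟩
  · refine sigPos_eq_one_and_sigNeg_eq_one _ (by rw [Module.finrank_baseChange, hrank])
      (v := 1 ⊗ₜ ⟨h, hhK⟩) (w := 1 ⊗ₜ ⟨β, hβK⟩) ?_ ?_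
    · simpa [LinearMap.BilinForm.restrict_apply] using hh
    · simpa [LinearMap.BilinForm.restrict_apply] using hβ
  · obtain ⟨s, t, rfl⟩ := Submodule.mem_span_pair.1 hz
    exact ⟨1, one_ne_zero, s, t, one_smul _ _⟩

theorem disc_orthogonal {K : Submodule ℤ Λ} {β : perp B h}
    (hK : ∀ y, y ∈ B.orthogonal K ↔ B h y = 0 ∧ B β y = 0) :
    disc B (B.orthogonal K) = disc (perpForm B h) (LinearMap.ker (perpForm B h β)) := by
  rw [← submoduleOf_orthogonal hK]
  exact (disc_congr (Submodule.submoduleOfEquivOfLe fun y hy => ((hK y).1 hy).1)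
    fun _ _ => rfl).symm

theorem ker_baseChange_one_tmul {L : Type*} [AddCommGroup L] (b : LinearMap.BilinForm ℤ L) (β : L) :
    LinearMap.ker (b.baseChange ℂ (1 ⊗ₜ β)) = (LinearMap.ker (b β)).baseChange ℂ := by
  have hrid (v : ℂ ⊗[ℤ] L) :
      TensorProduct.rid ℤ ℂ ((b β).baseChange ℂ v) = b.baseChange ℂ (1 ⊗ₜ β) v := by
    induction v with
    | zero => simp
    | add x y hx hy => simp only [map_add, hx, hy]
    | tmul z x => simp
  have hexact := Module.Flat.lTensor_exact (R := ℤ) ℂ (f := (LinearMap.ker (b β)).subtype)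
    (LinearMap.exact_subtype_ker_map (b β))
  ext v
  rw [LinearMap.mem_ker, ← hrid, LinearEquiv.map_eq_zero_iff]
  exact hexact v

theorem heegnerDivisor_eq_image_orthogonalLocus (hB : ∀ x y, B x y = B y x) (hh : 0 < B h h)
    (d : ℕ) : heegnerDivisor B h d =
      PeriodSpace.mk B h '' orthogonalLocus _ (heegnerVectors (perpForm B h) d) := by
  ext p
  constructor
  · rintro ⟨K, hK, hrank, hsig, hd, x, hx, rfl⟩
    obtain ⟨β, hhβ, hβ, horth⟩ := exists_orthogonal_of_signature hB hh hK hrank hsig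
    lift β to perp B h using hhβ
    refine ⟨x, ⟨β, ⟨hβ, by rw [← disc_orthogonal horth, hd]⟩, ?_⟩, rfl⟩
    rwa [ker_baseChange_one_tmul, ← submoduleOf_orthogonal horth]
  · rintro ⟨x, ⟨β, ⟨hβ, hd⟩, hx⟩, rfl⟩
    obtain ⟨K, hK, hrank, hsig, horth⟩ := exists_sublattice_of_orthogonal hh β.2 hβ
    refine ⟨K, hK, hrank, hsig, by rw [disc_orthogonal horth, hd], x, ?_, rfl⟩
    rwa [ker_baseChange_one_tmul, ← submoduleOf_orthogonal horth] at hx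

end HeegnerDivisor

/-! ### Discriminants of orthogonal complements -/

theorem apply_inl_mul_det {κ R : Type*} [Fintype κ] [DecidableEq κ] [CommRing R]
    {A : Matrix (Unit ⊕ κ) (Unit ⊕ κ) R} {c : Unit ⊕ κ → R} {a : R}
    (hc : c ᵥ* A = Pi.single (.inl ()) a) :
    c (.inl ()) * A.det = a * A.toBlocks₂₂.det := by
  have hblocks : A.updateRow (.inl ()) (Pi.single (.inl ()) 1) =
      Matrix.fromBlocks 1 0 A.toBlocks₂₁ A.toBlocks₂₂ := by
    ext i j
    rcases i with i | i <;> rcases j with j | j <;> simp [Matrix.toBlocks₂₁, Matrix.toBlocks₂₂]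
  have hadj : A.adjugate (.inl ()) (.inl ()) = A.toBlocks₂₂.det := by
    rw [Matrix.adjugate_apply, hblocks, Matrix.det_fromBlocks_zero₁₂, Matrix.det_one, one_mul]
  have hmul : (c ᵥ* A ᵥ* A.adjugate) (.inl ()) = a * A.toBlocks₂₂.det := by
    rw [hc, Matrix.single_vecMul, Pi.smul_apply, Matrix.row, hadj, smul_eq_mul]
  rw [← hmul, Matrix.vecMul_vecMul, Matrix.mul_adjugate, Matrix.vecMul_smul, Matrix.vecMul_one,
    Pi.smul_apply, smul_eq_mul, mul_comm]

section Discriminant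

variable {L : Type*} [AddCommGroup L] {b : LinearMap.BilinForm ℤ L} {v : L} {t : ℕ}

theorem repr_vecMul_toMatrix {ι : Type*} [Fintype ι] [DecidableEq ι] (e : Module.Basis ι ℤ L) :
    e.repr v ᵥ* LinearMap.BilinForm.toMatrix e b = fun j => b v (e j) := by
  funext j
  conv_rhs => rw [← e.sum_repr v]
  simp only [Matrix.vecMul, dotProduct, LinearMap.BilinForm.toMatrix_apply, map_sum, map_smul,
    LinearMap.sum_apply, LinearMap.smul_apply, smul_eq_mul]

variable [Module.Free ℤ L] [Module.Finite ℤ L]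

theorem disc_top_eq_det {ι : Type*} [Fintype ι] [DecidableEq ι] (e : Module.Basis ι ℤ L) :
    disc b ⊤ = (LinearMap.BilinForm.toMatrix e b).det := by
  rw [disc_eq b ⊤ (e.map Submodule.topEquiv.symm)]
  rfl

theorem disc_gramForm_top {ι : Type*} [Fintype ι] [DecidableEq ι] (G : Matrix ι ι ℤ) :
    disc (gramForm ℤ G) ⊤ = G.det := by
  rw [disc_top_eq_det (Pi.basisFun ℤ ι), gramForm_int]
  congr 1
  ext i j
  rw [LinearMap.BilinForm.toMatrix_apply, Pi.basisFun_apply, Pi.basisFun_apply,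
    Matrix.toBilin'_single]

theorem exists_basis_of_hasDivisibility (hv : HasDivisibility b v t) (ht : t ≠ 0) :
    ∃ e : Module.Basis (Unit ⊕ Fin (Module.finrank ℤ (LinearMap.ker (b v)))) ℤ L,
      b v (e (.inl ())) = t ∧
        ∀ i, e (.inr i) = Module.finBasis ℤ (LinearMap.ker (b v)) i := by
  have ht' : (t : ℤ) ≠ 0 := Int.natCast_ne_zero.2 ht
  obtain ⟨u, hu⟩ := hv.exists_eq
  let f : ℤ × LinearMap.ker (b v) →ₗ[ℤ] L :=
    (LinearMap.toSpanSingleton ℤ L u).coprod (LinearMap.ker (b v)).subtype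
  have hf (m : ℤ) (y : LinearMap.ker (b v)) : b v (f (m, y)) = m * t := by
    have hy : b v y = 0 := y.2
    simp [f, hu, hy]
  have hbij : Function.Bijective f := by
    refine ⟨(injective_iff_map_eq_zero f).2 fun ⟨m, y⟩ hmy => ?_, fun x => ?_⟩
    · have hm := hf m y
      rw [hmy, map_zero, eq_comm, mul_eq_zero, or_iff_left ht'] at hm
      subst hm
      simpa [f] using hmy
    · obtain ⟨m, hm⟩ := hv.dvd x
      refine ⟨(m, ⟨x - m • u, ?_⟩), by simp [f]⟩
      rw [LinearMap.mem_ker, map_sub, map_smul, hm, hu, smul_eq_mul, mul_comm, sub_self]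
  refine ⟨((Module.Basis.singleton Unit ℤ).prod (Module.finBasis ℤ _)).map
    (LinearEquiv.ofBijective f hbij), ?_, fun i => ?_⟩
  · simp [f, hu]
  · simp [f]

theorem sq_mul_disc_ker (hv : HasDivisibility b v t) :
    (t : ℤ) ^ 2 * disc b (LinearMap.ker (b v)) = b v v * disc b ⊤ := by
  rcases eq_or_ne t 0 with rfl | ht
  · have h₀ : b v v = 0 := zero_dvd_iff.1 (hv.dvd v)
    rw [h₀, Nat.cast_zero, zero_pow two_ne_zero, zero_mul, zero_mul]
  obtain ⟨e, hinl, hinr⟩ := exists_basis_of_hasDivisibility hv ht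
  have hbv : (fun j => b v (e j)) = Pi.single (.inl ()) (t : ℤ) := by
    funext j
    rcases j with j | j
    · rw [hinl, Pi.single_eq_same]
    · rw [hinr, Pi.single_eq_of_ne Sum.inr_ne_inl]
      exact (Module.finBasis ℤ (LinearMap.ker (b v)) j).2
  have hsq : b v v = e.repr v (.inl ()) * t := by
    calc b v v = b v (∑ j, e.repr v j • e j) := by rw [e.sum_repr]
      _ = e.repr v ⬝ᵥ fun j => b v (e j) := by
        simp only [map_sum, map_smul, smul_eq_mul, dotProduct]
      _ = _ := by rw [hbv, dotProduct_single]
  have hblock : (LinearMap.BilinForm.toMatrix e b).toBlocks₂₂.det =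
      disc b (LinearMap.ker (b v)) := by
    rw [disc]
    congr 1
    ext i j
    simp [Matrix.toBlocks₂₂, LinearMap.BilinForm.toMatrix_apply, hinr]
  have hdet := apply_inl_mul_det ((repr_vecMul_toMatrix e).trans hbv)
  rw [hblock, ← disc_top_eq_det] at hdet
  rw [hsq, sq, mul_assoc, ← hdet]
  ring

end Discriminant

/-! ### The lattice `2U ⊕ ⟨-2⟩² ⊕ E₈(-1)²` -/

section GramMatrices

variable {ι κ R : Type*} [Fintype ι] [DecidableEq ι] [Fintype κ] [DecidableEq κ] [CommRing R]

theorem gramForm_blockDiagonal (G : κ → Matrix ι ι ℤ) (x y : ι × κ → R) :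
    gramForm R (Matrix.blockDiagonal G) x y =
      ∑ k, gramForm R (G k) (fun i => x (i, k)) fun i => y (i, k) := by
  simp only [gramForm_apply, Fintype.sum_prod_type, Matrix.blockDiagonal_apply]
  rw [Finset.sum_comm]
  refine Finset.sum_congr rfl fun k _ => Finset.sum_congr rfl fun i _ =>
    Finset.sum_congr rfl fun j _ => ?_
  simp

theorem gramForm_diagonal (d : ι → ℤ) (x y : ι → R) :
    gramForm R (Matrix.diagonal d) x y = ∑ i, d i * (x i * y i) := by
  simp only [gramForm_apply, Matrix.diagonal_apply]
  refine Finset.sum_congr rfl fun i _ => ?_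
  simp only [Int.cast_ite, Int.cast_zero, mul_ite, mul_zero, ite_mul, zero_mul, Finset.sum_ite_eq,
    Finset.mem_univ, ↓reduceIte]
  ring

theorem even_gramForm_self {G : Matrix ι ι ℤ} (hG : G.IsSymm) (hev : ∀ i, Even (G i i))
    (x : ι → ℤ) : Even (gramForm ℤ G x x) := by
  have hx : x ∈ Submodule.span ℤ (Set.range (Pi.basisFun ℤ ι)) := by
    rw [(Pi.basisFun ℤ ι).span_eq]
    trivial
  induction hx using Submodule.span_induction with
  | mem x hx =>
    obtain ⟨i, rfl⟩ := hx
    rw [gramForm_int, Pi.basisFun_apply, Matrix.toBilin'_single]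
    exact hev i
  | zero => simp
  | add x y _ _ hx hy =>
    have hadd : gramForm ℤ G (x + y) (x + y) =
        gramForm ℤ G x x + gramForm ℤ G y y + 2 * gramForm ℤ G x y := by
      simp only [map_add, LinearMap.add_apply, gramForm_symm hG y x]
      ring
    rw [hadd]
    exact (hx.add hy).add (even_two_mul _)
  | smul c x _ hx =>
    rw [map_smul, map_smul, LinearMap.smul_apply]
    exact (hx.mul_left c).mul_left c

theorem exists_eq_smul_of_dvd_gramForm {G : Matrix ι ι ℤ} (hdet : IsUnit G.det) {t : ℤ}
    {x : ι → ℤ} (hx : ∀ y, t ∣ gramForm ℤ G x y) : ∃ z, x = t • z := by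
  have hrow (i : ι) : t ∣ (x ᵥ* G) i := by
    have hi := hx (Pi.single i 1)
    rwa [gramForm_int, Matrix.toBilin'_apply', Matrix.mulVec_single_one] at hi
  choose c hc using hrow
  refine ⟨c ᵥ* G⁻¹, ?_⟩
  rw [← Matrix.smul_vecMul, ← show x ᵥ* G = t • c from funext hc, Matrix.vecMul_vecMul,
    Matrix.mul_nonsing_inv _ hdet, Matrix.vecMul_one]

theorem gramForm_self_pos_of_nonneg {G : Matrix ι ι ℤ} (hG : G.IsSymm) (hdet : G.det ≠ 0)
    (hnonneg : ∀ x : ι → ℝ, 0 ≤ gramForm ℝ G x x) {x : ι → ℝ} (hx : x ≠ 0) :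
    0 < gramForm ℝ G x x := by
  have happly (x : ι → ℝ) : star x ⬝ᵥ G.map Int.cast *ᵥ x = gramForm ℝ G x x :=
    (Matrix.toBilin'_apply' _ _ _).symm
  have hpos : (G.map (Int.cast : ℤ → ℝ)).PosSemidef :=
    .of_dotProduct_mulVec_nonneg (Matrix.isHermitian_iff_isSymm.2 (hG.map _)) fun x =>
      (happly x).symm ▸ hnonneg x
  have hdet' : (G.map (Int.cast : ℤ → ℝ)).det ≠ 0 := by
    rwa [← Int.cast_det, Int.cast_ne_zero]
  rw [← happly]
  exact (hpos.posDef_iff_det_ne_zero.2 hdet').dotProduct_mulVec_pos hx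

end GramMatrices

section E8

/-- The Gram matrix of the lattice `E₈ ⊕ E₈`. -/
def e8SqGram : Matrix (Fin 8 × Fin 2) (Fin 8 × Fin 2) ℤ :=
  Matrix.blockDiagonal fun _ => CartanMatrix.E₈

theorem e8SqGram_isSymm : e8SqGram.IsSymm := by
  refine (Matrix.blockDiagonal_transpose _).trans ?_
  simp only [CartanMatrix.E₈_transpose]
  rfl

theorem even_e8SqGram_diag (i : Fin 8 × Fin 2) : Even (e8SqGram i i) := by
  rw [e8SqGram, Matrix.blockDiagonal_apply_eq, CartanMatrix.E₈_diag]
  exact even_two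

theorem det_e8SqGram : e8SqGram.det = 1 := by
  rw [e8SqGram, Matrix.det_blockDiagonal, CartanMatrix.E₈_det, Finset.prod_const_one]

theorem gramForm_e8_eq_sum_squares (x : Fin 8 → ℝ) : gramForm ℝ CartanMatrix.E₈ x x =
    2 * (x 0 - x 2 / 2) ^ 2 + 3 / 2 * (x 2 - 2 / 3 * x 3) ^ 2 + 2 * (x 1 - x 3 / 2) ^ 2 +
      2 * (x 7 - x 6 / 2) ^ 2 + 3 / 2 * (x 6 - 2 / 3 * x 5) ^ 2 +
      4 / 3 * (x 5 - 3 / 4 * x 4) ^ 2 + 5 / 4 * (x 4 - 4 / 5 * x 3) ^ 2 +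
      1 / 30 * x 3 ^ 2 := by
  simp only [gramForm_apply, Fin.sum_univ_eight, CartanMatrix.E₈, Fin.isValue, Int.reduceNeg,
    Matrix.of_apply, Matrix.cons_val', Matrix.cons_val_zero, Matrix.cons_val_fin_one,
    Int.cast_ofNat, Matrix.cons_val_one, Int.cast_zero, mul_zero, zero_mul, add_zero,
    Matrix.cons_val, Int.cast_neg, Int.cast_one, mul_neg, mul_one, neg_mul, zero_add]
  ring

theorem gramForm_e8SqGram_nonneg (x : Fin 8 × Fin 2 → ℝ) : 0 ≤ gramForm ℝ e8SqGram x x := by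
  rw [e8SqGram, gramForm_blockDiagonal]
  refine Finset.sum_nonneg fun k _ => ?_
  rw [gramForm_e8_eq_sum_squares]
  positivity

end E8

section ModelLattice

/-- The Gram matrix of the lattice `⟨2⟩² ⊕ E₈²`, so that `tubeGram modelGram` is the Gram matrix of
`2U ⊕ ⟨-2⟩² ⊕ E₈(-1)²`. -/
def modelGram : Matrix (Fin 2 ⊕ (Fin 8 × Fin 2)) (Fin 2 ⊕ (Fin 8 × Fin 2)) ℤ :=
  Matrix.fromBlocks (Matrix.diagonal fun _ => 2) 0 0 e8SqGram

theorem modelGram_isSymm : modelGram.IsSymm :=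
  (Matrix.isSymm_diagonal _).fromBlocks (by simp) e8SqGram_isSymm

theorem det_modelGram : modelGram.det = 4 := by
  rw [modelGram, Matrix.det_fromBlocks_zero₂₁, det_e8SqGram, Matrix.det_diagonal,
    Fin.prod_univ_two]
  rfl

theorem gramForm_modelGram {R : Type*} [CommRing R] (x y : Fin 2 ⊕ (Fin 8 × Fin 2) → R) :
    gramForm R modelGram x y = 2 * (x (.inl 0) * y (.inl 0) + x (.inl 1) * y (.inl 1)) +
      gramForm R e8SqGram (x ∘ Sum.inr) (y ∘ Sum.inr) := by
  rw [modelGram, gramForm_fromBlocks, gramForm_diagonal, Fin.sum_univ_two, Int.cast_two, mul_add]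
  rfl

theorem gramForm_modelGram_pos {x : Fin 2 ⊕ (Fin 8 × Fin 2) → ℝ} (hx : x ≠ 0) :
    0 < gramForm ℝ modelGram x x := by
  refine gramForm_self_pos_of_nonneg modelGram_isSymm (det_modelGram ▸ four_ne_zero) (fun x => ?_)
    hx
  rw [gramForm_modelGram]
  linarith [mul_self_nonneg (x (.inl 0)), mul_self_nonneg (x (.inl 1)),
    gramForm_e8SqGram_nonneg (x ∘ Sum.inr)]

theorem det_tubeGram_modelGram : (tubeGram modelGram).det = 4 := by
  rw [tubeGram, Matrix.det_fromBlocks_zero₂₁, Matrix.det_neg, det_modelGram]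
  decide

end ModelLattice

section RankOneSum

variable {M : Type*} [AddCommGroup M]

/-- The orthogonal sum `⟨c⟩ ⊕ M` of a lattice of rank one whose generator has square `c` and the
lattice `M` with form `B`. -/
def rankOneSum (c : ℤ) (B : LinearMap.BilinForm ℤ M) : LinearMap.BilinForm ℤ (ℤ × M) :=
  LinearMap.mk₂ ℤ (fun v w => c * (v.1 * w.1) + B v.2 w.2)
    (fun x y z => by simp only [Prod.fst_add, Prod.snd_add, map_add, LinearMap.add_apply]; ring)
    (fun k x y => by
      simp only [Prod.smul_fst, Prod.smul_snd, smul_eq_mul, map_smul, LinearMap.smul_apply]; ring)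
    (fun x y z => by simp only [Prod.fst_add, Prod.snd_add, map_add]; ring)
    (fun k x y => by simp only [Prod.smul_fst, Prod.smul_snd, smul_eq_mul, map_smul]; ring)

theorem rankOneSum_apply (c : ℤ) (B : LinearMap.BilinForm ℤ M) (a a' : ℤ) (x x' : M) :
    rankOneSum c B (a, x) (a', x') = c * (a * a') + B x x' :=
  rfl

variable {c : ℤ} {B : LinearMap.BilinForm ℤ M}

theorem rankOneSum_symm (hB : ∀ x y, B x y = B y x) (v w : ℤ × M) :
    rankOneSum c B v w = rankOneSum c B w v := by
  obtain ⟨a, x⟩ := v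
  obtain ⟨a', x'⟩ := w
  rw [rankOneSum_apply, rankOneSum_apply, hB x, mul_comm a]

theorem even_rankOneSum (hc : Even c) (hev : ∀ x, Even (B x x)) (v : ℤ × M) :
    Even (rankOneSum c B v v) :=
  (hc.mul_right _).add (hev v.2)

theorem SameOrbit.rankOneSum_swap (a b : ℤ) (x : M) :
    SameOrbit (rankOneSum c (rankOneSum c B)) (a, b, x) (b, a, x) :=
  ⟨{  toFun := fun v => (v.2.1, v.1, v.2.2)
      invFun := fun v => (v.2.1, v.1, v.2.2)
      map_add' := fun _ _ => rfl
      map_smul' := fun _ _ => rfl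
      map_app' := by
        rintro ⟨a, b, x⟩ ⟨a', b', x'⟩
        simp only [rankOneSum_apply]
        ring }, rfl⟩

end RankOneSum

section ModelForm

/-- The form of `E₈(-1)²`. -/
abbrev negE8SqForm : LinearMap.BilinForm ℤ (Fin 8 × Fin 2 → ℤ) := gramForm ℤ (-e8SqGram)

/-- The form of `⟨-2⟩² ⊕ E₈(-1)²`. -/
abbrev negModelForm : LinearMap.BilinForm ℤ (ℤ × ℤ × (Fin 8 × Fin 2 → ℤ)) :=
  rankOneSum (-2) (rankOneSum (-2) negE8SqForm)

/-- The form of `2U ⊕ ⟨-2⟩² ⊕ E₈(-1)²`. -/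
abbrev modelForm : LinearMap.BilinForm ℤ (ℤ × ℤ × ℤ × ℤ × ℤ × ℤ × (Fin 8 × Fin 2 → ℤ)) :=
  hyperbolicSum (hyperbolicSum negModelForm)

theorem negE8SqForm_symm (x y : Fin 8 × Fin 2 → ℤ) : negE8SqForm x y = negE8SqForm y x :=
  gramForm_symm e8SqGram_isSymm.neg x y

theorem even_negE8SqForm (x : Fin 8 × Fin 2 → ℤ) : Even (negE8SqForm x x) :=
  even_gramForm_self e8SqGram_isSymm.neg (fun i => (even_e8SqGram_diag i).neg) x

theorem exists_eq_smul_of_dvd_negE8SqForm {t : ℤ} {x : Fin 8 × Fin 2 → ℤ}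
    (hx : ∀ y, t ∣ negE8SqForm x y) : ∃ z, x = t • z :=
  exists_eq_smul_of_dvd_gramForm (by simp [Matrix.det_neg, det_e8SqGram]) hx

theorem negModelForm_symm (x y : ℤ × ℤ × (Fin 8 × Fin 2 → ℤ)) :
    negModelForm x y = negModelForm y x :=
  rankOneSum_symm (rankOneSum_symm negE8SqForm_symm) x y

theorem even_negModelForm (x : ℤ × ℤ × (Fin 8 × Fin 2 → ℤ)) : Even (negModelForm x x) :=
  even_rankOneSum (by decide) (even_rankOneSum (by decide) even_negE8SqForm) x

/-- The isometry expressing `negModelForm` through the Gram matrix `-modelGram`. -/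
def negModelIsometry : negModelForm.IsometryEquiv (gramForm ℤ (-modelGram)) where
  toFun v := Sum.elim ![v.1, v.2.1] v.2.2
  invFun x := (x (.inl 0), x (.inl 1), x ∘ Sum.inr)
  map_add' v w := by
    funext i
    rcases i with i | i
    · fin_cases i <;> rfl
    · rfl
  map_smul' c v := by
    funext i
    rcases i with i | i
    · fin_cases i <;> rfl
    · rfl
  left_inv _ := rfl
  right_inv x := by
    funext i
    rcases i with i | i
    · fin_cases i <;> rfl
    · rfl
  map_app' v w := by
    obtain ⟨a, b, x⟩ := v
    obtain ⟨a', b', x'⟩ := w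
    simp only [rankOneSum_apply, gramForm_neg, gramForm_modelGram, Sum.elim_inl,
      Sum.elim_comp_inr, Matrix.cons_val_zero, Matrix.cons_val_one]
    ring

/-- The isometry expressing `modelForm` through the Gram matrix `tubeGram modelGram`. -/
def modelIsometry : modelForm.IsometryEquiv (gramForm ℤ (tubeGram modelGram)) :=
  (hyperbolicSumCongr (hyperbolicSumCongr negModelIsometry)).trans (tubeIsometry modelGram)

theorem disc_modelForm : disc modelForm ⊤ = 4 := by
  rw [disc_top_isometryEquiv modelIsometry, disc_gramForm_top, det_tubeGram_modelGram]

end ModelForm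

section Proportional

variable {L : Type*} [AddCommGroup L] {b : LinearMap.BilinForm ℤ L} {v w : L} {m n : ℤ}

theorem ker_apply_smul (hm : m ≠ 0) : LinearMap.ker (b (m • v)) = LinearMap.ker (b v) := by
  ext y
  simp [hm]

theorem ker_apply_eq_of_smul_eq_smul (hm : m ≠ 0) (hn : n ≠ 0) (h : m • v = n • w) :
    LinearMap.ker (b v) = LinearMap.ker (b w) := by
  rw [← ker_apply_smul hm, h, ker_apply_smul hn]

theorem SameOrbit.exists_smul_eq_smul (hvw : SameOrbit b (m • v) (n • w)) :
    ∃ u, SameOrbit b w u ∧ m • v = n • u := by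
  obtain ⟨g, hg⟩ := hvw.symm
  exact ⟨g w, ⟨g, rfl⟩, hg.symm.trans (map_smul g.toLinearEquiv n w)⟩

end Proportional

section NormalVector

/-- The vectors `2 (e + q f) + δ`, where `e, f` is the standard basis of the first hyperbolic plane
of `2U ⊕ ⟨-2⟩² ⊕ E₈(-1)²` and `δ` is a sum of `r ≤ 2` of the generators of `⟨-2⟩²`. -/
def normalVector (q : ℤ) (r : Fin 3) :
    ℤ × ℤ × ℤ × ℤ × ℤ × ℤ × (Fin 8 × Fin 2 → ℤ) :=
  (2, 2 * q, 0, 0, ![0, 1, 1] r, ![0, 0, 1] r, 0)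

theorem modelForm_normalVector_self (q : ℤ) (r : Fin 3) :
    modelForm (normalVector q r) (normalVector q r) = 8 * q - 2 * r := by
  simp only [normalVector, hyperbolicSum_apply, rankOneSum_apply, map_zero]
  fin_cases r <;> norm_num <;> linarith

theorem hasDivisibility_normalVector (q : ℤ) (r : Fin 3) :
    HasDivisibility modelForm (normalVector q r) 2 := by
  obtain ⟨t, ht⟩ := exists_hasDivisibility modelForm (normalVector q r)
  have ht₂ : (2 : ℤ).natAbs = t := by
    refine ht.natAbs_eq_of_dvd ?_ ⟨(0, 1, 0), ?_⟩
    · rintro ⟨p', q', r', s', a, b, x⟩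
      simp only [normalVector, hyperbolicSum_apply, rankOneSum_apply, map_zero,
        LinearMap.zero_apply]
      exact ⟨q' + q * p' - ![0, 1, 1] r * a - ![0, 0, 1] r * b, by ring⟩
    · rw [normalVector, hyperbolicSum_apply, map_zero]
      norm_num
  rwa [← ht₂] at ht

theorem disc_ker_normalVector (q : ℤ) (r : Fin 3) :
    disc modelForm (LinearMap.ker (modelForm (normalVector q r))) = 8 * q - 2 * r := by
  have h := sq_mul_disc_ker (hasDivisibility_normalVector q r)
  rw [disc_modelForm, modelForm_normalVector_self] at h
  push_cast at h
  linarith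

theorem exists_sameOrbit_normalVector_of_two_dvd (q a b : ℤ) (x : Fin 8 × Fin 2 → ℤ) :
    ∃ q' r, SameOrbit modelForm (2, 2 * q, 0, 0, a, b, (2 : ℤ) • x) (normalVector q' r) := by
  have hdvd (y : ℤ × ℤ × (Fin 8 × Fin 2 → ℤ)) : 2 ∣ negModelForm (a, b, (2 : ℤ) • x) y := by
    obtain ⟨a', b', x'⟩ := y
    simp only [rankOneSum_apply, map_smul, LinearMap.smul_apply, smul_eq_mul]
    omega
  obtain ⟨q', hq'⟩ := exists_sameOrbit_add_smul negModelForm_symm even_negModelForm hdvd q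
    (-(a / 2), -(b / 2), -x)
  have hmod : (a, b, (2 : ℤ) • x) + (2 : ℤ) • (-(a / 2), -(b / 2), -x) = (a % 2, b % 2, 0) := by
    simp only [Prod.smul_mk, Prod.mk_add_mk, smul_eq_mul, smul_neg, add_neg_cancel]
    rw [Int.emod_def, Int.emod_def, mul_neg, mul_neg, ← sub_eq_add_neg, ← sub_eq_add_neg]
  rw [hmod] at hq'
  rcases Int.emod_two_eq_zero_or_one a with ha | ha <;>
    rcases Int.emod_two_eq_zero_or_one b with hb | hb <;> rw [ha, hb] at hq'
  · exact ⟨q', 0, hq'⟩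
  · exact ⟨q', 1, hq'.trans (.hyperbolicSum_right _ _ (.hyperbolicSum_right _ _
      (.rankOneSum_swap 0 1 0)))⟩
  · exact ⟨q', 1, hq'⟩
  · exact ⟨q', 2, hq'⟩

theorem exists_two_smul_eq_smul_normalVector
    {v : ℤ × ℤ × ℤ × ℤ × ℤ × ℤ × (Fin 8 × Fin 2 → ℤ)} (hv : modelForm v ≠ 0) :
    ∃ q r w, SameOrbit modelForm (normalVector q r) w ∧ ∃ n : ℤ, n ≠ 0 ∧ (2 : ℤ) • v = n • w := by
  obtain ⟨t, ht⟩ := exists_hasDivisibility modelForm v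
  have ht₀ : t ≠ 0 := by
    rintro rfl
    exact hv (LinearMap.ext fun x => zero_dvd_iff.1 (ht.dvd x))
  obtain ⟨q, ⟨a, b, x⟩, hw, hdvd⟩ :=
    exists_sameOrbit_of_hasDivisibility negModelForm_symm even_negModelForm ht₀ ht
  obtain ⟨a', ha⟩ : (t : ℤ) ∣ 2 * a := by simpa [rankOneSum_apply] using hdvd (1, 0, 0)
  obtain ⟨b', hb⟩ : (t : ℤ) ∣ 2 * b := by simpa [rankOneSum_apply] using hdvd (0, 1, 0)
  obtain ⟨x, rfl⟩ := exists_eq_smul_of_dvd_negE8SqForm (t := t) (x := x) fun y => by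
    simpa [rankOneSum_apply] using hdvd (0, 0, y)
  obtain ⟨q', r, hr⟩ := exists_sameOrbit_normalVector_of_two_dvd q a' b' x
  have hsmul : (2 : ℤ) • ((t, t * q, 0, 0, a, b, (t : ℤ) • x) :
      ℤ × ℤ × ℤ × ℤ × ℤ × ℤ × (Fin 8 × Fin 2 → ℤ)) =
      (t : ℤ) • (2, 2 * q, 0, 0, a', b', (2 : ℤ) • x) := by
    simp only [Prod.smul_mk, smul_eq_mul, ha, hb, smul_comm (2 : ℤ) (t : ℤ) x, mul_zero,
      mul_comm (2 : ℤ) (t : ℤ), mul_left_comm (2 : ℤ) (t : ℤ)]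
  have horbit := (hsmul ▸ hw.smul 2).trans (hr.smul t)
  obtain ⟨w, hw, hvw⟩ := horbit.exists_smul_eq_smul
  exact ⟨q', r, w, hw, t, Int.natCast_ne_zero.2 ht₀, hvw⟩

end NormalVector

section HeegnerVectors

theorem normalVector_mem_heegnerVectors {q : ℤ} {r : Fin 3} {d : ℕ} (hd : 0 < d)
    (hdr : (d : ℤ) = 2 * r - 8 * q) : normalVector q r ∈ heegnerVectors modelForm d := by
  rw [heegnerVectors, Set.mem_ofPred_eq, modelForm_normalVector_self, disc_ker_normalVector]
  omega

theorem exists_normalVector_of_mem_heegnerVectors {d : ℕ}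
    {v : ℤ × ℤ × ℤ × ℤ × ℤ × ℤ × (Fin 8 × Fin 2 → ℤ)} (hv : v ∈ heegnerVectors modelForm d) :
    ∃ (q : ℤ) (r : Fin 3) (w : _), SameOrbit modelForm (normalVector q r) w ∧
      (d : ℤ) = 2 * r - 8 * q ∧
      LinearMap.ker (modelForm v) = LinearMap.ker (modelForm w) := by
  obtain ⟨hneg, hdisc⟩ := hv
  have hv₀ : modelForm v ≠ 0 := fun h₀ => hneg.ne (by rw [h₀, LinearMap.zero_apply])
  obtain ⟨q, r, w, ⟨g, rfl⟩, n, hn, hvw⟩ := exists_two_smul_eq_smul_normalVector hv₀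
  have hker := ker_apply_eq_of_smul_eq_smul (b := modelForm) two_ne_zero hn hvw
  refine ⟨q, r, _, ⟨g, rfl⟩, ?_, hker⟩
  rw [hker, disc_ker_isometryEquiv, disc_ker_normalVector] at hdisc
  omega

theorem orthogonalLocus_heegnerVectors {q : ℤ} {r : Fin 3} {d : ℕ} (hd : 0 < d)
    (hdr : (d : ℤ) = 2 * r - 8 * q) :
    orthogonalLocus modelForm (heegnerVectors modelForm d) =
      orthogonalLocus modelForm {w | SameOrbit modelForm (normalVector q r) w} := by
  ext x
  constructor
  · rintro ⟨v, hv, hx⟩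
    obtain ⟨q', r', w, hw, hdr', hker⟩ := exists_normalVector_of_mem_heegnerVectors hv
    obtain ⟨rfl, hr⟩ : q' = q ∧ (r' : ℕ) = r := by omega
    obtain rfl := Fin.ext hr
    refine ⟨w, hw, ?_⟩
    rwa [ker_baseChange_one_tmul, ← hker, ← ker_baseChange_one_tmul]
  · rintro ⟨_, ⟨g, rfl⟩, hx⟩
    refine ⟨g (normalVector q r), ?_, hx⟩
    rw [← map_image_heegnerVectors g]
    exact Set.mem_image_of_mem g (normalVector_mem_heegnerVectors hd hdr)

end HeegnerVectors

section HeegnerLocus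

variable {L : Type*} [AddCommGroup L] {b : LinearMap.BilinForm ℤ L} {d : ℕ}

theorem gramForm_modelIsometry_normalVector_neg {q : ℤ} {r : Fin 3}
    (hqr : 0 < 2 * (r : ℤ) - 8 * q) :
    gramForm ℤ (tubeGram modelGram) (modelIsometry (normalVector q r))
      (modelIsometry (normalVector q r)) < 0 := by
  rw [modelIsometry.map_app, modelForm_normalVector_self]
  omega

theorem exists_normalVector_discriminant {e : ℕ} (he : ¬e ≡ 3 [MOD 4]) :
    ∃ (q : ℤ) (r : Fin 3), ((2 * e : ℕ) : ℤ) = 2 * r - 8 * q := by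
  have hr : e % 4 < 3 := by
    rw [Nat.ModEq] at he
    omega
  exact ⟨-(e / 4 : ℕ), ⟨e % 4, hr⟩, by push_cast; omega⟩

theorem orthogonalLocus_orbit_normalVector_nonempty (ψ : modelForm.IsometryEquiv b) {q : ℤ}
    {r : Fin 3} (hqr : 0 < 2 * (r : ℤ) - 8 * q) :
    (orthogonalLocus b {w | SameOrbit b (ψ (normalVector q r)) w}).Nonempty := by
  have hne := orthogonalLocus_orbit_nonempty modelGram_isSymm (modelIsometry.symm.trans ψ)
    two_ne_zero rfl rfl
    (gramForm_modelIsometry_normalVector_neg hqr)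
  rwa [isometryEquiv_symm_trans_apply] at hne

variable [Module.Free ℤ L] [Module.Finite ℤ L]

theorem orthogonalLocus_heegnerVectors_eq_orbit (ψ : modelForm.IsometryEquiv b) (hd : 0 < d)
    {q : ℤ} {r : Fin 3} (hdr : (d : ℤ) = 2 * r - 8 * q) :
    orthogonalLocus b (heegnerVectors b d) =
      orthogonalLocus b {w | SameOrbit b (ψ (normalVector q r)) w} := by
  rw [← map_image_heegnerVectors ψ, ← map_image_orthogonalLocus,
    orthogonalLocus_heegnerVectors hd hdr, map_image_orthogonalLocus, SameOrbit.image_setOf]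

theorem orthogonalLocus_heegnerVectors_nonempty_iff (ψ : modelForm.IsometryEquiv b) (hd : 0 < d) :
    (orthogonalLocus b (heegnerVectors b d)).Nonempty ↔ ∃ e, d = 2 * e ∧ ¬e ≡ 3 [MOD 4] := by
  constructor
  · rintro ⟨x, v, hv, -⟩
    rw [← map_image_heegnerVectors ψ] at hv
    obtain ⟨v, hv, rfl⟩ := hv
    obtain ⟨q, r, w, -, hdr, -⟩ := exists_normalVector_of_mem_heegnerVectors hv
    refine ⟨d / 2, by omega, fun he => ?_⟩
    rw [Nat.ModEq] at he
    omega
  · rintro ⟨e, rfl, he⟩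
    obtain ⟨q, r, hqr⟩ := exists_normalVector_discriminant he
    rw [orthogonalLocus_heegnerVectors_eq_orbit ψ hd hqr]
    exact orthogonalLocus_orbit_normalVector_nonempty ψ (by omega)

end HeegnerLocus

theorem isIrreducibleAnalytic_image_orthogonalLocus_heegnerVectors {Λ : Type*} [AddCommGroup Λ]
    [Module.Free ℤ Λ] [Module.Finite ℤ Λ] {B : LinearMap.BilinForm ℤ Λ} {h : Λ}
    (hγ : ∀ γ, InPeriodGroup B h γ) (ψ : modelForm.IsometryEquiv (perpForm B h))
    {d : ℕ} (hd : 0 < d)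
    (hne : (orthogonalLocus (perpForm B h) (heegnerVectors (perpForm B h) d)).Nonempty) :
    IsIrreducibleAnalytic
      (PeriodSpace.mk B h '' orthogonalLocus _ (heegnerVectors (perpForm B h) d)) := by
  obtain ⟨e, rfl, he⟩ := (orthogonalLocus_heegnerVectors_nonempty_iff ψ hd).1 hne
  obtain ⟨q, r, hqr⟩ := exists_normalVector_discriminant he
  have hirr := isIrreducibleAnalytic_image_orthogonalLocus modelGram_isSymm
    (fun _ => gramForm_modelGram_pos) hγ (modelIsometry.symm.trans ψ) two_ne_zero rfl rfl
    (gramForm_modelIsometry_normalVector_neg (q := q) (r := r) (by omega))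
  rw [isometryEquiv_symm_trans_apply] at hirr
  rwa [orthogonalLocus_heegnerVectors_eq_orbit ψ hd hqr]

/-! ### The lattices `h₂^⊥` and `h₃^⊥` -/

section Perp

variable {L L' : Type*} [AddCommGroup L] [AddCommGroup L'] {b : LinearMap.BilinForm ℤ L}
  {b' : LinearMap.BilinForm ℤ L'}

/-- The isometry `h^⊥ ≅ (g h)^⊥` induced by the isometry `g`. -/
def perpCongr (g : b.IsometryEquiv b') (h : L) :
    (perpForm b h).IsometryEquiv (perpForm b' (g h)) where
  toLinearEquiv := g.toLinearEquiv.ofSubmodules _ _ (map_ker_apply_isometryEquiv g h)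
  map_app' x y := g.map_app y x

variable {M : Type*} [AddCommGroup M]

/-- The isometry of `2U ⊕ ⟨-2⟩ ⊕ ⟨c⟩ ⊕ M` onto the complement of `e + f` in `3U ⊕ ⟨c⟩ ⊕ M`, where
`e, f` is the standard basis of the first `U`: the generator of `⟨-2⟩` is sent to `e - f`. -/
def oneOnePerpIsometry (c : ℤ) (B : LinearMap.BilinForm ℤ M) :
    (hyperbolicSum (hyperbolicSum (rankOneSum (-2) (rankOneSum c B)))).IsometryEquiv
      (perpForm (hyperbolicSum (hyperbolicSum (hyperbolicSum (rankOneSum c B)))) (1, 1, 0)) where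
  toFun := fun (p, q, r, s, a, b, x) => ⟨(a, -a, p, q, r, s, b, x), by
    rw [LinearMap.mem_ker, hyperbolicSum_apply, map_zero, LinearMap.zero_apply]
    ring⟩
  invFun := fun ⟨(a, _, p, q, r, s, b, x), _⟩ => (p, q, r, s, a, b, x)
  map_add' _ _ := Subtype.ext (Prod.ext rfl (Prod.ext (neg_add _ _) rfl))
  map_smul' _ _ := Subtype.ext (Prod.ext rfl (Prod.ext (mul_neg _ _).symm rfl))
  left_inv _ := rfl
  right_inv := by
    rintro ⟨⟨a, a', p, q, r, s, b, x⟩, hperp⟩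
    rw [LinearMap.mem_ker, hyperbolicSum_apply, map_zero, LinearMap.zero_apply] at hperp
    obtain rfl : a' = -a := by linarith
    rfl
  map_app' := by
    rintro ⟨p, q, r, s, a, b, x⟩ ⟨p', q', r', s', a', b', x'⟩
    simp only [LinearMap.BilinForm.restrict_apply, LinearMap.domRestrict_apply,
      hyperbolicSum_apply, rankOneSum_apply]
    ring

/-- The isometry of `2U ⊕ ⟨-2⟩² ⊕ M` onto the complement of `2 (e + f) + δ` in `3U ⊕ ⟨-4⟩ ⊕ M`,
where `e, f` is the standard basis of the first `U` and `δ` the generator of `⟨-4⟩`: the generators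
of `⟨-2⟩²` are sent to `e + f + δ` and `e - f`. -/
def twoTwoPerpIsometry (B : LinearMap.BilinForm ℤ M) :
    (hyperbolicSum (hyperbolicSum (rankOneSum (-2) (rankOneSum (-2) B)))).IsometryEquiv
      (perpForm (hyperbolicSum (hyperbolicSum (hyperbolicSum (rankOneSum (-4) B))))
        (2, 2, 0, 0, 0, 0, 1, 0)) where
  toFun := fun (p, q, r, s, a, b, x) => ⟨(a + b, a - b, p, q, r, s, a, x), by
    simp only [LinearMap.mem_ker, hyperbolicSum_apply, rankOneSum_apply, map_zero,
      LinearMap.zero_apply]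
    ring⟩
  invFun := fun ⟨(a, _, p, q, r, s, b, x), _⟩ => (p, q, r, s, b, a - b, x)
  map_add' _ _ :=
    Subtype.ext (Prod.ext (add_add_add_comm _ _ _ _) (Prod.ext (add_sub_add_comm _ _ _ _) rfl))
  map_smul' _ _ :=
    Subtype.ext (Prod.ext (mul_add _ _ _).symm (Prod.ext (mul_sub _ _ _).symm rfl))
  left_inv := fun (p, q, r, s, a, b, x) => by simp only [add_sub_cancel_left]
  right_inv := by
    rintro ⟨⟨a, a', p, q, r, s, b, x⟩, hperp⟩
    simp only [LinearMap.mem_ker, hyperbolicSum_apply, rankOneSum_apply, map_zero,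
      LinearMap.zero_apply] at hperp
    obtain rfl : a' = b - (a - b) := by linarith
    simp only [add_sub_cancel]
  map_app' := by
    rintro ⟨p, q, r, s, a, b, x⟩ ⟨p', q', r', s', a', b', x'⟩
    simp only [LinearMap.BilinForm.restrict_apply, LinearMap.domRestrict_apply,
      hyperbolicSum_apply, rankOneSum_apply]
    ring

end Perp

section K3m

theorem k3mGram_isSymm (m : ℕ) : (k3mGram m).IsSymm := by
  refine (Matrix.IsSymm.fromBlocks ?_ (by simp) ?_).fromBlocks (by simp) rfl
  · exact (Matrix.blockDiagonal_transpose _).trans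
      (congrArg Matrix.blockDiagonal (funext fun _ => by decide))
  · exact (Matrix.blockDiagonal_transpose _).trans
      (congrArg Matrix.blockDiagonal (funext fun _ => by
        rw [Matrix.transpose_neg, CartanMatrix.E₈_transpose]))

theorem k3mForm_symm (m : ℕ) (x y : K3mLattice) : k3mForm m x y = k3mForm m y x := by
  rw [k3mForm, ← gramForm_int]
  exact gramForm_symm (k3mGram_isSymm m) x y

theorem k3Gram_eq : k3Gram =
    Matrix.fromBlocks (Matrix.blockDiagonal fun _ : Fin 3 => !![0, 1; 1, 0]) 0 0 (-e8SqGram) := by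
  rw [k3Gram, e8SqGram, ← Matrix.blockDiagonal_neg]
  rfl

theorem k3mForm_apply (m : ℕ) (x y : K3mLattice) : k3mForm m x y =
    ∑ k, (x (.inl (.inl (0, k))) * y (.inl (.inl (1, k))) +
        x (.inl (.inl (1, k))) * y (.inl (.inl (0, k)))) +
      negE8SqForm (fun i => x (.inl (.inr i))) (fun i => y (.inl (.inr i))) +
      (2 - 2 * m) * (x (.inr ()) * y (.inr ())) := by
  rw [k3mForm, ← gramForm_int, k3mGram, gramForm_fromBlocks, k3Gram_eq, gramForm_fromBlocks,
    gramForm_blockDiagonal]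
  simp only [gramForm_apply, Fin.sum_univ_two, Function.comp_apply, Matrix.of_apply,
    Matrix.cons_val', Matrix.cons_val_fin_one, Matrix.cons_val_zero, Matrix.cons_val_one,
    Finset.univ_unique, Finset.sum_singleton, PUnit.default_eq_unit, Int.cast_id,
    mul_zero, zero_mul, mul_one, zero_add, add_zero]
  ring

/-- The isometry `Λ_{K3^[m]} ≅ 3U ⊕ ⟨-(2m - 2)⟩ ⊕ E₈(-1)²`. -/
def k3mIsometry {m : ℕ} {c : ℤ} (hc : c = 2 - 2 * m) : (k3mForm m).IsometryEquiv
    (hyperbolicSum (hyperbolicSum (hyperbolicSum (rankOneSum c negE8SqForm)))) where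
  toFun x := (x (.inl (.inl (0, 0))), x (.inl (.inl (1, 0))), x (.inl (.inl (0, 1))),
    x (.inl (.inl (1, 1))), x (.inl (.inl (0, 2))), x (.inl (.inl (1, 2))), x (.inr ()),
    fun i => x (.inl (.inr i)))
  invFun := fun (p, q, r, s, u, v, a, x) =>
    Sum.elim (Sum.elim (fun i => !![p, r, u; q, s, v] i.1 i.2) x) fun _ => a
  map_add' _ _ := rfl
  map_smul' _ _ := rfl
  left_inv x := by
    funext i
    rcases i with (⟨i, j⟩ | i) | i
    · fin_cases i <;> fin_cases j <;> rfl
    · rfl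
    · rfl
  right_inv _ := rfl
  map_app' x y := by
    simp only [hyperbolicSum_apply, rankOneSum_apply]
    rw [k3mForm_apply, Fin.sum_univ_three, hc]
    ring

theorem exists_isometryEquiv_apply_eq_one_one {h : K3mLattice} (hsq : k3mForm 2 h h = 2)
    (hdiv : HasDivisibility (k3mForm 2) h 1) :
    ∃ g : (k3mForm 2).IsometryEquiv
        (hyperbolicSum (hyperbolicSum (hyperbolicSum (rankOneSum (-2) negE8SqForm)))),
      g h = (1, 1, 0) := by
  have hsymm := hyperbolicSum_symm (rankOneSum_symm (c := -2) negE8SqForm_symm)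
  have heven := even_hyperbolicSum (even_rankOneSum (c := -2) (by decide) even_negE8SqForm)
  let g₀ := k3mIsometry (m := 2) (c := -2) (by norm_num)
  obtain ⟨q, x, hx, hdvd⟩ := exists_sameOrbit_of_hasDivisibility hsymm heven one_ne_zero
    (hdiv.map g₀)
  obtain ⟨q', hq'⟩ := exists_sameOrbit_add_smul hsymm heven hdvd q (-x)
  have horbit := hx.trans hq'
  rw [Nat.cast_one, one_smul, add_neg_cancel, one_mul] at horbit
  have hnorm := horbit.apply_self
  rw [g₀.map_app, hsq, hyperbolicSum_apply, hyperbolicSum_apply, map_zero] at hnorm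
  obtain rfl : q' = 1 := by omega
  obtain ⟨g, hg⟩ := horbit
  exact ⟨g₀.trans g, hg⟩

theorem exists_isometryEquiv_apply_eq_two_two {h : K3mLattice} (hsq : k3mForm 3 h h = 4)
    (hdiv : HasDivisibility (k3mForm 3) h 2) :
    ∃ g : (k3mForm 3).IsometryEquiv
        (hyperbolicSum (hyperbolicSum (hyperbolicSum (rankOneSum (-4) negE8SqForm)))),
      g h = (2, 2, 0, 0, 0, 0, 1, 0) := by
  have hsymm := hyperbolicSum_symm (rankOneSum_symm (c := -4) negE8SqForm_symm)
  have heven := even_hyperbolicSum (even_rankOneSum (c := -4) (by decide) even_negE8SqForm)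
  let g₀ := k3mIsometry (m := 3) (c := -4) (by norm_num)
  obtain ⟨q, ⟨u, v, a, x⟩, hx, hdvd⟩ := exists_sameOrbit_of_hasDivisibility hsymm heven
    two_ne_zero (hdiv.map g₀)
  obtain ⟨u, rfl⟩ : (2 : ℤ) ∣ u := by simpa [hyperbolicSum_apply] using hdvd (0, 1, 0)
  obtain ⟨v, rfl⟩ : (2 : ℤ) ∣ v := by simpa [hyperbolicSum_apply] using hdvd (1, 0, 0)
  obtain ⟨x, rfl⟩ := exists_eq_smul_of_dvd_negE8SqForm (t := 2) (x := x) fun y => by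
    simpa [hyperbolicSum_apply, rankOneSum_apply] using hdvd (0, 0, 0, y)
  obtain ⟨q', hq'⟩ := exists_sameOrbit_add_smul hsymm heven hdvd q (-u, -v, -(a / 2), -x)
  have hmod : (2 * u, 2 * v, a, (2 : ℤ) • x) + ((2 : ℕ) : ℤ) • (-u, -v, -(a / 2), -x) =
      (0, 0, a % 2, 0) := by
    simp only [Nat.cast_ofNat, Prod.smul_mk, Prod.mk_add_mk, smul_eq_mul, mul_neg, smul_neg,
      add_neg_cancel, Int.emod_def, sub_eq_add_neg]
  rw [hmod] at hq'
  have horbit := hx.trans hq'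
  have hnorm := horbit.apply_self
  rw [g₀.map_app, hsq] at hnorm
  simp only [hyperbolicSum_apply, rankOneSum_apply, map_zero, Nat.cast_ofNat] at hnorm
  obtain ⟨ha, rfl⟩ : a % 2 = 1 ∧ q' = 1 := by
    rcases Int.emod_two_eq_zero_or_one a with ha | ha <;> rw [ha] at hnorm <;> omega
  rw [ha] at horbit
  obtain ⟨g, hg⟩ := horbit
  exact ⟨g₀.trans g, hg⟩

theorem modelForm_equivalent_perpForm_two {h : K3mLattice} (hsq : k3mForm 2 h h = 2)
    (hdiv : HasDivisibility (k3mForm 2) h 1) :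
    modelForm.Equivalent (perpForm (k3mForm 2) h) := by
  obtain ⟨g, hg⟩ := exists_isometryEquiv_apply_eq_one_one hsq hdiv
  exact ⟨(oneOnePerpIsometry (-2) negE8SqForm).trans (hg ▸ perpCongr g h).symm⟩

theorem modelForm_equivalent_perpForm_three {h : K3mLattice} (hsq : k3mForm 3 h h = 4)
    (hdiv : HasDivisibility (k3mForm 3) h 2) :
    modelForm.Equivalent (perpForm (k3mForm 3) h) := by
  obtain ⟨g, hg⟩ := exists_isometryEquiv_apply_eq_two_two hsq hdiv
  exact ⟨(twoTwoPerpIsometry negE8SqForm).trans (hg ▸ perpCongr g h).symm⟩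

end K3m

end K3Heegner

end

open K3Heegner in
theorem mainTheorem11 (h₂ h₃ : K3mLattice)
    (hsq₂ : k3mForm 2 h₂ h₂ = 2) (hdiv₂ : HasDivisibility (k3mForm 2) h₂ 1)
    (hsq₃ : k3mForm 3 h₃ h₃ = 4) (hdiv₃ : HasDivisibility (k3mForm 3) h₃ 2) :
    (perpForm (k3mForm 2) h₂).Equivalent (perpForm (k3mForm 3) h₃) ∧
    ∀ d : ℕ, 0 < d →
      ((heegnerDivisor (k3mForm 3) h₃ d).Nonempty ↔ ∃ e : ℕ, d = 2 * e ∧ ¬ e ≡ 3 [MOD 4]) ∧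
      ((heegnerDivisor (k3mForm 3) h₃ d).Nonempty →
        IsIrreducibleAnalytic (heegnerDivisor (k3mForm 3) h₃ d) ∧
        ∀ φ : (perpForm (k3mForm 2) h₂).IsometryEquiv (perpForm (k3mForm 3) h₃),
          rho hsq₃ hdiv₃ φ '' heegnerDivisor (k3mForm 2) h₂ d =
            heegnerDivisor (k3mForm 3) h₃ d) := by
  obtain ⟨ψ₂⟩ := modelForm_equivalent_perpForm_two hsq₂ hdiv₂
  obtain ⟨ψ₃⟩ := modelForm_equivalent_perpForm_three hsq₃ hdiv₃
  refine ⟨⟨ψ₂.symm.trans ψ₃⟩, fun d hd => ?_⟩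
  rw [heegnerDivisor_eq_image_orthogonalLocus (k3mForm_symm 3) (hsq₃ ▸ four_pos) d,
    heegnerDivisor_eq_image_orthogonalLocus (k3mForm_symm 2) (hsq₂ ▸ two_pos) d,
    Set.image_nonempty]
  refine ⟨orthogonalLocus_heegnerVectors_nonempty_iff ψ₃ hd, fun hne => ⟨?_, fun φ => ?_⟩⟩
  · exact isIrreducibleAnalytic_image_orthogonalLocus_heegnerVectors
      (inPeriodGroup_of_sq_of_div hsq₃ hdiv₃) ψ₃ hd hne
  · rw [← map_image_heegnerVectors φ, ← map_image_orthogonalLocus φ, Set.image_image,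
      Set.image_image]
    rfl
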